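/- **Theorem 3.5 (No zero–one law).** Consider a polling system with one server and three nodes $1,2,3$. Jobs arrive at the nodes in independent Poisson streams of rates $\lambda_i>0$. The service times at node $i$ are i.i.d., independent of the arrivals, with mean $\mu_i^{-1}\in(0,\infty)$ and finite variance. Put $\rho_i=\lambda_i/\mu_i$ and assume $$\rho_i<1\quad(i=1,2,3),\qquad \rho_1+\rho_2+\rho_3>1 .$$ The server serves its node until the queue there is empty and then switches instantaneously. For $(i,j,k)$ a cyclic permutation of $(1,2,3)$ and *decision points* $d_1,d_2,d_3\in(0,1)$, a server that has emptied queue $i$ and leaves queue lengths $(x_j,x_k)\neq(0,0)$ behind goes to $j$ if $x_k/(x_j+x_k)<d_i$ and to $k$ if $x_k/(x_j+x_k)>d_i$; in case of equality any randomized rule, depending on the present state, may be used. If the system is empty, the server waits for the next arrival and goes to its node. Let $\Xi=(\xi(t),s(t))_{t\ge0}$ be the Markov chain of queue lengths and server location at the epochs of service completion and switching, let $\tau_0<\tau_1<\cdots$ be the successive epochs at which the server has emptied its queue while the system is not empty, and let $$\zeta(n)=\Lambda(\xi(\tau_n)),\qquad \Lambda(y)=\frac{y}{y_1+y_2+y_3}.$$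 Let $\operatorname{Side}(\zeta(n))$ be the node whose queue is emptied at $\tau_n$. A trajectory of $\zeta$ is *nonperiodic* if there are no $m\ge1$ and $N$ such that $\operatorname{Side}(\zeta(n+m))=\operatorname{Side}(\zeta(n))$ for all $n\ge N$. The *triangle process* $Z$ is the deterministic system $z(t+1)\in\varphi(z(t))$ on the boundary of the simplex $\{z\in\mathbb R_+^3:\sum_i z_i=1\}$ given as follows. Let $$\bigl(f_j(z)\bigr)_j=0,\qquad \bigl(f_j(z)\bigr)_i=\frac{(\mu_j-\lambda_j)z_i+\lambda_i z_j}{(\mu_j-\lambda_j)+\mu_j\theta_j z_j}\quad(i\ne j),\qquad \theta_j=\mu_j^{-1}\sum_i\lambda_i-1 .$$ For $z$ with $z_i=0$ and $(i,j,k)$ a cyclic permutation of $(1,2,3)$, $\varphi(z)$ contains $f_j(z)$ if $z_k\le d_i$ and $f_k(z)$ if $z_k\ge d_i$ (both images are allowed when $z_k=d_i$). A *periodic orbit* of $Z$ is a finite sequence $u_1,\dots,u_m$ with $u_{n+1}\in\varphi(u_n)$ for $n<m$ and $u_1\in\varphi(u_m)$. The process $\zeta$ *converges to* it if for some $n_0\ge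 0$ one has $\zeta(mt+n+n_0)\to u_n$ as $t\to\infty$ for each $n=1,\dots,m$. For all rates $\lambda_i,\mu_i$ as above there exist decision points $d_1,d_2,d_3\in(0,1)$ such that, for all service time distributions as above, every rule for ties and every initial state of $\Xi$: 1. with positive probability the trajectory of $\zeta$ is nonperiodic; 2. there is a periodic orbit of $Z$ to which $\zeta$ converges with positive probability. -/

import Mathlib

open MeasureTheory ProbabilityTheory Filter
open scoped NNReal ENNReal Topology

noncomputable section

namespace Polling

/-! Nodes are indexed by `Fin 3` with its cyclic addition: for a node `i`, the triple
`(i, i + 1, i + 2)` is the cyclic permutation of the three nodes that starts at `i`. -/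

/-- Arrival rates `lam i` and service rates `mu i` (so that the mean service time at node `i`
is `1 / mu i`). -/
structure Rates where
  lam : Fin 3 → ℝ≥0
  mu : Fin 3 → ℝ≥0
  lam_pos : ∀ i, 0 < lam i
  mu_pos : ∀ i, 0 < mu i

namespace Rates

/-- The traffic intensity at node `i`. -/
def rho (r : Rates) (i : Fin 3) : ℝ := r.lam i / r.mu i

def theta (r : Rates) (j : Fin 3) : ℝ := (∑ i, (r.lam i : ℝ)) / r.mu j - 1

end Rates

/-! ### The triangle process -/

/-- The boundary `A⁰` of the unit simplex: the union over `i` of the sides `{z | z i = 0}`. -/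
def Triangle : Set (Fin 3 → ℝ) :=
  {z | (∀ i, 0 ≤ z i) ∧ ∑ i, z i = 1 ∧ ∃ i, z i = 0}

/-- The distance on the triangle: the Euclidean distance divided by `√2`. -/
def dist₁ (z w : Fin 3 → ℝ) : ℝ := Real.sqrt (∑ i, (z i - w i) ^ 2) / Real.sqrt 2

/-- The projection `Λ(y) = y / ∑ y_i`. -/
def proj (y : Fin 3 → ℝ) : Fin 3 → ℝ := fun i => y i / ∑ k, y k

/-- The map `f_j` sending a point of the triangle to the projection of the point at which the
particle, served at node `j`, empties queue `j`. -/
def serve (r : Rates) (j : Fin 3) (z : Fin 3 → ℝ) : Fin 3 → ℝ := fun i =>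
  if i = j then 0
  else (((r.mu j : ℝ) - r.lam j) * z i + r.lam i * z j) /
    (((r.mu j : ℝ) - r.lam j) + r.mu j * r.theta j * z j)

/-- The (branching) map `φ`, as a relation: on side `i`, the point
`z = (1 - x) e_{i+1} + x e_{i+2}` goes to `f_{i+1} z` if `x ≤ d i` and to `f_{i+2} z`
if `x ≥ d i`; both images are allowed when `x = d i`. -/
def Step (r : Rates) (d : Fin 3 → ℝ) (z w : Fin 3 → ℝ) : Prop :=
  ∃ i, z i = 0 ∧
    ((z (i + 2) ≤ d i ∧ w = serve r (i + 1) z) ∨ (d i ≤ z (i + 2) ∧ w = serve r (i + 2) z))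

/-- `u` is a periodic orbit of the triangle process with `m` points
(indices are taken modulo `m`). -/
def IsPeriodicOrbit (r : Rates) (d : Fin 3 → ℝ) (m : ℕ) [NeZero m]
    (u : Fin m → Fin 3 → ℝ) : Prop :=
  (∀ n, u n ∈ Triangle) ∧ ∀ n, Step r d (u n) (u (n + 1))

/-- The sequence `z` converges onto the orbit `u`. -/
def ConvergesOnto (z : ℕ → Fin 3 → ℝ) (m : ℕ) (u : Fin m → Fin 3 → ℝ) : Prop :=
  ∃ n₀ : ℕ, ∀ n : Fin m,
    Tendsto (fun t : ℕ => dist₁ (z (m * t + n + n₀)) (u n)) atTop (𝓝 0)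

/-- A sequence of sides is eventually `m`-periodic. -/
def EventuallyPeriodic (side : ℕ → Fin 3) (m : ℕ) : Prop :=
  ∃ N, ∀ n, N ≤ n → side (n + m) = side n

/-! ### The stochastic model -/

/-- Service time distributions on `[0, ∞)` with mean `1 / mu i` and finite second moment. -/
structure ServiceLaws (r : Rates) where
  law : Fin 3 → Measure ℝ≥0
  isProb : ∀ i, IsProbabilityMeasure (law i)
  mean : ∀ i, ∫⁻ s, (s : ℝ≥0∞) ∂(law i) = (r.mu i : ℝ≥0∞)⁻¹
  secondMoment : ∀ i, ∫⁻ s, (s : ℝ≥0∞) ^ 2 ∂(law i) < ∞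

/-- The state of the embedded chain: queue lengths and server location. -/
abbrev State : Type := (Fin 3 → ℕ) × Fin 3

/-- The law of the numbers of arrivals at the three nodes during a time interval of length `s`:
independent Poisson variables with means `lam i * s`. -/
def poissonArrivals (r : Rates) (s : ℝ≥0) : Measure (Fin 3 → ℕ) :=
  Measure.pi fun i => poissonMeasure (r.lam i * s)

/-- The law of the numbers of arrivals during one service at node `j`. -/
def arrivals {r : Rates} (S : ServiceLaws r) (j : Fin 3) : Measure (Fin 3 → ℕ) :=
  (S.law j).bind (poissonArrivals r)

/-- Tie-breaking: the probability that the server goes from `i` to `i + 1` (rather than to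
`i + 2`) when the queue lengths are `x` and the rule at node `i` is undecided. -/
abbrev TieRule : Type := (Fin 3 → ℕ) → Fin 3 → unitInterval

/-- The real vector of queue lengths. -/
def toReal (x : Fin 3 → ℕ) : Fin 3 → ℝ := fun i => x i

open scoped Classical in
/-- The probability that a server which has just emptied queue `i`, with queue lengths
`x ≠ 0` left behind, goes to node `i + 1`; otherwise it goes to node `i + 2`. -/
def probNext (d : Fin 3 → ℝ) (tie : TieRule) (x : Fin 3 → ℕ) (i : Fin 3) : unitInterval :=
  if proj (toReal x) (i + 2) < d i then 1
  else if d i < proj (toReal x) (i + 2) then 0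
  else tie x i

/-- The one-step transition law of the embedded chain `Ξ`, observed at service completions and
at (instantaneous) switchings.
* If the queue at the server is not empty, one job is served there, and arrivals take place at
  all nodes during its service time.
* If the queue at the server is empty and the system is not, the server switches to another
  node by the threshold rule with decision points `d`.
* If the system is empty, the server waits for the next arrival and goes to its node. -/
def transition {r : Rates} (S : ServiceLaws r) (d : Fin 3 → ℝ) (tie : TieRule)
    (s : State) : Measure State :=
  if s.1 s.2 ≠ 0 then
    (arrivals S s.2).map fun a => (s.1 - Pi.single s.2 1 + a, s.2)
  else if s.1 ≠ 0 then
    ENNReal.ofReal (probNext d tie s.1 s.2) • Measure.dirac (s.1, s.2 + 1) +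
      ENNReal.ofReal (1 - probNext d tie s.1 s.2) • Measure.dirac (s.1, s.2 + 2)
  else
    ∑ i, ((r.lam i : ℝ≥0∞) / ∑ k, (r.lam k : ℝ≥0∞)) • Measure.dirac (Pi.single i 1, i)

/-- The transition kernel of `Ξ`. -/
def kernel {r : Rates} (S : ServiceLaws r) (d : Fin 3 → ℝ) (tie : TieRule) :
    Kernel State State :=
  Kernel.ofFunOfCountable (transition S d tie)

instance {r : Rates} (s : ℝ≥0) : IsProbabilityMeasure (poissonArrivals r s) := by
  unfold poissonArrivals; infer_instance

theorem measurable_poissonArrivals (r : Rates) : Measurable (poissonArrivals r) := by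
  refine Measure.measurable_of_measurable_coe _ fun B _ => ?_
  have h : ∀ s, poissonArrivals r s B = ∑' a : B, poissonArrivals r s {(a : Fin 3 → ℕ)} := by
    intro s
    rw [← measure_biUnion (Set.to_countable B)]
    · simp
    · intro a _ b _ hab
      simpa [Function.onFun] using hab
    · intro a _
      exact MeasurableSet.of_discrete
  simp_rw [h]
  refine Measurable.tsum fun a => ?_
  simp_rw [poissonArrivals, Measure.pi_singleton, poissonMeasure_singleton]
  fun_prop

instance {r : Rates} (S : ServiceLaws r) (j : Fin 3) : IsProbabilityMeasure (arrivals S j) := by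
  have := S.isProb j
  constructor
  rw [arrivals, Measure.bind_apply MeasurableSet.univ (measurable_poissonArrivals r).aemeasurable]
  simp

instance {r : Rates} (S : ServiceLaws r) (d : Fin 3 → ℝ) (tie : TieRule) :
    IsMarkovKernel (kernel S d tie) := by
  refine ⟨fun s => ?_⟩
  change IsProbabilityMeasure (transition S d tie s)
  unfold transition
  split_ifs
  · exact Measure.isProbabilityMeasure_map (measurable_of_countable _).aemeasurable
  · constructor
    have h0 := (probNext d tie s.1 s.2).2.1
    have h1 := (probNext d tie s.1 s.2).2.2
    simp only [Measure.add_apply, Measure.smul_apply, measure_univ, smul_eq_mul, mul_one]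
    rw [← ENNReal.ofReal_add h0 (by linarith)]
    simp
  · constructor
    have hp : (∑ k, (r.lam k : ℝ≥0∞)) ≠ 0 := by
      have := (r.lam_pos 0).ne'
      simp [Finset.sum_eq_zero_iff, Fin.forall_fin_succ, this]
    have ht : (∑ k, (r.lam k : ℝ≥0∞)) ≠ ∞ := by simp
    simp only [Measure.coe_finsetSum, Finset.sum_apply, Measure.smul_apply, measure_univ,
      smul_eq_mul, mul_one]
    simp_rw [div_eq_mul_inv]
    rw [← Finset.sum_mul, ENNReal.mul_inv_cancel hp ht]

/-- The kernel of `Ξ` at time `n` as a function of the whole past: it depends on the present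
state only. -/
def historyKernel {r : Rates} (S : ServiceLaws r) (d : Fin 3 → ℝ) (tie : TieRule) (n : ℕ) :
    Kernel (Π _ : Finset.Iic n, State) State :=
  (kernel S d tie).comap (fun h => h ⟨n, Finset.mem_Iic.2 le_rfl⟩) (measurable_pi_apply _)

instance {r : Rates} (S : ServiceLaws r) (d : Fin 3 → ℝ) (tie : TieRule) (n : ℕ) :
    IsMarkovKernel (historyKernel S d tie n) := by
  unfold historyKernel; infer_instance

/-- The law, on the space of sequences of states, of the Markov chain `Ξ` started from `s₀`. -/
def chainLaw {r : Rates} (S : ServiceLaws r) (d : Fin 3 → ℝ) (tie : TieRule) (s₀ : State) :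
    Measure (ℕ → State) :=
  Kernel.trajMeasure (X := fun _ => State) (Measure.dirac s₀) (historyKernel S d tie)

instance {r : Rates} (S : ServiceLaws r) (d : Fin 3 → ℝ) (tie : TieRule) (s₀ : State) :
    IsProbabilityMeasure (chainLaw S d tie s₀) := by
  unfold chainLaw; infer_instance

/-- The epochs at which the server changes queues: the queue at the server is empty, while the
system is not. -/
def switchTimes (ω : ℕ → State) : Set ℕ := {t | (ω t).1 (ω t).2 = 0 ∧ (ω t).1 ≠ 0}

/-- The `n`-th switching epoch `τ_n`, counted from `n = 0` (meaningful when there are more than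
`n` switching epochs). -/
def tau (ω : ℕ → State) (n : ℕ) : ℕ := Nat.nth (· ∈ switchTimes ω) n

/-- The stochastic triangle process `ζ(n) = Λ(ξ(τ_n))`. -/
def zeta (ω : ℕ → State) (n : ℕ) : Fin 3 → ℝ := proj (toReal (ω (tau ω n)).1)

/-- The side of the triangle on which `ζ(n)` lies: the node whose queue has just been emptied. -/
def zetaSide (ω : ℕ → State) (n : ℕ) : Fin 3 := (ω (tau ω n)).2

/-- The trajectory of `ζ` is infinite and is not eventually `m`-periodic for any `m`. -/
def zetaNonperiodic : Set (ℕ → State) :=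
  {ω | (switchTimes ω).Infinite ∧ ∀ m, 0 < m → ¬ EventuallyPeriodic (zetaSide ω) m}

/-- The trajectory of `ζ` is infinite and converges onto the orbit `u`. -/
def zetaConvergesOnto (m : ℕ) (u : Fin m → Fin 3 → ℝ) : Set (ℕ → State) :=
  {ω | (switchTimes ω).Infinite ∧ ConvergesOnto (zeta ω) m u}

end Polling

end

/-! Measure each queue in units of its arrival rate. Up to scale, a state on side `i` is then one
ratio `R`, of queue `i + 2` to queue `i + 1`. In the fluid limit, emptying queue `i + 1` or `i + 2`
acts as `R ↦ 1 / (1 + β R)` or `R ↦ 1 + β / R`, where `β` belongs to the node served. Both maps are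
decreasing; the first has values below `1`, the second above `1`. Decision points become thresholds
for `R`.

Thresholds can be placed so that two regimes coexist. The cycle `0 → 2 → 1 → 0` carries a periodic
orbit `v` with ratios above `1`, which is attracting because relative errors contract. Below `v 0`
there is an interval `[l, c]` around `1` on side `0` to which the process returns after four steps,
by `0 → 1 → 2 → 1 → 0` or by `0 → 2 → 1 → 2 → 0`. Both return maps are increasing, as compositions
of four decreasing maps, and their images lie on opposite sides of `1`. This is a contracted
rotation, and a suitable threshold `D` at node `0` makes it semiconjugate to an irrational rotation
(`GapPair.exists_threshold`, `exists_four_step_blocks`). An eventually periodic itinerary would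
shift the bounded rotation coordinate by a fixed nonzero amount per period, which is impossible; the
argument tolerates vanishing errors (`not_eventually_periodic_coding`).

In the random system the workload `w` grows by a fixed factor at each switch, since the total load
exceeds `1`. The squared deviation from the fluid target over one service period has mean of order
`w`, so exceeding `w ^ (3 / 2)` has probability of order `w ^ (-1 / 2)`, which is summable along
geometric growth. The superharmonic function `lyapunov` encodes this sum. Hence from a large state
the chain follows the fluid model forever with positive probability (`exists_follow`), with relative
errors tending to zero (`exists_noisyOrbit`). All states can be reached from every initial state, so
either regime can be entered. -/

namespace Polling

/-! ### Contracted rotations with irrational rotation number -/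

/-- The forward orbit of an irrational rotation visits every interval. -/
theorem exists_fract_sub_mul_mem_Ioo {α : ℝ} (hα : Irrational α) (x : ℝ) {a b : ℝ}
    (ha : 0 ≤ a) (hab : a < b) (hb : b ≤ 1) :
    ∃ n : ℕ, Int.fract (x - n * α) ∈ Set.Ioo a b := by
  -- In the compact circle group a forward orbit is dense as soon as the two-sided orbit is.
  have hd : DenseRange (fun n : ℕ => n • ((-α : ℝ) : AddCircle (1 : ℝ))) := by
    rw [← denseRange_zsmul_iff_nsmul, AddCircle.denseRange_zsmul_coe_iff]
    simpa using hα
  have ho : IsOpen ((fun z : AddCircle (1 : ℝ) => (x : AddCircle (1 : ℝ)) + z) ⁻¹'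
      ((fun y : ℝ => (y : AddCircle (1 : ℝ))) '' Set.Ioo a b)) := by
    refine IsOpen.preimage (by fun_prop) ?_
    exact QuotientAddGroup.isOpenMap_coe _ isOpen_Ioo
  obtain ⟨n, hn⟩ := hd.exists_mem_open ho (by
    refine ⟨(((a + b) / 2 : ℝ) : AddCircle (1 : ℝ)) - x, (a + b) / 2, ⟨?_, ?_⟩, ?_⟩
    · linarith
    · linarith
    · simp)
  obtain ⟨y, hy, hyn⟩ := hn
  refine ⟨n, ?_⟩
  have h1 : ((y - (x - n * α) : ℝ) : AddCircle (1 : ℝ)) = 0 := by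
    simp only at hyn
    rw [AddCircle.coe_sub, hyn, sub_eq_zero, sub_eq_add_neg, AddCircle.coe_add]
    congr 1
    rw [← nsmul_eq_mul, ← smul_neg]
    rfl
  obtain ⟨k, hk⟩ := (AddCircle.coe_eq_zero_iff _).1 h1
  have h2 : x - n * α = y - k := by
    simp only [zsmul_eq_mul, mul_one] at hk
    linarith
  rw [h2, Int.fract_sub_intCast, Int.fract_eq_self.2 ⟨ha.trans hy.1.le, hy.2.trans_le hb⟩]
  exact hy

/-- Data of a contracted rotation: two strictly increasing branches `f` (moving up) and `g`
(moving down) of an interval whose images are separated. -/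
structure GapPair (l c b : ℝ) (f g : ℝ → ℝ) : Prop where
  le : l ≤ c
  mono_up : StrictMonoOn f (Set.Icc l c)
  mono_down : StrictMonoOn g (Set.Icc l c)
  mapsTo_up : Set.MapsTo f (Set.Icc l c) (Set.Icc l c)
  mapsTo_down : Set.MapsTo g (Set.Icc l c) (Set.Icc l c)
  lt_up : ∀ x ∈ Set.Icc l c, b < f x
  down_lt : ∀ x ∈ Set.Icc l c, g x < b

namespace GapPair

variable {l c b : ℝ} {f g : ℝ → ℝ}

/-- The rotation by `α` embeds monotonically into the contracted rotation. -/
theorem exists_monotone_conj (H : GapPair l c b f g) {α : ℝ} (h0 : 0 < α) (h1 : α < 1) :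
    ∃ h : ℝ → ℝ, MonotoneOn h (Set.Ico 0 1) ∧ Set.MapsTo h (Set.Ico 0 1) (Set.Icc l c) ∧
      (∀ θ ∈ Set.Ico α 1, h θ = f (h (θ - α))) ∧
      (∀ θ ∈ Set.Ico 0 α, h θ = g (h (θ - α + 1))) := by
  classical
  have : Fact (l ≤ c) := ⟨H.le⟩
  -- Fixed points of this operator solve the two functional equations. It preserves monotonicity:
  -- inside a branch because `f` and `g` increase, across `α` because the values of `g` lie below
  -- `b` and those of `f` above. Monotone maps into `[l, c]` form a complete lattice, so
  -- Knaster–Tarski applies without any continuity of `f` and `g`.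
  let T : (Set.Ico (0 : ℝ) 1 →o Set.Icc l c) →o (Set.Ico (0 : ℝ) 1 →o Set.Icc l c) :=
    { toFun := fun u =>
        { toFun := fun θ =>
            if hθ : α ≤ θ.1 then
              ⟨f (u ⟨θ.1 - α, by constructor <;> linarith [θ.2.1, θ.2.2]⟩),
                H.mapsTo_up (u _).2⟩
            else
              ⟨g (u ⟨θ.1 - α + 1, by constructor <;> linarith [θ.2.1, θ.2.2, not_le.1 hθ]⟩),
                H.mapsTo_down (u _).2⟩
          monotone' := by
            intro θ θ' hle
            have hle' : θ.1 ≤ θ'.1 := hle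
            by_cases hθ : α ≤ θ.1
            · have hθ' : α ≤ θ'.1 := hθ.trans hle'
              simp only [hθ, hθ', dite_true]
              refine H.mono_up.monotoneOn (u _).2 (u _).2 (u.monotone ?_)
              exact sub_le_sub_right hle' α
            · by_cases hθ' : α ≤ θ'.1
              · simp only [hθ, hθ', dite_true, dite_false]
                exact ((H.down_lt _ (u _).2).trans (H.lt_up _ (u _).2)).le
              · simp only [hθ, hθ', dite_false]
                refine H.mono_down.monotoneOn (u _).2 (u _).2 (u.monotone ?_)
                exact add_le_add_left (sub_le_sub_right hle' α) 1 }
      monotone' := by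
        intro u v huv θ
        change (if hθ : α ≤ θ.1 then _ else _ : Set.Icc l c) ≤ (if hθ : α ≤ θ.1 then _ else _)
        by_cases hθ : α ≤ θ.1
        · rw [dif_pos hθ, dif_pos hθ]
          exact H.mono_up.monotoneOn (u _).2 (v _).2 (huv _)
        · rw [dif_neg hθ, dif_neg hθ]
          exact H.mono_down.monotoneOn (u _).2 (v _).2 (huv _) }
  let u := OrderHom.lfp (α := Set.Ico (0 : ℝ) 1 →o Set.Icc l c) T
  have hu : T u = u := OrderHom.map_lfp (α := Set.Ico (0 : ℝ) 1 →o Set.Icc l c) T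
  refine ⟨fun θ => if hθ : θ ∈ Set.Ico (0 : ℝ) 1 then (u ⟨θ, hθ⟩ : ℝ) else 0, ?_, ?_, ?_, ?_⟩
  · intro θ hθ θ' hθ' hle
    simp only [hθ, hθ', dite_true]
    exact u.monotone hle
  · intro θ hθ
    simp only [hθ, dite_true]
    exact (u _).2
  · intro θ hθ
    have m1 : θ ∈ Set.Ico (0 : ℝ) 1 := ⟨h0.le.trans hθ.1, hθ.2⟩
    have m2 : θ - α ∈ Set.Ico (0 : ℝ) 1 := ⟨by linarith [hθ.1], by linarith [hθ.2]⟩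
    simp only [m1, m2, dite_true]
    conv_lhs => rw [← hu]
    exact congrArg Subtype.val (dif_pos (c := α ≤ θ) hθ.1)
  · intro θ hθ
    have m1 : θ ∈ Set.Ico (0 : ℝ) 1 := ⟨hθ.1, hθ.2.trans h1⟩
    have m2 : θ - α + 1 ∈ Set.Ico (0 : ℝ) 1 := ⟨by linarith [hθ.1], by linarith [hθ.2]⟩
    simp only [m1, m2, dite_true]
    conv_lhs => rw [← hu]
    exact congrArg Subtype.val (dif_neg (c := α ≤ θ) (not_le.2 hθ.2))

/-- A failure of strictness on an interval is pulled back by the rotation, because the branches are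
strictly increasing. The pulled back interval never straddles `α`, since there `g`-values on the
left meet larger `f`-values on the right; hence it is never cut. But the backward orbit of an
irrational rotation is dense and must produce an interval of the given length that straddles `α`. -/
theorem strictMonoOn_conj (H : GapPair l c b f g) {α : ℝ} (h0 : 0 < α) (h1 : α < 1)
    (hα : Irrational α) {h : ℝ → ℝ}
    (hmaps : Set.MapsTo h (Set.Ico 0 1) (Set.Icc l c))
    (hup : ∀ θ ∈ Set.Ico α 1, h θ = f (h (θ - α)))
    (hdown : ∀ θ ∈ Set.Ico 0 α, h θ = g (h (θ - α + 1))) :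
    StrictMonoOn h (Set.Ico 0 1) := by
  intro θ₁ hθ₁ θ₂ hθ₂ hlt
  by_contra hcon
  set δ := θ₂ - θ₁ with hδ
  have key : ∀ n : ℕ, Int.fract (θ₁ - n * α) + δ < 1 ∧
      ¬ (Int.fract (θ₁ - n * α) < α ∧ α ≤ Int.fract (θ₁ - n * α) + δ) ∧
      h (Int.fract (θ₁ - n * α) + δ) ≤ h (Int.fract (θ₁ - n * α)) := by
    have straddle : ∀ a : ℝ, 0 ≤ a → a + δ < 1 → h (a + δ) ≤ h a →
        ¬ (a < α ∧ α ≤ a + δ) := by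
      rintro a ha ha1 hle ⟨h2, h3⟩
      rw [hup _ ⟨h3, ha1⟩, hdown _ ⟨ha, h2⟩] at hle
      have e1 := H.lt_up _ (hmaps (x := a + δ - α) ⟨by linarith, by linarith⟩)
      have e2 := H.down_lt _ (hmaps (x := a - α + 1) ⟨by linarith, by linarith⟩)
      linarith
    intro n
    induction n with
    | zero =>
      have e : Int.fract (θ₁ - (0 : ℕ) * α) = θ₁ := by
        simpa using Int.fract_eq_self.2 ⟨hθ₁.1, hθ₁.2⟩
      rw [e]
      have e1 : θ₁ + δ = θ₂ := by rw [hδ]; ring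
      have hle : h (θ₁ + δ) ≤ h θ₁ := by rw [e1]; exact not_lt.1 hcon
      have hlt1 : θ₁ + δ < 1 := by rw [e1]; exact hθ₂.2
      exact ⟨hlt1, straddle _ hθ₁.1 hlt1 hle, hle⟩
    | succ n ih =>
      set a := Int.fract (θ₁ - n * α) with ha
      have ha0 : 0 ≤ a := Int.fract_nonneg _
      have ha1 : a < 1 := Int.fract_lt_one _
      obtain ⟨i1, i2, i3⟩ := ih
      have hstep : Int.fract (θ₁ - (n + 1 : ℕ) * α) = Int.fract (a - α) := by
        have : θ₁ - (n + 1 : ℕ) * α = (a - α) + ⌊θ₁ - n * α⌋ := by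
          rw [ha, Int.fract]; push_cast; ring
        rw [this, Int.fract_add_intCast]
      have hδ0 : 0 < δ := by rw [hδ]; linarith
      by_cases hc : α ≤ a
      · have e : Int.fract (a - α) = a - α :=
          Int.fract_eq_self.2 ⟨by linarith, by linarith⟩
        rw [hstep, e]
        have hle : h (a - α + δ) ≤ h (a - α) := by
          rw [hup _ ⟨hc, ha1⟩, hup _ ⟨by linarith, i1⟩] at i3
          have m1 := hmaps (x := a - α) ⟨by linarith, by linarith⟩
          have m2 := hmaps (x := a + δ - α) ⟨by linarith, by linarith⟩
          have := (H.mono_up.le_iff_le m2 m1).1 i3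
          rwa [show a - α + δ = a + δ - α by ring]
        exact ⟨by linarith, straddle _ (by linarith) (by linarith) hle, hle⟩
      · rw [not_le] at hc
        have hc2 : a + δ < α := by
          by_contra hh
          exact i2 ⟨hc, not_lt.1 hh⟩
        have e : Int.fract (a - α) = a - α + 1 := by
          have := Int.fract_add_intCast (a - α) 1
          rw [← this, Int.cast_one]
          exact Int.fract_eq_self.2 ⟨by linarith, by linarith⟩
        rw [hstep, e]
        have hle : h (a - α + 1 + δ) ≤ h (a - α + 1) := by
          rw [hdown _ ⟨ha0, hc⟩, hdown _ ⟨by linarith, hc2⟩] at i3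
          have m1 := hmaps (x := a - α + 1) ⟨by linarith, by linarith⟩
          have m2 := hmaps (x := a + δ - α + 1) ⟨by linarith, by linarith⟩
          have := (H.mono_down.le_iff_le m2 m1).1 i3
          rwa [show a - α + 1 + δ = a + δ - α + 1 by ring]
        exact ⟨by linarith, straddle _ (by linarith) (by linarith) hle, hle⟩
  have hδ0 : 0 < δ := by rw [hδ]; linarith
  obtain ⟨n, hn⟩ := exists_fract_sub_mul_mem_Ioo hα θ₁ (le_max_left 0 (α - δ))
    (max_lt h0 (by linarith)) h1.le
  refine (key n).2.1 ⟨hn.2, ?_⟩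
  linarith [hn.1, le_max_right 0 (α - δ)]

/-- A threshold at which the contracted rotation is semiconjugate to the rotation by `α`. -/
theorem exists_threshold (H : GapPair l c b f g) {α : ℝ} (h0 : 0 < α) (h1 : α < 1)
    (hα : Irrational α) :
    ∃ D ∈ Set.Icc l c, ∃ ψ : ℝ → ℝ, Continuous ψ ∧ (∀ x, ψ x ∈ Set.Icc (0 : ℝ) 1) ∧
      (∀ x ∈ Set.Icc l c, x ≤ D → ψ (f x) = ψ x + α) ∧
      (∀ x ∈ Set.Icc l c, D ≤ x → ψ (g x) = ψ x + α - 1) := by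
  obtain ⟨h, hm, hmaps, hup, hdown⟩ := H.exists_monotone_conj h0 h1
  have hs := H.strictMonoOn_conj h0 h1 hα hmaps hup hdown
  set I := h '' Set.Ico 0 (1 - α) with hI
  have hIne : I.Nonempty := ⟨h 0, 0, ⟨le_rfl, by linarith⟩, rfl⟩
  have hIbdd : BddAbove I := by
    refine ⟨c, ?_⟩
    rintro _ ⟨θ, hθ, rfl⟩
    exact (hmaps ⟨hθ.1, by linarith [hθ.2]⟩).2
  -- `D` separates the values of `h` at angles which the rotation moves without wrapping from those
  -- at angles which it wraps around.
  set D := sSup I with hD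
  have hle : ∀ θ ∈ Set.Ico 0 (1 - α), h θ ≤ D := fun θ hθ => le_csSup hIbdd ⟨θ, hθ, rfl⟩
  have hge : ∀ θ ∈ Set.Ico (1 - α) 1, D ≤ h θ := by
    intro θ hθ
    refine csSup_le hIne ?_
    rintro _ ⟨θ', hθ', rfl⟩
    exact hm ⟨hθ'.1, by linarith [hθ'.2]⟩ ⟨by linarith [hθ.1], hθ.2⟩ (by linarith [hθ.1, hθ'.2])
  have hDmem : D ∈ Set.Icc l c := by
    have z := hmaps (x := 0) ⟨le_rfl, by linarith⟩
    refine ⟨z.1.trans (hle 0 ⟨le_rfl, by linarith⟩), csSup_le hIne ?_⟩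
    rintro _ ⟨θ, hθ, rfl⟩
    exact (hmaps ⟨hθ.1, by linarith [hθ.2]⟩).2
  -- The supremum of `A x` is the generalized inverse of `h`. The point `0` keeps the set nonempty
  -- when `x` lies to the left of the range of `h`.
  let A : ℝ → Set ℝ := fun x => {0} ∪ {θ | θ ∈ Set.Ico (0 : ℝ) 1 ∧ h θ < x}
  have hAb : ∀ x, ∀ θ ∈ A x, θ ∈ Set.Ico (0 : ℝ) 1 := by
    rintro x θ (hθ | hθ)
    · rw [Set.mem_singleton_iff.1 hθ]; exact ⟨le_rfl, zero_lt_one⟩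
    · exact hθ.1
  have hlub : ∀ x, IsLUB (A x) (sSup (A x)) := fun x =>
    isLUB_csSup ⟨0, Or.inl rfl⟩ ⟨1, fun θ hθ => (hAb x θ hθ).2.le⟩
  let ψ : ℝ → ℝ := fun x => sSup (A x)
  have hψI : ∀ x, ψ x ∈ Set.Icc (0 : ℝ) 1 := fun x =>
    ⟨(hlub x).1 (Or.inl rfl), (hlub x).2 fun θ hθ => (hAb x θ hθ).2.le⟩
  have hψm : Monotone ψ := by
    intro x y hxy
    refine (hlub x).2 fun θ hθ => (hlub y).1 ?_
    exact hθ.imp id fun h => ⟨h.1, h.2.trans_le hxy⟩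
  have hψh : ∀ θ ∈ Set.Ico (0 : ℝ) 1, ψ (h θ) = θ := by
    intro θ hθ
    apply le_antisymm
    · refine (hlub _).2 ?_
      rintro θ' (hθ' | hθ')
      · rw [Set.mem_singleton_iff.1 hθ']; exact hθ.1
      · exact ((hs.lt_iff_lt hθ'.1 hθ).1 hθ'.2).le
    · refine le_of_forall_lt fun a ha => ?_
      rcases lt_or_ge a 0 with ha0 | ha0
      · exact ha0.trans_le (hψI _).1
      · have hmid : (a + θ) / 2 ∈ A (h θ) :=
          Or.inr ⟨⟨by linarith, by linarith [hθ.2]⟩,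
            hs ⟨by linarith, by linarith [hθ.2]⟩ hθ (by linarith)⟩
        have := (hlub (h θ)).1 hmid
        exact lt_of_lt_of_le (by linarith) this
  -- A monotone map with dense range has no jumps. The range contains `[0, 1)` because `ψ` inverts
  -- `h`, and this is where strictness of `h` is used.
  have hψc : Continuous ψ := by
    let φ : ℝ → Set.Icc (0 : ℝ) 1 := fun x => ⟨ψ x, hψI x⟩
    have hφ : Continuous φ := by
      refine Monotone.continuous_of_denseRange (fun x y hxy => hψm hxy) ?_
      intro y
      rw [Metric.mem_closure_iff]
      intro ε hε
      have hw : max 0 (y.1 - ε / 2) ∈ Set.Ico (0 : ℝ) 1 :=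
        ⟨le_max_left _ _, max_lt zero_lt_one (by linarith [y.2.2])⟩
      refine ⟨φ (h (max 0 (y.1 - ε / 2))), ⟨_, rfl⟩, ?_⟩
      have e : (φ (h (max 0 (y.1 - ε / 2)))).1 = max 0 (y.1 - ε / 2) := hψh _ hw
      rw [Subtype.dist_eq, e, Real.dist_eq, abs_lt]
      constructor
      · have := max_le y.2.1 (by linarith : y.1 - ε / 2 ≤ y.1)
        linarith
      · linarith [le_max_right 0 (y.1 - ε / 2)]
    exact continuous_subtype_val.comp hφ
  refine ⟨D, hDmem, ψ, hψc, hψI, ?_, ?_⟩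
  · intro x hx hxD
    refine (hlub (f x)).unique ⟨?_, ?_⟩
    · rintro θ (hθ | ⟨hθ, hlt⟩)
      · rw [Set.mem_singleton_iff.1 hθ]; linarith [(hψI x).1]
      · rcases lt_or_ge θ α with hc | hc
        · linarith [(hψI x).1]
        · rw [hup θ ⟨hc, hθ.2⟩] at hlt
          have m : θ - α ∈ Set.Ico (0 : ℝ) 1 := ⟨by linarith, by linarith [hθ.2]⟩
          have := (hlub x).1 (Or.inr ⟨m, (H.mono_up.lt_iff_lt (hmaps m) hx).1 hlt⟩)
          linarith
    · intro u hu
      have : ψ x ≤ u - α := by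
        refine (hlub x).2 ?_
        rintro θ (hθ | ⟨hθ, hlt⟩)
        · rw [Set.mem_singleton_iff.1 hθ, sub_nonneg]
          -- All values of `h` on `[0, α)` come from `g` and so lie below `f x`, even if no value of
          -- `h` lies below `x`. This forces `α ≤ u`.
          refine le_of_forall_lt fun a ha => ?_
          rcases lt_or_ge a 0 with ha0 | ha0
          · exact ha0.trans_le (hu (Or.inl rfl))
          · have m : (a + α) / 2 ∈ Set.Ico 0 α := ⟨by linarith, by linarith⟩
            have m' := hmaps (x := (a + α) / 2 - α + 1) ⟨by linarith, by linarith⟩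
            have hmem : (a + α) / 2 ∈ A (f x) := by
              refine Or.inr ⟨⟨m.1, by linarith⟩, ?_⟩
              rw [hdown _ m]
              exact (H.down_lt _ m').trans (H.lt_up x hx)
            have := hu hmem
            linarith
        · have hc : θ < 1 - α := by
            by_contra hh
            have := hge θ ⟨not_lt.1 hh, hθ.2⟩
            linarith
          have hmem : θ + α ∈ A (f x) := by
            refine Or.inr ⟨⟨by linarith [hθ.1], by linarith⟩, ?_⟩
            rw [hup _ ⟨by linarith [hθ.1], by linarith⟩, add_sub_cancel_right]
            exact H.mono_up (hmaps hθ) hx hlt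
          linarith [hu hmem]
      linarith
  · intro x hx hxD
    have hψx : 1 - α ≤ ψ x := by
      refine le_of_forall_lt fun a ha => ?_
      rcases lt_or_ge a 0 with ha0 | ha0
      · exact ha0.trans_le (hψI _).1
      · have m : (a + (1 - α)) / 2 ∈ Set.Ico (0 : ℝ) 1 := ⟨by linarith, by linarith⟩
        have m' : (a + 3 * (1 - α)) / 4 ∈ Set.Ico 0 (1 - α) := ⟨by linarith, by linarith⟩
        have := (hlub x).1 (Or.inr ⟨m, (hs m ⟨m'.1, by linarith [m'.2]⟩
          (by linarith)).trans_le ((hle _ m').trans hxD)⟩)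
        exact lt_of_lt_of_le (by linarith) this
    refine (hlub (g x)).unique ⟨?_, ?_⟩
    · rintro θ (hθ | ⟨hθ, hlt⟩)
      · rw [Set.mem_singleton_iff.1 hθ]; linarith
      · rcases lt_or_ge θ α with hc | hc
        · rw [hdown θ ⟨hθ.1, hc⟩] at hlt
          have m : θ - α + 1 ∈ Set.Ico (0 : ℝ) 1 := ⟨by linarith [hθ.1], by linarith⟩
          have := (hlub x).1 (Or.inr ⟨m, (H.mono_down.lt_iff_lt (hmaps m) hx).1 hlt⟩)
          linarith
        · rw [hup θ ⟨hc, hθ.2⟩] at hlt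
          have m' := hmaps (x := θ - α) ⟨by linarith, by linarith [hθ.2]⟩
          have e1 := H.lt_up _ m'
          have e2 := H.down_lt x hx
          linarith
    · intro u hu
      have hu0 : 0 ≤ u := hu (Or.inl rfl)
      have : ψ x ≤ u + (1 - α) := by
        refine (hlub x).2 ?_
        rintro θ (hθ | ⟨hθ, hlt⟩)
        · rw [Set.mem_singleton_iff.1 hθ]; linarith
        · rcases lt_or_ge θ (1 - α) with hc | hc
          · linarith
          · have hmem : θ + α - 1 ∈ A (g x) := by
              refine Or.inr ⟨⟨by linarith, by linarith [hθ.2]⟩, ?_⟩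
              rw [hdown _ ⟨by linarith, by linarith [hθ.2]⟩,
                show θ + α - 1 - α + 1 = θ by ring]
              exact H.mono_down (hmaps hθ) hx hlt
            linarith [hu hmem]
      linarith

end GapPair

/-- A bounded sequence cannot have increments that converge to a nonzero limit. -/
theorem not_tendsto_increments {u : ℕ → ℝ} (hu : ∀ n, u n ∈ Set.Icc (0 : ℝ) 1) {κ : ℝ}
    (hκ : κ ≠ 0) : ¬ Tendsto (fun n => u (n + 1) - u n) atTop (𝓝 κ) := by
  intro h
  -- The Cesàro means of the increments inherit the limit `κ`, but the sums telescope and stay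
  -- bounded.
  have h1 : Tendsto (fun n : ℕ => (n : ℝ)⁻¹ * ∑ i ∈ Finset.range n, (u (i + 1) - u i)) atTop
      (𝓝 κ) := h.cesaro
  have h2 : Tendsto (fun n : ℕ => (n : ℝ)⁻¹ * ∑ i ∈ Finset.range n, (u (i + 1) - u i)) atTop
      (𝓝 0) := by
    refine squeeze_zero_norm (fun n => ?_) tendsto_inv_atTop_nhds_zero_nat
    rw [Finset.sum_range_sub, norm_mul]
    have : ‖u n - u 0‖ ≤ 1 := by
      rw [Real.norm_eq_abs, abs_le]
      constructor <;> linarith [(hu n).1, (hu n).2, (hu 0).1, (hu 0).2]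
    calc ‖(n : ℝ)⁻¹‖ * ‖u n - u 0‖ ≤ ‖(n : ℝ)⁻¹‖ * 1 := by gcongr
      _ = (n : ℝ)⁻¹ := by simp
  exact hκ (tendsto_nhds_unique h1 h2)

/-- Asymptotic orbits of a contracted rotation with irrational rotation number have codings that
are not eventually periodic. -/
theorem not_eventually_periodic_coding {l c α D : ℝ} {f g ψ : ℝ → ℝ} (hα : Irrational α)
    (hψ : Continuous ψ) (hψI : ∀ x, ψ x ∈ Set.Icc (0 : ℝ) 1)
    (hf : ∀ x ∈ Set.Icc l c, x ≤ D → ψ (f x) = ψ x + α)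
    (hg : ∀ x ∈ Set.Icc l c, D ≤ x → ψ (g x) = ψ x + α - 1)
    (hfI : Set.MapsTo f (Set.Icc l c) (Set.Icc l c))
    (hgI : Set.MapsTo g (Set.Icc l c) (Set.Icc l c))
    {x : ℕ → ℝ} {s : ℕ → Prop} [DecidablePred s] (hx : ∀ n, x n ∈ Set.Icc l c)
    (hs : ∀ n, s n → x n ≤ D) (hs' : ∀ n, ¬ s n → D ≤ x n)
    (hxs : Tendsto (fun n => x (n + 1) - if s n then f (x n) else g (x n)) atTop (𝓝 0))
    {m : ℕ} (hm : 0 < m) {N : ℕ} (hper : ∀ n, N ≤ n → (s (n + m) ↔ s n)) : False := by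
  set y : ℕ → ℝ := fun n => if s n then f (x n) else g (x n) with hy
  have hyI : ∀ n, y n ∈ Set.Icc l c := by
    intro n
    simp only [hy]
    split_ifs
    · exact hfI (hx n)
    · exact hgI (hx n)
  let k : ℕ → ℝ := fun n => if s n then α else α - 1
  have hψy : ∀ n, ψ (y n) = ψ (x n) + k n := by
    intro n
    simp only [hy, k]
    split_ifs with h
    · exact hf _ (hx n) (hs n h)
    · rw [hg _ (hx n) (hs' n h)]; ring
  -- Uniform continuity of `ψ` on the compact interval turns the vanishing errors of `x` into
  -- vanishing errors of the rotation coordinate.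
  have hd : Tendsto (fun n => ψ (x (n + 1)) - ψ (y n)) atTop (𝓝 0) := by
    have huc := isCompact_Icc.uniformContinuousOn_of_continuous (hψ.continuousOn (s := Set.Icc l c))
    rw [Metric.uniformContinuousOn_iff] at huc
    rw [Metric.tendsto_atTop] at hxs ⊢
    intro ε hε
    obtain ⟨δ, hδ, hδ'⟩ := huc ε hε
    obtain ⟨M, hM⟩ := hxs δ hδ
    refine ⟨M, fun n hn => ?_⟩
    have e1 := hM n hn
    rw [Real.dist_eq, sub_zero] at e1 ⊢
    have := hδ' _ (hx (n + 1)) _ (hyI n) (by rw [Real.dist_eq]; exact e1)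
    rwa [Real.dist_eq] at this
  have hsum : Tendsto (fun n => ∑ i ∈ Finset.range m, (ψ (x (n + i + 1)) - ψ (y (n + i)))) atTop
      (𝓝 0) := by
    have : Tendsto (fun n => ∑ i ∈ Finset.range m, (ψ (x (n + i + 1)) - ψ (y (n + i)))) atTop
        (𝓝 (∑ i ∈ Finset.range m, (0 : ℝ))) :=
      tendsto_finsetSum _ fun i _ => hd.comp (tendsto_add_atTop_nat i)
    simpa using this
  have hk : ∀ n, N ≤ n → k (n + m) = k n := by
    intro n hn
    simp only [k, hper n hn]
  have hK : ∀ j, ∑ i ∈ Finset.range m, k (N + j * m + i) = ∑ i ∈ Finset.range m, k (N + i) := by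
    intro j
    induction j with
    | zero => simp
    | succ j ih =>
      rw [← ih]
      refine Finset.sum_congr rfl fun i _ => ?_
      rw [← hk (N + j * m + i) (by omega)]
      congr 1
      ring
  -- Over one period the coordinate advances by `m * α` minus a number of wraps, which is not zero
  -- since `α` is irrational.
  have hKne : ∑ i ∈ Finset.range m, k (N + i) ≠ 0 := by
    have e : ∑ i ∈ Finset.range m, k (N + i) =
        m * α - ((Finset.range m).filter fun i => ¬ s (N + i)).card := by
      have : ∀ n, k n = α - if ¬ s n then 1 else 0 := by
        intro n; simp only [k]; split_ifs <;> simp_all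
      simp only [this, Finset.sum_sub_distrib, Finset.sum_const, Finset.card_range, nsmul_eq_mul,
        Finset.sum_boole]
    rw [e, sub_ne_zero]
    have := (hα.natCast_mul hm.ne')
    exact this.ne_nat _
  refine not_tendsto_increments (u := fun j => ψ (x (N + j * m))) (fun j => hψI _) hKne ?_
  have ht : Tendsto (fun j : ℕ => N + j * m) atTop atTop :=
    tendsto_atTop_mono (fun j => show j ≤ _ by nlinarith) tendsto_id
  have := (hsum.comp ht).add_const (∑ i ∈ Finset.range m, k (N + i))
  rw [zero_add] at this
  refine this.congr fun j => ?_
  simp only [Function.comp]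
  rw [← hK j, ← Finset.sum_add_distrib]
  have e : ∀ i, ψ (x (N + j * m + i + 1)) - ψ (y (N + j * m + i)) + k (N + j * m + i) =
      ψ (x (N + j * m + (i + 1))) - ψ (x (N + j * m + i)) := by
    intro i; rw [hψy, ← add_assoc]; ring
  simp only [e]
  rw [Finset.sum_range_sub (fun i => ψ (x (N + j * m + i)))]
  congr 3
  ring

/-! ### The ratio dynamics and its noisy orbits -/

/-- The effect on the normalized queue ratio of a switch `i → i + 1`. -/
noncomputable def ratioUp (β R : ℝ) : ℝ := 1 / (1 + β * R)

/-- The effect on the normalized queue ratio of a switch `i → i + 2`. -/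
noncomputable def ratioDown (β R : ℝ) : ℝ := 1 + β / R

section ratio

variable {β x y : ℝ}

theorem ratioUp_pos (hβ : 0 < β) (hx : 0 < x) : 0 < ratioUp β x := by
  unfold ratioUp; positivity

theorem ratioUp_lt_one (hβ : 0 < β) (hx : 0 < x) : ratioUp β x < 1 := by
  unfold ratioUp
  rw [div_lt_one (by positivity)]
  linarith [mul_pos hβ hx]

theorem one_lt_ratioDown (hβ : 0 < β) (hx : 0 < x) : 1 < ratioDown β x := by
  unfold ratioDown
  linarith [div_pos hβ hx]

theorem ratioUp_lt (hβ : 0 < β) (hx : 0 < x) (hxy : x < y) : ratioUp β y < ratioUp β x := by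
  unfold ratioUp
  exact one_div_lt_one_div_of_lt (by positivity) (by linarith [mul_lt_mul_of_pos_left hxy hβ])

theorem ratioDown_lt (hβ : 0 < β) (hx : 0 < x) (hxy : x < y) :
    ratioDown β y < ratioDown β x := by
  unfold ratioDown
  linarith [div_lt_div_of_pos_left hβ hx hxy]

theorem strictAntiOn_ratioUp (hβ : 0 < β) : StrictAntiOn (ratioUp β) (Set.Ioi 0) :=
  fun _ hx _ _ hxy => ratioUp_lt hβ hx hxy

theorem strictAntiOn_ratioDown (hβ : 0 < β) : StrictAntiOn (ratioDown β) (Set.Ioi 0) :=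
  fun _ hx _ _ hxy => ratioDown_lt hβ hx hxy

theorem abs_ratioUp_sub_le (hβ : 0 < β) (hx : 0 < x) (hy : 0 < y) (e : ℝ) :
    |ratioUp β x * (1 + e) - ratioUp β y| ≤ β * |x - y| + |e| := by
  have h1 : ratioUp β x * (1 + e) - ratioUp β y =
      ratioUp β x * ratioUp β y * (β * (y - x)) + ratioUp β x * e := by
    unfold ratioUp
    have : 1 + β * x ≠ 0 := by positivity
    have : 1 + β * y ≠ 0 := by positivity
    field_simp
    ring
  have p1 := ratioUp_pos hβ hx
  have p2 := ratioUp_pos hβ hy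
  have q1 := ratioUp_lt_one hβ hx
  have q2 := ratioUp_lt_one hβ hy
  rw [h1]
  refine (abs_add_le _ _).trans ?_
  rw [abs_mul, abs_mul, abs_mul, abs_mul, abs_of_pos p1, abs_of_pos p2, abs_of_pos hβ,
    abs_sub_comm y x]
  have h2 : ratioUp β x * ratioUp β y ≤ 1 := by nlinarith
  have h3 : 0 ≤ β * |x - y| := by positivity
  have h4 := abs_nonneg e
  nlinarith

theorem abs_ratioDown_sub_le {m : ℝ} (hβ : 0 < β) (hm : 0 < m) (hx : m ≤ x) (hy : m ≤ y) (e : ℝ) :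
    |ratioDown β x * (1 + e) - ratioDown β y| ≤ β / m ^ 2 * |x - y| + (1 + β / m) * |e| := by
  have hx0 : 0 < x := hm.trans_le hx
  have hy0 : 0 < y := hm.trans_le hy
  have h1 : ratioDown β x * (1 + e) - ratioDown β y =
      β / (x * y) * (y - x) + ratioDown β x * e := by
    unfold ratioDown
    field_simp
    ring
  have p1 : 0 < ratioDown β x := zero_lt_one.trans (one_lt_ratioDown hβ hx0)
  rw [h1]
  refine (abs_add_le _ _).trans ?_
  rw [abs_mul, abs_mul, abs_of_pos p1, abs_sub_comm y x, abs_of_pos (by positivity)]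
  have h2 : m ^ 2 ≤ x * y := by nlinarith
  have h3 : ratioDown β x ≤ 1 + β / m := by
    unfold ratioDown
    linarith [div_le_div_of_nonneg_left hβ.le hm hx]
  gcongr

end ratio

/-- An antitone map keeps a margin under small relative perturbations. -/
theorem eventually_perturb_mem {F : ℝ → ℝ} {a b a' b' : ℝ} (hF : AntitoneOn F (Set.Icc a b))
    (hab : a ≤ b) (ha' : 0 < a') (h1 : a' < F b) (h2 : F a < b') :
    ∀ᶠ ε in 𝓝[>] (0 : ℝ), ∀ R ∈ Set.Icc a b, ∀ e : ℝ, |e| ≤ ε → F R * (1 + e) ∈ Set.Icc a' b' := by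
  have hFb : 0 < F b := ha'.trans h1
  have hFa : 0 < F a := hFb.trans_le (hF ⟨le_rfl, hab⟩ ⟨hab, le_rfl⟩ hab)
  have hp : 0 < min ((F b - a') / F b) ((b' - F a) / F a) :=
    lt_min (div_pos (by linarith) hFb) (div_pos (by linarith) hFa)
  filter_upwards [Ioo_mem_nhdsGT hp] with ε hε R hR e he
  have e1 := (lt_div_iff₀ hFb).1 (hε.2.trans_le (min_le_left _ _))
  have e2 := (lt_div_iff₀ hFa).1 (hε.2.trans_le (min_le_right _ _))
  have r1 := hF hR ⟨hab, le_rfl⟩ hR.2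
  have r2 := hF ⟨le_rfl, hab⟩ hR hR.1
  obtain ⟨e3, e4⟩ := abs_le.1 he
  have hR0 : 0 < F R := hFb.trans_le r1
  have hε1 : ε < 1 := by
    have : (F b - a') / F b < 1 := by rw [div_lt_one hFb]; linarith
    exact (hε.2.trans_le (min_le_left _ _)).trans this
  constructor
  · nlinarith
  · nlinarith [hε.1]

/-- A trajectory of the (branching) ratio dynamics with vanishing relative errors. -/
structure NoisyOrbit (β T : Fin 3 → ℝ) (side : ℕ → Fin 3) (R e : ℕ → ℝ) : Prop where
  pos : ∀ n, 0 < R n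
  tendsto : Tendsto e atTop (𝓝 0)
  step : ∀ n,
    (R n ≤ T (side n) ∧ side (n + 1) = side n + 1 ∧
      R (n + 1) = ratioUp (β (side n + 1)) (R n) * (1 + e n)) ∨
    (T (side n) ≤ R n ∧ side (n + 1) = side n + 2 ∧
      R (n + 1) = ratioDown (β (side n + 2)) (R n) * (1 + e n))

namespace NoisyOrbit

variable {β T : Fin 3 → ℝ} {side : ℕ → Fin 3} {R e : ℕ → ℝ}

theorem up (H : NoisyOrbit β T side R e) {n : ℕ} (h : R n < T (side n)) :
    side (n + 1) = side n + 1 ∧ R (n + 1) = ratioUp (β (side n + 1)) (R n) * (1 + e n) := by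
  rcases H.step n with h1 | h1
  · exact h1.2
  · exact absurd h1.1 (not_le.2 h)

theorem down (H : NoisyOrbit β T side R e) {n : ℕ} (h : T (side n) < R n) :
    side (n + 1) = side n + 2 ∧ R (n + 1) = ratioDown (β (side n + 2)) (R n) * (1 + e n) := by
  rcases H.step n with h1 | h1
  · exact absurd h1.1 (not_le.2 h)
  · exact h1.2

end NoisyOrbit

theorem tendsto_zero_of_le_mul_add {x d : ℕ → ℝ} {q : ℝ} (hq0 : 0 ≤ q) (hq : q < 1)
    (hx : ∀ n, 0 ≤ x n) (hd : Tendsto d atTop (𝓝 0)) (h : ∀ n, x (n + 1) ≤ q * x n + d n) :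
    Tendsto x atTop (𝓝 0) := by
  rw [Metric.tendsto_atTop]
  intro δ hδ
  have hδ' : 0 < (1 - q) * (δ / 2) := mul_pos (by linarith) (by linarith)
  obtain ⟨N, hN⟩ := (Metric.tendsto_atTop.1 hd) _ hδ'
  have hk : ∀ k, x (N + k) ≤ q ^ k * x N + δ / 2 := by
    intro k
    induction k with
    | zero => simp; linarith
    | succ k ih =>
      have h1 := h (N + k)
      have h2 := hN (N + k) (by omega)
      rw [Real.dist_eq, sub_zero] at h2
      have h3 := (abs_lt.1 h2).2
      rw [← add_assoc, pow_succ]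
      nlinarith [mul_le_mul_of_nonneg_left ih hq0]
  have hlim : Tendsto (fun k => q ^ k * x N) atTop (𝓝 0) := by
    simpa using (tendsto_pow_atTop_nhds_zero_of_lt_one hq0 hq).mul_const (x N)
  obtain ⟨K, hK⟩ := (Metric.tendsto_atTop.1 hlim) (δ / 2) (by linarith)
  refine ⟨N + K, fun n hn => ?_⟩
  obtain ⟨k, rfl⟩ := Nat.exists_eq_add_of_le (show N ≤ n by omega)
  have h1 := hK k (by omega)
  rw [Real.dist_eq, sub_zero] at h1 ⊢
  rw [abs_of_nonneg (hx _)]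
  linarith [hk k, (abs_lt.1 h1).2]

/-! ### The attracting cycle and the choice of thresholds -/

/-- The cycle `0 → 2 → 1 → 0` has an orbit. -/
theorem exists_cycle {β : Fin 3 → ℝ} (hβ : ∀ i, 0 < β i) :
    ∃ v : Fin 3 → ℝ, (∀ i, 1 < v i) ∧ ∀ i, v (i + 2) = ratioDown (β (i + 2)) (v i) := by
  have hd : ∀ i x, 1 ≤ x → 1 ≤ ratioDown (β i) x := fun i x hx =>
    (one_lt_ratioDown (hβ i) (by linarith)).le
  have hc : ∀ i, ContinuousOn (ratioDown (β i)) (Set.Ici 1) := by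
    intro i
    unfold ratioDown
    exact continuousOn_const.add (continuousOn_const.div continuousOn_id
      fun x hx => (zero_lt_one.trans_le hx).ne')
  -- Each down map preserves `[1, ∞)`, and the last one is at most `1 + β 0` there. So the
  -- composition maps this compact interval into itself.
  obtain ⟨w, hw, hfix⟩ := exists_mem_Icc_isFixedPt_of_mapsTo (a := 1) (b := 1 + β 0)
    (f := fun x => ratioDown (β 0) (ratioDown (β 1) (ratioDown (β 2) x))) (by
      have h2 : ContinuousOn (ratioDown (β 2)) (Set.Icc 1 (1 + β 0)) :=
        (hc 2).mono fun x hx => hx.1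
      have h1 := (hc 1).comp h2 fun x hx => hd 2 x hx.1
      exact (hc 0).comp h1 fun x hx => hd 1 _ (hd 2 x hx.1)) (by linarith [hβ 0])
    (by
      intro x hx
      have h1 := hd 1 _ (hd 2 x hx.1)
      refine ⟨hd 0 _ h1, ?_⟩
      exact add_le_add_right (div_le_self (hβ 0).le h1) 1)
  have hw0 : (0 : ℝ) < w := by linarith [hw.1]
  have p2 := one_lt_ratioDown (hβ 2) hw0
  have p1 := one_lt_ratioDown (hβ 1) (zero_lt_one.trans p2)
  have p0 := one_lt_ratioDown (hβ 0) (zero_lt_one.trans p1)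
  have hfix' : ratioDown (β 0) (ratioDown (β 1) (ratioDown (β 2) w)) = w := hfix
  rw [hfix'] at p0
  refine ⟨![w, ratioDown (β 1) (ratioDown (β 2) w), ratioDown (β 2) w], ?_, ?_⟩
  · intro i
    fin_cases i
    · exact p0
    · exact p1
    · exact p2
  · intro i
    fin_cases i
    · rfl
    · exact hfix'.symm
    · rfl

/-- The cycle attracts the noisy orbits that start close to it. -/
theorem noisyOrbit_tendsto_cycle {β T v : Fin 3 → ℝ} (hβ : ∀ i, 0 < β i)
    (hv0 : ∀ i, 0 < v i) (hTv : ∀ i, T i < v i)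
    (hv : ∀ i, v (i + 2) = ratioDown (β (i + 2)) (v i)) :
    ∃ ε > 0, ∀ side R e, NoisyOrbit β T side R e → (∀ n, |e n| ≤ ε) →
      |R 0 - v (side 0)| < ε * v (side 0) →
      (∀ n, side (n + 1) = side n + 2) ∧ Tendsto (fun n => R n - v (side n)) atTop (𝓝 0) := by
  -- Within relative distance `η` of `v` the ratio stays above the threshold, and the contraction
  -- factor stays below `β / (β + v / 2)`.
  obtain ⟨η, hη0, hη1, hηT, hηq⟩ : ∃ η : ℝ, 0 < η ∧ η ≤ 1 / 2 ∧
      (∀ i, η * v i < v i - T i) ∧ ∀ i, η * (v i + β (i + 2)) ≤ v i / 2 := by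
    have h1 : ∀ i : Fin 3, ∀ᶠ η in 𝓝[>] (0 : ℝ), η * v i < v i - T i := by
      intro i
      have : Tendsto (fun η : ℝ => η * v i) (𝓝[>] 0) (𝓝 (0 * v i)) :=
        (tendsto_id.mono_left nhdsWithin_le_nhds).mul_const _
      rw [zero_mul] at this
      exact this.eventually_lt_const (by linarith [hTv i])
    have h2 : ∀ i : Fin 3, ∀ᶠ η in 𝓝[>] (0 : ℝ), η * (v i + β (i + 2)) < v i / 2 := by
      intro i
      have : Tendsto (fun η : ℝ => η * (v i + β (i + 2))) (𝓝[>] 0)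
          (𝓝 (0 * (v i + β (i + 2)))) :=
        (tendsto_id.mono_left nhdsWithin_le_nhds).mul_const _
      rw [zero_mul] at this
      exact this.eventually_lt_const (by linarith [hv0 i])
    obtain ⟨η, ha, hb, hc⟩ := ((eventually_all.2 h1).and ((eventually_all.2 h2).and
      (Ioo_mem_nhdsGT (show (0 : ℝ) < 1 / 2 by norm_num)))).exists
    exact ⟨η, hc.1, hc.2.le, ha, fun i => (hb i).le⟩
  obtain ⟨q, hq0, hq1, hq⟩ : ∃ q : ℝ, 0 ≤ q ∧ q < 1 ∧
      ∀ i, β (i + 2) / (β (i + 2) + v i / 2) ≤ q := by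
    have h1 : ∀ i : Fin 3, β (i + 2) / (β (i + 2) + v i / 2) < 1 := by
      intro i
      have := hβ (i + 2); have := hv0 i
      rw [div_lt_one (by positivity)]; linarith
    have h0 : ∀ i : Fin 3, 0 ≤ β (i + 2) / (β (i + 2) + v i / 2) := by
      intro i
      have := hβ (i + 2); have := hv0 i
      positivity
    refine ⟨Finset.univ.sup' ⟨0, Finset.mem_univ _⟩
      (fun i : Fin 3 => β (i + 2) / (β (i + 2) + v i / 2)), ?_, ?_, ?_⟩
    · exact (h0 0).trans (Finset.le_sup' (fun i : Fin 3 => β (i + 2) / (β (i + 2) + v i / 2))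
        (Finset.mem_univ 0))
    · exact (Finset.sup'_lt_iff _).2 fun i _ => h1 i
    · intro i
      exact Finset.le_sup' (fun i : Fin 3 => β (i + 2) / (β (i + 2) + v i / 2))
        (Finset.mem_univ i)
  -- The second bound gives `q * η + 2 * ε ≤ η`, so the neighbourhood of relative radius `η` is
  -- invariant.
  refine ⟨min η ((1 - q) * η / 2), lt_min hη0 (by nlinarith), ?_⟩
  intro side R e H he h0
  have one : ∀ n, |R n - v (side n)| ≤ η * v (side n) → side (n + 1) = side n + 2 ∧
      |R (n + 1) - v (side (n + 1))| / v (side (n + 1)) ≤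
        q * (|R n - v (side n)| / v (side n)) + 2 * |e n| := by
    intro n hn
    set i := side n with hi
    have hR : v i - η * v i ≤ R n := by linarith [(abs_le.1 hn).1]
    have hTR : T (side n) < R n := by linarith [hηT i]
    obtain ⟨s1, s2⟩ := H.down hTR
    rw [← hi] at s1 s2
    refine ⟨s1, ?_⟩
    rw [s1, s2, hv i]
    have hb := hβ (i + 2)
    have hvi := hv0 i
    have hRp := H.pos n
    have hw : 0 < ratioDown (β (i + 2)) (v i) := zero_lt_one.trans (one_lt_ratioDown hb hvi)
    -- The relative error is multiplied by a coefficient that equals `β / (v + β) < 1` when `R n = v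
    -- i`.
    have e1 : (ratioDown (β (i + 2)) (R n) * (1 + e n) - ratioDown (β (i + 2)) (v i)) /
        ratioDown (β (i + 2)) (v i) =
        -(β (i + 2) * v i / (R n * (v i + β (i + 2)))) * ((R n - v i) / v i) * (1 + e n) +
          e n := by
      unfold ratioDown
      have : v i + β (i + 2) ≠ 0 := by positivity
      field_simp
      ring
    rw [← abs_of_pos hw, ← abs_div, abs_of_pos hw, e1]
    refine (abs_add_le _ _).trans ?_
    rw [abs_mul, abs_mul, abs_neg, abs_div (R n - v i), abs_of_pos hvi,
      abs_of_pos (a := β (i + 2) * v i / (R n * (v i + β (i + 2)))) (by positivity)]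
    have hqq : β (i + 2) * v i / (R n * (v i + β (i + 2))) ≤ q := by
      refine le_trans ?_ (hq i)
      rw [div_le_div_iff₀ (by positivity) (by positivity)]
      have := hηq i
      have h3 : v i * (β (i + 2) + v i / 2) ≤ R n * (v i + β (i + 2)) := by
        have h4 : (v i - η * v i) * (v i + β (i + 2)) ≤ R n * (v i + β (i + 2)) := by gcongr
        nlinarith
      nlinarith
    have hx1 : |R n - v i| / v i ≤ 1 / 2 := by
      rw [div_le_iff₀ hvi]; nlinarith
    have hx0 : 0 ≤ |R n - v i| / v i := by positivity
    have h1e : |1 + e n| ≤ 1 + |e n| := by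
      simpa using abs_add_le 1 (e n)
    have he0 := abs_nonneg (e n)
    calc _ ≤ q * (|R n - v i| / v i) * (1 + |e n|) + |e n| := by gcongr
      _ = q * (|R n - v i| / v i) + q * (|R n - v i| / v i) * |e n| + |e n| := by ring
      _ ≤ q * (|R n - v i| / v i) + 1 * |e n| + |e n| := by
        gcongr; nlinarith
      _ = _ := by ring
  have hclose : ∀ n, |R n - v (side n)| ≤ η * v (side n) := by
    intro n
    induction n with
    | zero => exact h0.le.trans (by have := hv0 (side 0); gcongr; exact min_le_left _ _)
    | succ n ih =>
      have h1 := (one n ih).2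
      have h2 := (he n).trans (min_le_right _ _)
      rw [← div_le_iff₀ (hv0 _)] at ih ⊢
      nlinarith
  refine ⟨fun n => (one n (hclose n)).1, ?_⟩
  have hlim := tendsto_zero_of_le_mul_add (x := fun n => |R n - v (side n)| / v (side n))
    (d := fun n => 2 * |e n|) hq0 hq1 (fun n => by have := hv0 (side n); positivity)
    (by simpa using H.tendsto.abs.const_mul 2) fun n => (one n (hclose n)).2
  have hV : ∀ i, v i ≤ ∑ j, v j := fun i =>
    Finset.single_le_sum (fun j _ => (hv0 j).le) (Finset.mem_univ i)
  refine squeeze_zero_norm (fun n => ?_) (by simpa using hlim.mul_const (∑ j, v j))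
  rw [Real.norm_eq_abs]
  calc |R n - v (side n)| = |R n - v (side n)| / v (side n) * v (side n) := by
        rw [div_mul_cancel₀ _ (hv0 _).ne']
    _ ≤ |R n - v (side n)| / v (side n) * ∑ j, v j := by
        have := hv0 (side n)
        gcongr
        exact hV _

theorem exists_common_lipschitz {β : Fin 3 → ℝ} (hβ : ∀ i, 0 < β i) {m : ℝ} (hm : 0 < m) :
    ∃ L : ℝ, 1 ≤ L ∧ ∀ i x y e, m ≤ x → m ≤ y →
      |ratioUp (β i) x * (1 + e) - ratioUp (β i) y| ≤ L * (|x - y| + |e|) ∧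
      |ratioDown (β i) x * (1 + e) - ratioDown (β i) y| ≤ L * (|x - y| + |e|) := by
  have hS : ∀ i, β i ≤ ∑ j, β j := fun i =>
    Finset.single_le_sum (fun j _ => (hβ j).le) (Finset.mem_univ i)
  have hS0 : 0 < ∑ j, β j := (hβ 0).trans_le (hS 0)
  set S := ∑ j, β j
  have p1 : 0 < S / m ^ 2 := by positivity
  have p2 : 0 < S / m := by positivity
  refine ⟨1 + S + S / m ^ 2 + S / m, by linarith, ?_⟩
  intro i x y e hx hy
  have ha := abs_nonneg (x - y)
  have he := abs_nonneg e
  constructor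
  · refine (abs_ratioUp_sub_le (hβ i) (hm.trans_le hx) (hm.trans_le hy) e).trans ?_
    rw [mul_add]
    refine add_le_add ?_ ?_
    · gcongr; linarith [hS i]
    · refine le_mul_of_one_le_left he ?_; linarith
  · refine (abs_ratioDown_sub_le (hβ i) hm hx hy e).trans ?_
    rw [mul_add]
    refine add_le_add (mul_le_mul_of_nonneg_right ?_ ha) (mul_le_mul_of_nonneg_right ?_ he)
    · have : β i / m ^ 2 ≤ S / m ^ 2 := div_le_div_of_nonneg_right (hS i) (by positivity)
      linarith
    · have : β i / m ≤ S / m := div_le_div_of_nonneg_right (hS i) (by positivity)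
      linarith

/-- An error made at one step is amplified by at most `L` there and at each later step; since `1 ≤
L`, the factor `L ^ 4` covers all four. -/
theorem abs_four_steps_le {F₁ F₂ F₃ F₄ : ℝ → ℝ} {L m : ℝ} (hL : 1 ≤ L)
    (h₁ : ∀ x y e, m ≤ x → m ≤ y → |F₁ x * (1 + e) - F₁ y| ≤ L * (|x - y| + |e|))
    (h₂ : ∀ x y e, m ≤ x → m ≤ y → |F₂ x * (1 + e) - F₂ y| ≤ L * (|x - y| + |e|))
    (h₃ : ∀ x y e, m ≤ x → m ≤ y → |F₃ x * (1 + e) - F₃ y| ≤ L * (|x - y| + |e|))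
    (h₄ : ∀ x y e, m ≤ x → m ≤ y → |F₄ x * (1 + e) - F₄ y| ≤ L * (|x - y| + |e|))
    {r₀ r₁ r₂ r₃ r₄ e₀ e₁ e₂ e₃ : ℝ}
    (hr₁ : r₁ = F₁ r₀ * (1 + e₀)) (hr₂ : r₂ = F₂ r₁ * (1 + e₁))
    (hr₃ : r₃ = F₃ r₂ * (1 + e₂)) (hr₄ : r₄ = F₄ r₃ * (1 + e₃))
    (m₀ : m ≤ r₀) (m₁ : m ≤ r₁) (m₂ : m ≤ r₂) (m₃ : m ≤ r₃)
    (n₁ : m ≤ F₁ r₀) (n₂ : m ≤ F₂ (F₁ r₀)) (n₃ : m ≤ F₃ (F₂ (F₁ r₀))) :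
    |r₄ - F₄ (F₃ (F₂ (F₁ r₀)))| ≤ L ^ 4 * (|e₀| + |e₁| + |e₂| + |e₃|) := by
  have d₁ := h₁ r₀ r₀ e₀ m₀ m₀
  have d₂ := h₂ r₁ (F₁ r₀) e₁ m₁ n₁
  have d₃ := h₃ r₂ (F₂ (F₁ r₀)) e₂ m₂ n₂
  have d₄ := h₄ r₃ (F₃ (F₂ (F₁ r₀))) e₃ m₃ n₃
  rw [← hr₁] at d₁
  rw [← hr₂] at d₂
  rw [← hr₃] at d₃
  rw [← hr₄] at d₄
  rw [sub_self, abs_zero, zero_add] at d₁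
  have L0 : 0 ≤ L := by linarith
  have a₀ := abs_nonneg e₀
  have a₁ := abs_nonneg e₁
  have a₂ := abs_nonneg e₂
  have a₃ := abs_nonneg e₃
  have L2 : L ≤ L ^ 2 := by nlinarith
  have L3 : L ^ 2 ≤ L ^ 3 := pow_le_pow_right₀ hL (by norm_num)
  have L4 : L ^ 3 ≤ L ^ 4 := pow_le_pow_right₀ hL (by norm_num)
  calc |r₄ - F₄ (F₃ (F₂ (F₁ r₀)))| ≤ L * (L * (L * (L * |e₀| + |e₁|) + |e₂|) + |e₃|) := by
        refine d₄.trans ?_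
        gcongr
        refine d₃.trans ?_
        gcongr
        refine d₂.trans ?_
        gcongr
    _ = L ^ 4 * |e₀| + L ^ 3 * |e₁| + L ^ 2 * |e₂| + L * |e₃| := by ring
    _ ≤ L ^ 4 * |e₀| + L ^ 4 * |e₁| + L ^ 4 * |e₂| + L ^ 4 * |e₃| := by
        gcongr <;> linarith
    _ = _ := by ring

/-- Conditions under which four consecutive steps of a noisy orbit follow the pattern
`0 → 1 → 2 → 1 → 0` or `0 → 2 → 1 → 2 → 0`, depending on the first decision. -/
theorem exists_four_step_blocks {β v : Fin 3 → ℝ} (hβ : ∀ i, 0 < β i)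
    (hv1 : ∀ i, 1 < v i) (hv : ∀ i, v (i + 2) = ratioDown (β (i + 2)) (v i)) :
    ∃ l c T₁ T₂ : ℝ, 0 < l ∧ l < 1 ∧ 1 < c ∧ c < v 0 ∧ 0 < T₁ ∧ T₁ < v 1 ∧ 0 < T₂ ∧ T₂ < v 2 ∧
      GapPair l c 1
        (fun x => ratioDown (β 0) (ratioDown (β 1) (ratioUp (β 2) (ratioUp (β 1) x))))
        (fun x => ratioUp (β 0) (ratioUp (β 2) (ratioDown (β 1) (ratioDown (β 2) x)))) ∧
      ∃ ε > 0, ∃ K : ℝ, ∀ D side R e, NoisyOrbit β ![D, T₁, T₂] side R e →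
        (∀ n, |e n| ≤ ε) → ∀ n, side n = 0 → R n ∈ Set.Icc l c →
        side (n + 4) = 0 ∧ R (n + 4) ∈ Set.Icc l c ∧
        ((R n ≤ D ∧ side (n + 1) = 1 ∧
          |R (n + 4) - ratioDown (β 0) (ratioDown (β 1) (ratioUp (β 2) (ratioUp (β 1) (R n))))|
            ≤ K * (|e n| + |e (n + 1)| + |e (n + 2)| + |e (n + 3)|)) ∨
         (D ≤ R n ∧ side (n + 1) = 2 ∧
          |R (n + 4) - ratioUp (β 0) (ratioUp (β 2) (ratioDown (β 1) (ratioDown (β 2) (R n))))|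
            ≤ K * (|e n| + |e (n + 1)| + |e (n + 2)| + |e (n + 3)|))) := by
  have hv2 : v 2 = ratioDown (β 2) (v 0) := hv 0
  have hv0 : v 0 = ratioDown (β 0) (v 1) := hv 1
  have hv1' : v 1 = ratioDown (β 1) (v 2) := hv 2
  have one : (0 : ℝ) < 1 := zero_lt_one
  -- The interval is dictated by the end of a block. Two final up steps apply `ratioUp (β 0)` to a
  -- number below `1`, so the result exceeds `l`. Two final down steps apply `ratioDown (β 0)` to a
  -- number above `ratioDown (β 1) 1`, so the result is below `c`.
  set l := ratioUp (β 0) 1 with hl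
  set c := ratioDown (β 0) (ratioDown (β 1) 1) with hc
  have hd11 : 1 < ratioDown (β 1) 1 := one_lt_ratioDown (hβ 1) one
  have hl0 : 0 < l := ratioUp_pos (hβ 0) one
  have hl1 : l < 1 := ratioUp_lt_one (hβ 0) one
  have hc1 : 1 < c := one_lt_ratioDown (hβ 0) (one.trans hd11)
  have hc0 : 0 < c := one.trans hc1
  have hlc : l ≤ c := (hl1.trans hc1).le
  -- Two down steps are increasing in the starting ratio and `1 < v 2`. Hence any threshold `D ≤ c`
  -- leaves the cycle intact.
  have hcv : c < v 0 := by
    rw [hv0, hv1']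
    refine ratioDown_lt (hβ 0) (one.trans (one_lt_ratioDown (hβ 1) (one.trans (hv1 2)))) ?_
    exact ratioDown_lt (hβ 1) one (hv1 2)
  -- At node `1` the threshold `ratioDown (β 1) t` must lie below `v 1`, which is `v 2 < t`. It must
  -- also exceed the ratios with which the second pattern arrives from node `2`, which is `t <
  -- ratioDown (β 2) c`. Since `1 < t`, it lies below the ratios with which the first pattern comes
  -- back to node `1`.
  obtain ⟨t, ht1, ht2⟩ : ∃ t, v 2 < t ∧ t < ratioDown (β 2) c := by
    rw [hv2]
    exact exists_between (ratioDown_lt (hβ 2) hc0 hcv)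
  have ht0 : 1 < t := (hv1 2).trans ht1
  set T₁ := ratioDown (β 1) t with hT₁
  -- An up step into node `2` ends above `T₂` exactly when it starts from a ratio below `1`. This
  -- distinguishes the visit of the first pattern from the second visit of the second pattern.
  set T₂ := ratioUp (β 2) 1 with hT₂
  have hT₁1 : 1 < T₁ := one_lt_ratioDown (hβ 1) (one.trans ht0)
  have hT₁v : T₁ < v 1 := by
    rw [hv1']
    exact ratioDown_lt (hβ 1) (one.trans (hv1 2)) ht1
  have hT₁d : T₁ < ratioDown (β 1) 1 := ratioDown_lt (hβ 1) one ht0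
  have hT₂0 : 0 < T₂ := ratioUp_pos (hβ 2) one
  have hT₂1 : T₂ < 1 := ratioUp_lt_one (hβ 2) one
  have anti : ∀ (F : ℝ → ℝ) (a b : ℝ), StrictAntiOn F (Set.Ioi 0) → 0 < a →
      AntitoneOn F (Set.Icc a b) := fun F a b hF ha =>
    hF.antitoneOn.mono fun x hx => ha.trans_le hx.1
  -- intervals along the first pattern
  obtain ⟨a₁, ha₁, ha₁'⟩ := exists_between (ratioUp_pos (hβ 1) hc0)
  obtain ⟨b₁, hb₁, hb₁'⟩ := exists_between (ratioUp_lt_one (hβ 1) hl0)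
  have hab₁ : a₁ ≤ b₁ := by
    have := ratioUp_lt (hβ 1) hl0 (hl1.trans hc1)
    linarith
  have hb₁0 : 0 < b₁ := ha₁.trans_le hab₁
  obtain ⟨a₂, ha₂, ha₂'⟩ := exists_between (ratioUp_lt (hβ 2) hb₁0 hb₁')
  obtain ⟨b₂, hb₂, hb₂'⟩ := exists_between (ratioUp_lt_one (hβ 2) ha₁)
  have hab₂ : a₂ ≤ b₂ := by
    have := (strictAntiOn_ratioUp (hβ 2)).antitoneOn ha₁ hb₁0 hab₁
    linarith
  have ha₂0 : 0 < a₂ := hT₂0.trans ha₂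
  have hb₂0 : 0 < b₂ := ha₂0.trans_le hab₂
  obtain ⟨a₃, ha₃, ha₃'⟩ := exists_between (ratioDown_lt (hβ 1) hb₂0 hb₂')
  obtain ⟨b₃, hb₃⟩ := exists_gt (ratioDown (β 1) a₂)
  have hab₃ : a₃ ≤ b₃ := by
    have := (strictAntiOn_ratioDown (hβ 1)).antitoneOn ha₂0 hb₂0 hab₂
    linarith
  have ha₃0 : 0 < a₃ := by linarith
  have hb₃0 : 0 < b₃ := ha₃0.trans_le hab₃
  -- The intervals are nested with strict inequalities, which leaves room for relative errors of one
  -- common size `ε`.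
  have E₁ := eventually_perturb_mem (anti _ l c (strictAntiOn_ratioUp (hβ 1)) hl0) hlc ha₁ ha₁' hb₁
  have E₂ := eventually_perturb_mem (anti _ a₁ b₁ (strictAntiOn_ratioUp (hβ 2)) ha₁) hab₁ ha₂0
    ha₂' hb₂
  have E₃ := eventually_perturb_mem (anti _ a₂ b₂ (strictAntiOn_ratioDown (hβ 1)) ha₂0) hab₂ ha₃0
    ha₃' hb₃
  have E₄ := eventually_perturb_mem (anti _ a₃ b₃ (strictAntiOn_ratioDown (hβ 0)) ha₃0) hab₃ hl0
    (hl1.trans (one_lt_ratioDown (hβ 0) hb₃0)) (ratioDown_lt (hβ 0) (one.trans hd11) ha₃)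
  -- intervals along the second pattern
  obtain ⟨p₁, hp₁, hp₁'⟩ := exists_between ht2
  obtain ⟨q₁, hq₁⟩ := exists_gt (ratioDown (β 2) l)
  have hpq₁ : p₁ ≤ q₁ := by
    have := ratioDown_lt (hβ 2) hl0 (hl1.trans hc1)
    linarith
  have hp₁0 : 0 < p₁ := by linarith
  have hq₁0 : 0 < q₁ := by linarith
  obtain ⟨p₂, hp₂, hp₂'⟩ := exists_between (one_lt_ratioDown (hβ 1) hq₁0)
  obtain ⟨q₂, hq₂, hq₂'⟩ := exists_between (ratioDown_lt (hβ 1) (one.trans ht0) hp₁)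
  have hpq₂ : p₂ ≤ q₂ := by
    have := (strictAntiOn_ratioDown (hβ 1)).antitoneOn hp₁0 hq₁0 hpq₁
    linarith
  have hp₂0 : 0 < p₂ := by linarith
  have hq₂0 : 0 < q₂ := by linarith
  obtain ⟨p₃, hp₃, hp₃'⟩ := exists_between (ratioUp_pos (hβ 2) hq₂0)
  obtain ⟨q₃, hq₃, hq₃'⟩ := exists_between (ratioUp_lt (hβ 2) one hp₂)
  have hpq₃ : p₃ ≤ q₃ := by
    have := (strictAntiOn_ratioUp (hβ 2)).antitoneOn hp₂0 hq₂0 hpq₂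
    linarith
  have hq₃0 : 0 < q₃ := by linarith
  have G₁ := eventually_perturb_mem (anti _ l c (strictAntiOn_ratioDown (hβ 2)) hl0) hlc hp₁0
    hp₁' hq₁
  have G₂ := eventually_perturb_mem (anti _ p₁ q₁ (strictAntiOn_ratioDown (hβ 1)) hp₁0) hpq₁ hp₂0
    hp₂' hq₂
  have G₃ := eventually_perturb_mem (anti _ p₂ q₂ (strictAntiOn_ratioUp (hβ 2)) hp₂0) hpq₂ hp₃
    hp₃' hq₃
  have G₄ := eventually_perturb_mem (anti _ p₃ q₃ (strictAntiOn_ratioUp (hβ 0)) hp₃) hpq₃ hl0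
    (ratioUp_lt (hβ 0) hq₃0 (hq₃'.trans hT₂1)) ((ratioUp_lt_one (hβ 0) hp₃).trans hc1)
  obtain ⟨ε, ⟨⟨⟨E₁, E₂⟩, E₃, E₄⟩, ⟨G₁, G₂⟩, G₃, G₄⟩, hε⟩ :=
    ((((E₁.and E₂).and (E₃.and E₄)).and ((G₁.and G₂).and (G₃.and G₄))).and
      (self_mem_nhdsWithin (a := (0 : ℝ)) (s := Set.Ioi 0))).exists
  have hε0 : |(0 : ℝ)| ≤ ε := by rw [abs_zero]; exact le_of_lt hε
  -- Zero error yields the same inclusions for the exact maps.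
  have noerr : ∀ x : ℝ, x * (1 + 0) = x := fun x => by ring
  have E₁' : ∀ R ∈ Set.Icc l c, _ := fun R hR => noerr (ratioUp (β 1) R) ▸ E₁ R hR 0 hε0
  have E₂' : ∀ R ∈ Set.Icc a₁ b₁, _ := fun R hR => noerr (ratioUp (β 2) R) ▸ E₂ R hR 0 hε0
  have E₃' : ∀ R ∈ Set.Icc a₂ b₂, _ := fun R hR => noerr (ratioDown (β 1) R) ▸ E₃ R hR 0 hε0
  have E₄' : ∀ R ∈ Set.Icc a₃ b₃, _ := fun R hR => noerr (ratioDown (β 0) R) ▸ E₄ R hR 0 hε0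
  have G₁' : ∀ R ∈ Set.Icc l c, _ := fun R hR => noerr (ratioDown (β 2) R) ▸ G₁ R hR 0 hε0
  have G₂' : ∀ R ∈ Set.Icc p₁ q₁, _ := fun R hR => noerr (ratioDown (β 1) R) ▸ G₂ R hR 0 hε0
  have G₃' : ∀ R ∈ Set.Icc p₂ q₂, _ := fun R hR => noerr (ratioUp (β 2) R) ▸ G₃ R hR 0 hε0
  have G₄' : ∀ R ∈ Set.Icc p₃ q₃, _ := fun R hR => noerr (ratioUp (β 0) R) ▸ G₄ R hR 0 hε0
  have pos_of : ∀ {x : ℝ}, x ∈ Set.Icc l c → 0 < x := fun hx => hl0.trans_le hx.1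
  refine ⟨l, c, T₁, T₂, hl0, hl1, hc1, hcv, one.trans hT₁1, hT₁v, hT₂0, hT₂1.trans (hv1 2), ?_, ε, hε,
    ?_⟩
  · refine ⟨hlc, ?_, ?_, ?_, ?_, ?_, ?_⟩
    · intro x hx y hy hxy
      have hx0 := pos_of hx
      have h1 := ratioUp_lt (hβ 1) hx0 hxy
      have h2 := ratioUp_lt (hβ 2) (ratioUp_pos (hβ 1) (pos_of hy)) h1
      have h3 := ratioDown_lt (hβ 1) (ratioUp_pos (hβ 2) (ratioUp_pos (hβ 1) hx0)) h2
      exact ratioDown_lt (hβ 0) (one.trans (one_lt_ratioDown (hβ 1)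
        (ratioUp_pos (hβ 2) (ratioUp_pos (hβ 1) (pos_of hy))))) h3
    · intro x hx y hy hxy
      have hx0 := pos_of hx
      have k1 := one.trans (one_lt_ratioDown (hβ 2) hx0)
      have k2 := one.trans (one_lt_ratioDown (hβ 2) (pos_of hy))
      have h1 := ratioDown_lt (hβ 2) hx0 hxy
      have h2 := ratioDown_lt (hβ 1) k2 h1
      have h3 := ratioUp_lt (hβ 2) (one.trans (one_lt_ratioDown (hβ 1) k1)) h2
      exact ratioUp_lt (hβ 0) (ratioUp_pos (hβ 2) (one.trans (one_lt_ratioDown (hβ 1) k2))) h3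
    · exact fun x hx => E₄' _ (E₃' _ (E₂' _ (E₁' _ hx)))
    · exact fun x hx => G₄' _ (G₃' _ (G₂' _ (G₁' _ hx)))
    · intro x hx
      exact one_lt_ratioDown (hβ 0) (one.trans (one_lt_ratioDown (hβ 1)
        (ratioUp_pos (hβ 2) (ratioUp_pos (hβ 1) (pos_of hx)))))
    · intro x hx
      exact ratioUp_lt_one (hβ 0) (ratioUp_pos (hβ 2) (one.trans (one_lt_ratioDown (hβ 1)
        (one.trans (one_lt_ratioDown (hβ 2) (pos_of hx))))))
  · obtain ⟨m, hm0, m0, m1, m2, m3, m1', m2', m3'⟩ : ∃ m : ℝ, 0 < m ∧ m ≤ l ∧ m ≤ a₁ ∧ m ≤ a₂ ∧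
        m ≤ a₃ ∧ m ≤ p₁ ∧ m ≤ p₂ ∧ m ≤ p₃ := by
      have : ∀ x : ℝ, 0 < x → ∀ᶠ m in 𝓝[>] (0 : ℝ), m ≤ x := fun x hx => by
        filter_upwards [Ioo_mem_nhdsGT hx] with y hy using hy.2.le
      obtain ⟨m, h⟩ := ((this l hl0).and ((this a₁ ha₁).and ((this a₂ ha₂0).and ((this a₃ ha₃0).and
        ((this p₁ hp₁0).and ((this p₂ hp₂0).and ((this p₃ hp₃).and
        (self_mem_nhdsWithin (a := (0 : ℝ)) (s := Set.Ioi 0))))))))).exists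
      exact ⟨m, h.2.2.2.2.2.2.2, h.1, h.2.1, h.2.2.1, h.2.2.2.1, h.2.2.2.2.1, h.2.2.2.2.2.1,
        h.2.2.2.2.2.2.1⟩
    obtain ⟨L, hL, hLip⟩ := exists_common_lipschitz hβ hm0
    refine ⟨L ^ 4, ?_⟩
    intro D side R e H he n hs hR
    have lipU : ∀ i x y e, m ≤ x → m ≤ y →
        |ratioUp (β i) x * (1 + e) - ratioUp (β i) y| ≤ L * (|x - y| + |e|) :=
      fun i x y e hx hy => (hLip i x y e hx hy).1
    have lipD : ∀ i x y e, m ≤ x → m ≤ y →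
        |ratioDown (β i) x * (1 + e) - ratioDown (β i) y| ≤ L * (|x - y| + |e|) :=
      fun i x y e hx hy => (hLip i x y e hx hy).2
    rcases H.step n with ⟨h0, s1, r1⟩ | ⟨h0, s1, r1⟩
    · rw [hs] at h0 s1 r1
      replace s1 : side (n + 1) = 1 := s1
      replace r1 : R (n + 1) = ratioUp (β 1) (R n) * (1 + e n) := r1
      have i1 : R (n + 1) ∈ Set.Icc a₁ b₁ := r1 ▸ E₁ _ hR _ (he n)
      obtain ⟨s2, r2⟩ := H.up (n := n + 1) (by
        rw [s1]; exact (i1.2.trans_lt hb₁').trans hT₁1)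
      rw [s1] at s2 r2
      replace s2 : side (n + 2) = 2 := s2
      replace r2 : R (n + 2) = ratioUp (β 2) (R (n + 1)) * (1 + e (n + 1)) := r2
      have i2 : R (n + 2) ∈ Set.Icc a₂ b₂ := r2 ▸ E₂ _ i1 _ (he _)
      obtain ⟨s3, r3⟩ := H.down (n := n + 2) (by
        rw [s2]; exact ha₂.trans_le i2.1)
      rw [s2] at s3 r3
      replace s3 : side (n + 3) = 1 := s3
      replace r3 : R (n + 3) = ratioDown (β 1) (R (n + 2)) * (1 + e (n + 2)) := r3
      have i3 : R (n + 3) ∈ Set.Icc a₃ b₃ := r3 ▸ E₃ _ i2 _ (he _)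
      obtain ⟨s4, r4⟩ := H.down (n := n + 3) (by
        rw [s3]; exact (hT₁d.trans ha₃).trans_le i3.1)
      rw [s3] at s4 r4
      replace s4 : side (n + 4) = 0 := s4
      replace r4 : R (n + 4) = ratioDown (β 0) (R (n + 3)) * (1 + e (n + 3)) := r4
      refine ⟨s4, r4 ▸ E₄ _ i3 _ (he _), Or.inl ⟨h0, s1, ?_⟩⟩
      exact abs_four_steps_le hL (lipU 1) (lipU 2) (lipD 1) (lipD 0) r1 r2 r3 r4
        (m0.trans hR.1) (m1.trans i1.1) (m2.trans i2.1) (m3.trans i3.1) (m1.trans (E₁' _ hR).1)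
        (m2.trans (E₂' _ (E₁' _ hR)).1) (m3.trans (E₃' _ (E₂' _ (E₁' _ hR))).1)
    · rw [hs] at h0 s1 r1
      replace s1 : side (n + 1) = 2 := s1
      replace r1 : R (n + 1) = ratioDown (β 2) (R n) * (1 + e n) := r1
      have i1 : R (n + 1) ∈ Set.Icc p₁ q₁ := r1 ▸ G₁ _ hR _ (he n)
      obtain ⟨s2, r2⟩ := H.down (n := n + 1) (by
        rw [s1]; exact ((hT₂1.trans ht0).trans hp₁).trans_le i1.1)
      rw [s1] at s2 r2
      replace s2 : side (n + 2) = 1 := s2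
      replace r2 : R (n + 2) = ratioDown (β 1) (R (n + 1)) * (1 + e (n + 1)) := r2
      have i2 : R (n + 2) ∈ Set.Icc p₂ q₂ := r2 ▸ G₂ _ i1 _ (he _)
      obtain ⟨s3, r3⟩ := H.up (n := n + 2) (by
        rw [s2]; exact i2.2.trans_lt hq₂')
      rw [s2] at s3 r3
      replace s3 : side (n + 3) = 2 := s3
      replace r3 : R (n + 3) = ratioUp (β 2) (R (n + 2)) * (1 + e (n + 2)) := r3
      have i3 : R (n + 3) ∈ Set.Icc p₃ q₃ := r3 ▸ G₃ _ i2 _ (he _)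
      obtain ⟨s4, r4⟩ := H.up (n := n + 3) (by
        rw [s3]; exact i3.2.trans_lt hq₃')
      rw [s3] at s4 r4
      replace s4 : side (n + 4) = 0 := s4
      replace r4 : R (n + 4) = ratioUp (β 0) (R (n + 3)) * (1 + e (n + 3)) := r4
      refine ⟨s4, r4 ▸ G₄ _ i3 _ (he _), Or.inr ⟨h0, s1, ?_⟩⟩
      exact abs_four_steps_le hL (lipD 2) (lipD 1) (lipU 2) (lipU 0) r1 r2 r3 r4
        (m0.trans hR.1) (m1'.trans i1.1) (m2'.trans i2.1) (m3'.trans i3.1)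
        (m1'.trans (G₁' _ hR).1) (m2'.trans (G₂' _ (G₁' _ hR)).1)
        (m3'.trans (G₃' _ (G₂' _ (G₁' _ hR))).1)

/-- There are thresholds for which the cycle `0 → 2 → 1 → 0` has an attracting orbit, while noisy
orbits that start near the ratio `1` at node `0` never become periodic. -/
theorem exists_thresholds {β : Fin 3 → ℝ} (hβ : ∀ i, 0 < β i) :
    ∃ T v : Fin 3 → ℝ, (∀ i, 0 < T i) ∧ (∀ i, T i < v i) ∧
      (∀ i, v (i + 2) = ratioDown (β (i + 2)) (v i)) ∧
      ∃ ε > 0, ∀ side R e, NoisyOrbit β T side R e → (∀ n, |e n| ≤ ε) → side 0 = 0 →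
        |R 0 - 1| < ε → ∀ m, 0 < m → ¬ EventuallyPeriodic side m := by
  obtain ⟨v, hv1, hv⟩ := exists_cycle hβ
  obtain ⟨l, c, T₁, T₂, hl0, hl1, hc1, hcv, hT₁, hT₁v, hT₂, hT₂v, hgap, ε, hε, K, hK⟩ :=
    exists_four_step_blocks hβ hv1 hv
  -- Any irrational number in `(0, 1)` would serve.
  have hα : Irrational (√2 - 1) := by
    simpa using irrational_sqrt_two.sub_natCast 1
  have hα0 : 0 < √2 - 1 := by
    rw [sub_pos]; exact Real.lt_sqrt_of_sq_lt (by norm_num)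
  have hα1 : √2 - 1 < 1 := by
    have : √2 < 2 := by rw [Real.sqrt_lt' (by norm_num)]; norm_num
    linarith
  obtain ⟨D, hD, ψ, hψ, hψI, hψf, hψg⟩ := hgap.exists_threshold hα0 hα1 hα
  refine ⟨![D, T₁, T₂], v, ?_, ?_, hv, min ε (min (1 - l) (c - 1)),
    lt_min hε (lt_min (by linarith) (by linarith)), ?_⟩
  · intro i
    fin_cases i
    · exact hl0.trans_le hD.1
    · exact hT₁
    · exact hT₂
  · intro i
    fin_cases i
    · exact hD.2.trans_lt hcv
    · exact hT₁v
    · exact hT₂v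
  intro side R e H he hs hR m hm hper
  obtain ⟨N, hN⟩ := hper
  have hR0 : R 0 ∈ Set.Icc l c := by
    have h1 := hR.le.trans ((min_le_right _ _).trans (min_le_left _ _))
    have h2 := hR.le.trans ((min_le_right _ _).trans (min_le_right _ _))
    exact ⟨by linarith [(abs_le.1 h1).1], by linarith [(abs_le.1 h2).2]⟩
  have block := hK D side R e H fun n => (he n).trans (min_le_left _ _)
  have hall : ∀ n, side (4 * n) = 0 ∧ R (4 * n) ∈ Set.Icc l c := by
    intro n
    induction n with
    | zero => exact ⟨hs, hR0⟩
    | succ n ih =>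
      have := block (4 * n) ih.1 ih.2
      exact ⟨this.1, this.2.1⟩
  classical
  -- The first decision of each block is the code. If `m` is a period of the sides then so is `4 *
  -- m`, hence `m` is a period of the code.
  refine not_eventually_periodic_coding hα hψ hψI hψf hψg hgap.mapsTo_up hgap.mapsTo_down
    (x := fun n => R (4 * n)) (s := fun n => side (4 * n + 1) = 1) (fun n => (hall n).2) ?_ ?_ ?_
    hm (N := N) ?_
  · intro n hn
    rcases (block (4 * n) (hall n).1 (hall n).2).2.2 with h | h
    · exact h.1
    · exact absurd (h.2.1.symm.trans hn) (by decide)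
  · intro n hn
    rcases (block (4 * n) (hall n).1 (hall n).2).2.2 with h | h
    · exact absurd h.2.1 hn
    · exact h.1
  · have h4 : Tendsto (fun n : ℕ => 4 * n) atTop atTop :=
      tendsto_atTop_mono (fun n => show n ≤ 4 * n by omega) tendsto_id
    have hlim : Tendsto (fun n => K * (|e (4 * n)| + |e (4 * n + 1)| + |e (4 * n + 2)| +
        |e (4 * n + 3)|)) atTop (𝓝 0) := by
      have ht : ∀ i, Tendsto (fun n : ℕ => |e (4 * n + i)|) atTop (𝓝 0) := fun i => by
        simpa using (H.tendsto.comp ((tendsto_add_atTop_nat i).comp h4)).abs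
      simpa using ((((ht 0).add (ht 1)).add (ht 2)).add (ht 3)).const_mul K
    refine squeeze_zero_norm (fun n => ?_) hlim
    rw [Real.norm_eq_abs]
    rcases (block (4 * n) (hall n).1 (hall n).2).2.2 with h | h
    · simp only [h.2.1, if_true]
      exact h.2.2
    · have h21 : ¬ ((2 : Fin 3) = 1) := by decide
      simp only [h.2.1, h21, if_false]
      exact h.2.2
  · intro n hn
    have hiter : ∀ k j, N ≤ j → side (j + k * m) = side j := by
      intro k
      induction k with
      | zero => intro j _; simp
      | succ k ih =>
        intro j hj
        rw [Nat.succ_mul, ← add_assoc, hN _ (by omega), ih j hj]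
    rw [show 4 * (n + m) + 1 = 4 * n + 1 + 4 * m by ring, hiter 4 _ (by omega)]

/-! ### Moments of the arrivals -/

theorem poissonMeasure_singleton_succ (r : ℝ≥0) (n : ℕ) :
    ((n + 1 : ℕ) : ℝ≥0∞) * poissonMeasure r {n + 1} = r * poissonMeasure r {n} := by
  rw [poissonMeasure_singleton, poissonMeasure_singleton, ← ENNReal.ofReal_natCast,
    ← ENNReal.ofReal_coe_nnreal, ← ENNReal.ofReal_mul (by positivity),
    ← ENNReal.ofReal_mul (by positivity)]
  congr 1
  rw [Nat.factorial_succ]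
  push_cast
  field_simp
  ring

/-- Size-biasing of the Poisson law: a constant `f` yields the mean, the identity yields the second
moment. -/
theorem lintegral_poissonMeasure_mul (r : ℝ≥0) (f : ℕ → ℝ≥0∞) :
    ∫⁻ n, n * f n ∂poissonMeasure r = r * ∫⁻ n, f (n + 1) ∂poissonMeasure r := by
  rw [lintegral_countable', lintegral_countable', tsum_eq_zero_add' ENNReal.summable,
    ← ENNReal.tsum_mul_left]
  simp only [Nat.cast_zero, zero_mul, zero_add]
  congr 1
  ext n
  rw [mul_right_comm, poissonMeasure_singleton_succ]
  ring

theorem lintegral_id_poissonMeasure (r : ℝ≥0) :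
    ∫⁻ n, (n : ℝ≥0∞) ∂poissonMeasure r = r := by
  simpa using lintegral_poissonMeasure_mul r fun _ => 1

theorem lintegral_sq_poissonMeasure (r : ℝ≥0) :
    ∫⁻ n, (n : ℝ≥0∞) ^ 2 ∂poissonMeasure r = r * (r + 1) := by
  have h := lintegral_poissonMeasure_mul r fun n => (n : ℝ≥0∞)
  simp only [Nat.cast_add, Nat.cast_one] at h
  rw [lintegral_add_right _ measurable_const, lintegral_id_poissonMeasure] at h
  simp only [sq]
  simpa using h

variable {r : Rates}

theorem lintegral_poissonArrivals (s : ℝ≥0) (i : Fin 3) (f : ℕ → ℝ≥0∞) :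
    ∫⁻ a, f (a i) ∂poissonArrivals r s = ∫⁻ n, f n ∂poissonMeasure (r.lam i * s) := by
  have h := measurePreserving_eval (fun i => poissonMeasure (r.lam i * s)) i
  rw [← h.map_eq, lintegral_map (measurable_of_countable _) (measurable_pi_apply i)]
  rfl

theorem lintegral_arrivals (S : ServiceLaws r) (j i : Fin 3) (f : ℕ → ℝ≥0∞) :
    ∫⁻ a, f (a i) ∂arrivals S j =
      ∫⁻ s, ∫⁻ n, f n ∂poissonMeasure (r.lam i * s) ∂S.law j := by
  rw [arrivals, Measure.lintegral_bind (measurable_poissonArrivals r).aemeasurable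
    (measurable_of_countable _).aemeasurable]
  simp only [lintegral_poissonArrivals]

theorem lintegral_arrivals_apply (S : ServiceLaws r) (j i : Fin 3) :
    ∫⁻ a, (a i : ℝ≥0∞) ∂arrivals S j = r.lam i * (r.mu j : ℝ≥0∞)⁻¹ := by
  rw [lintegral_arrivals S j i fun n => (n : ℝ≥0∞)]
  simp only [lintegral_id_poissonMeasure, ENNReal.coe_mul]
  rw [lintegral_const_mul _ (by fun_prop), S.mean]

theorem lintegral_arrivals_sq_lt_top (S : ServiceLaws r) (j i : Fin 3) :
    ∫⁻ a, (a i : ℝ≥0∞) ^ 2 ∂arrivals S j < ∞ := by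
  rw [lintegral_arrivals S j i fun n => (n : ℝ≥0∞) ^ 2]
  simp only [lintegral_sq_poissonMeasure, ENNReal.coe_mul]
  have h : ∀ s : ℝ≥0, (r.lam i : ℝ≥0∞) * s * (r.lam i * s + 1) =
      (r.lam i : ℝ≥0∞) ^ 2 * (s : ℝ≥0∞) ^ 2 + r.lam i * s := fun s => by ring
  simp only [h]
  rw [lintegral_add_right _ (by fun_prop), lintegral_const_mul _ (by fun_prop),
    lintegral_const_mul _ (by fun_prop), S.mean]
  have h2 : (r.lam i : ℝ≥0∞) ^ 2 ≠ ∞ := by simp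
  have h3 : (r.mu j : ℝ≥0∞)⁻¹ ≠ ∞ := by simpa using (r.mu_pos j).ne'
  exact ENNReal.add_lt_top.2 ⟨ENNReal.mul_lt_top h2.lt_top (S.secondMoment j),
    ENNReal.mul_lt_top ENNReal.coe_lt_top h3.lt_top⟩

theorem memLp_arrivals (S : ServiceLaws r) (j i : Fin 3) :
    MemLp (fun a : Fin 3 → ℕ => (a i : ℝ)) 2 (arrivals S j) := by
  refine ⟨(measurable_of_countable _).aestronglyMeasurable, ?_⟩
  rw [eLpNorm_lt_top_iff_lintegral_rpow_enorm_lt_top (by norm_num) (by norm_num)]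
  refine lt_of_eq_of_lt (lintegral_congr fun a => ?_) (lintegral_arrivals_sq_lt_top S j i)
  simp only [ENNReal.toReal_ofNat, Real.enorm_natCast]
  exact_mod_cast ENNReal.rpow_natCast (a i : ℝ≥0∞) 2

theorem integral_arrivals_apply (S : ServiceLaws r) (j i : Fin 3) :
    ∫ a, (a i : ℝ) ∂arrivals S j = r.lam i / r.mu j := by
  rw [integral_eq_lintegral_of_nonneg_ae (Eventually.of_forall fun a => Nat.cast_nonneg _)
    (measurable_of_countable _).aestronglyMeasurable]
  simp only [ENNReal.ofReal_natCast]
  rw [lintegral_arrivals_apply]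
  simp [div_eq_mul_inv]

/-- A positive service time gives every arrival vector positive probability, and the service time
cannot vanish almost surely because its mean is not zero. -/
theorem arrivals_singleton_ne_zero (S : ServiceLaws r) (j : Fin 3) (a : Fin 3 → ℕ) :
    arrivals S j {a} ≠ 0 := by
  rw [arrivals, Measure.bind_apply (MeasurableSet.singleton a)
    (measurable_poissonArrivals r).aemeasurable]
  have hm : Measurable fun s => poissonArrivals r s {a} :=
    (Measure.measurable_coe (MeasurableSet.singleton a)).comp (measurable_poissonArrivals r)
  intro h
  rw [lintegral_eq_zero_iff hm] at h
  have h0 : ∀ᵐ s ∂S.law j, s = 0 := by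
    filter_upwards [h] with s hs
    by_contra hs0
    have hs' : 0 < s := pos_iff_ne_zero.2 hs0
    rw [Pi.zero_apply, poissonArrivals, Measure.pi_singleton, Finset.prod_eq_zero_iff] at hs
    obtain ⟨i, -, hi⟩ := hs
    rw [poissonMeasure_singleton, ENNReal.ofReal_eq_zero] at hi
    have hp : (0 : ℝ) < (r.lam i * s : ℝ≥0) := by
      exact_mod_cast mul_pos (r.lam_pos i) hs'
    have : (0 : ℝ) < Real.exp (-((r.lam i * s : ℝ≥0) : ℝ)) * ((r.lam i * s : ℝ≥0) : ℝ) ^ a i /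
      (a i).factorial := by positivity
    linarith
  have hmean := S.mean j
  rw [lintegral_congr_ae (g := fun _ => 0) (by
    filter_upwards [h0] with s hs
    simp [hs])] at hmean
  rw [lintegral_zero] at hmean
  exact ENNReal.inv_ne_zero.2 ENNReal.coe_ne_top hmean.symm

/-! ### The fluid target of a service period -/

/-- The queue lengths when the server has emptied queue `j` in the fluid model. -/
noncomputable def target (r : Rates) (j : Fin 3) (x : Fin 3 → ℝ) : Fin 3 → ℝ := fun i =>
  if i = j then 0 else x i + r.lam i / (r.mu j - r.lam j) * x j

/-- The increment of the target over one service. -/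
noncomputable def targetIncr (r : Rates) (j i : Fin 3) (a : Fin 3 → ℕ) : ℝ :=
  if i = j then 0 else a i + r.lam i / (r.mu j - r.lam j) * (a j - 1)

theorem Rates.lam_lt_mu {r : Rates} (hload : ∀ i, r.rho i < 1) (j : Fin 3) :
    (r.lam j : ℝ) < r.mu j := by
  have := hload j
  rwa [Rates.rho, div_lt_one (by exact_mod_cast r.mu_pos j)] at this

theorem toReal_serve {x : Fin 3 → ℕ} {j : Fin 3} (hx : x j ≠ 0) (a : Fin 3 → ℕ) (i : Fin 3) :
    toReal (x - Pi.single j 1 + a) i = toReal x i + ((a i : ℝ) - if i = j then 1 else 0) := by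
  unfold toReal
  by_cases h : i = j
  · subst h
    have : 1 ≤ x i := Nat.one_le_iff_ne_zero.2 hx
    simp [Nat.cast_sub this]
    ring
  · simp [h]

theorem target_serve {x : Fin 3 → ℕ} {j : Fin 3} (hx : x j ≠ 0) (a : Fin 3 → ℕ) (i : Fin 3) :
    target r j (toReal (x - Pi.single j 1 + a)) i =
      target r j (toReal x) i + targetIncr r j i a := by
  unfold target targetIncr
  by_cases h : i = j
  · simp [h]
  · simp only [h, if_false, toReal_serve hx]
    simp
    ring

theorem memLp_targetIncr (S : ServiceLaws r) (j i : Fin 3) :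
    MemLp (targetIncr r j i) 2 (arrivals S j) := by
  unfold targetIncr
  by_cases h : i = j
  · simp only [h, if_true]; exact MemLp.zero'
  · simp only [h, if_false]
    exact (memLp_arrivals S j i).add (((memLp_arrivals S j j).sub (memLp_const 1)).const_mul _)

/-- The mean loss `1 - ρ_j` at queue `j` shortens the remaining service period just enough to offset
the arrivals at `i`. So the target is a martingale while `j` is served. -/
theorem integral_targetIncr (hload : ∀ i, r.rho i < 1) (S : ServiceLaws r) (j i : Fin 3) :
    ∫ a, targetIncr r j i a ∂arrivals S j = 0 := by
  unfold targetIncr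
  by_cases h : i = j
  · simp [h]
  · simp only [h, if_false]
    have h1 := (memLp_arrivals S j i).integrable one_le_two
    have h2 := (memLp_arrivals S j j).integrable one_le_two
    have h6 : Integrable (fun a : Fin 3 → ℕ => (r.lam i : ℝ) / (r.mu j - r.lam j) * (a j - 1))
        (arrivals S j) := (h2.sub (integrable_const 1)).const_mul _
    rw [integral_add h1 h6, integral_const_mul,
      integral_sub h2 (integrable_const 1), integral_arrivals_apply, integral_arrivals_apply]
    have h3 := Rates.lam_lt_mu hload j
    have h4 : (0 : ℝ) < r.mu j := by exact_mod_cast r.mu_pos j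
    have h5 : (r.mu j : ℝ) - r.lam j ≠ 0 := by linarith
    simp
    field_simp
    ring

theorem integral_sq_add {Ω : Type*} [MeasurableSpace Ω] {μ : Measure Ω} [IsProbabilityMeasure μ]
    {ξ : Ω → ℝ} (h : MemLp ξ 2 μ) (h0 : ∫ ω, ξ ω ∂μ = 0) (A : ℝ) :
    Integrable (fun ω => (A + ξ ω) ^ 2) μ ∧ ∫ ω, (A + ξ ω) ^ 2 ∂μ = A ^ 2 + ∫ ω, ξ ω ^ 2 ∂μ := by
  have h1 := h.integrable one_le_two
  have h2 := h.integrable_sq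
  have h3 : (fun ω => (A + ξ ω) ^ 2) = fun ω => A ^ 2 + 2 * A * ξ ω + ξ ω ^ 2 := by
    ext ω; ring
  rw [h3]
  have h4 : Integrable (fun ω => A ^ 2 + 2 * A * ξ ω) μ := (integrable_const _).add (h1.const_mul _)
  refine ⟨h4.add h2, ?_⟩
  rw [integral_add h4 h2, integral_add (integrable_const _) (h1.const_mul _), integral_const_mul, h0]
  simp

/-- The compensator of the squared deviation from the target, per job in the queue. -/
noncomputable def compensator (S : ServiceLaws r) (j : Fin 3) : ℝ :=
  (∑ i, ∫ a, targetIncr r j i a ^ 2 ∂arrivals S j) / (1 - r.rho j)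

theorem compensator_nonneg (hload : ∀ i, r.rho i < 1) (S : ServiceLaws r) (j : Fin 3) :
    0 ≤ compensator S j := by
  refine div_nonneg (Finset.sum_nonneg fun i _ => integral_nonneg fun _ => sq_nonneg _) ?_
  linarith [hload j]

/-- The squared deviation of the target from `c`, compensated so as to be harmonic while the
server is at `j`. -/
noncomputable def potential (S : ServiceLaws r) (j : Fin 3) (c : Fin 3 → ℝ) (x : Fin 3 → ℕ) : ℝ :=
  ∑ i, (target r j (toReal x) i - c i) ^ 2 + compensator S j * x j

theorem potential_nonneg (hload : ∀ i, r.rho i < 1) (S : ServiceLaws r) (j : Fin 3)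
    (c : Fin 3 → ℝ) (x : Fin 3 → ℕ) : 0 ≤ potential S j c x :=
  add_nonneg (Finset.sum_nonneg fun _ _ => sq_nonneg _)
    (mul_nonneg (compensator_nonneg hload S j) (Nat.cast_nonneg _))

theorem integral_queue_serve (S : ServiceLaws r) {x : Fin 3 → ℕ} {j : Fin 3} (hx : x j ≠ 0) :
    Integrable (fun a : Fin 3 → ℕ => (((x - Pi.single j 1 + a : Fin 3 → ℕ) j : ℕ) : ℝ)) (arrivals S j) ∧
    ∫ a, (((x - Pi.single j 1 + a : Fin 3 → ℕ) j : ℕ) : ℝ) ∂arrivals S j = x j - (1 - r.rho j) := by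
  have h2 := (memLp_arrivals S j j).integrable one_le_two
  have h : (fun a : Fin 3 → ℕ => (((x - Pi.single j 1 + a : Fin 3 → ℕ) j : ℕ) : ℝ)) =
      fun a => (x j : ℝ) + ((a j : ℝ) - 1) := by
    ext a
    simpa [toReal] using toReal_serve hx a j
  rw [h]
  have h3 : Integrable (fun a : Fin 3 → ℕ => (a j : ℝ) - 1) (arrivals S j) :=
    h2.sub (integrable_const 1)
  refine ⟨(integrable_const _).add h3, ?_⟩
  rw [integral_add (integrable_const _) h3,
    integral_sub h2 (integrable_const 1), integral_arrivals_apply]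
  simp [Rates.rho]
  ring

/-- A service adds the second moment of the target increment to the mean squared deviation and
removes `1 - ρ_j` jobs from queue `j` on average. `compensator` is the quotient of the two, so they
cancel. -/
theorem integral_potential_serve (hload : ∀ i, r.rho i < 1) (S : ServiceLaws r)
    {x : Fin 3 → ℕ} {j : Fin 3} (hx : x j ≠ 0) (c : Fin 3 → ℝ) :
    Integrable (fun a => potential S j c (x - Pi.single j 1 + a)) (arrivals S j) ∧
    ∫ a, potential S j c (x - Pi.single j 1 + a) ∂arrivals S j = potential S j c x := by
  have hsq : ∀ i, Integrable (fun a => (target r j (toReal (x - Pi.single j 1 + a)) i - c i) ^ 2)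
      (arrivals S j) ∧
      ∫ a, (target r j (toReal (x - Pi.single j 1 + a)) i - c i) ^ 2 ∂arrivals S j =
        (target r j (toReal x) i - c i) ^ 2 + ∫ a, targetIncr r j i a ^ 2 ∂arrivals S j := by
    intro i
    have := integral_sq_add (memLp_targetIncr S j i) (integral_targetIncr hload S j i)
      (target r j (toReal x) i - c i)
    have e : ∀ a, target r j (toReal (x - Pi.single j 1 + a)) i - c i =
        target r j (toReal x) i - c i + targetIncr r j i a := fun a => by
      rw [target_serve hx]; ring
    simpa only [e] using this
  obtain ⟨hq, hq'⟩ := integral_queue_serve S hx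
  have hs := integrable_finsetSum Finset.univ fun i _ => (hsq i).1
  unfold potential
  refine ⟨hs.add (hq.const_mul _), ?_⟩
  rw [integral_add hs (hq.const_mul _), integral_finsetSum _ fun i _ => (hsq i).1,
    integral_const_mul, hq']
  simp only [(hsq _).2, Finset.sum_add_distrib]
  have : 1 - r.rho j ≠ 0 := by linarith [hload j]
  unfold compensator
  field_simp
  ring

/-! ### Growth of the workload at a switch -/

/-- The node `j` is a possible destination of a server that has emptied queue `i` and left the
queue lengths `y` behind. -/
def Allowed (d : Fin 3 → ℝ) (y : Fin 3 → ℕ) (i j : Fin 3) : Prop :=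
  y i = 0 ∧ y ≠ 0 ∧ ((j = i + 1 ∧ proj (toReal y) (i + 2) ≤ d i) ∨
    (j = i + 2 ∧ d i ≤ proj (toReal y) (i + 2)))

/-- The total workload. -/
noncomputable def work (r : Rates) (c : Fin 3 → ℝ) : ℝ := ∑ i, c i / r.mu i

variable {d : Fin 3 → ℝ}

theorem Rates.mu_pos' (r : Rates) (i : Fin 3) : (0 : ℝ) < r.mu i := by
  exact_mod_cast r.mu_pos i

theorem Rates.lam_pos' (r : Rates) (i : Fin 3) : (0 : ℝ) < r.lam i := by
  exact_mod_cast r.lam_pos i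

theorem toReal_nonneg (y : Fin 3 → ℕ) (i : Fin 3) : 0 ≤ toReal y i := Nat.cast_nonneg _

theorem sum_toReal_pos {y : Fin 3 → ℕ} (hy : y ≠ 0) : 0 < ∑ i, toReal y i := by
  obtain ⟨i, hi⟩ := Function.ne_iff.1 hy
  refine Finset.sum_pos' (fun i _ => toReal_nonneg y i) ⟨i, Finset.mem_univ _, ?_⟩
  exact Nat.cast_pos.2 (Nat.pos_of_ne_zero hi)

theorem sum_cyclic (f : Fin 3 → ℝ) (i : Fin 3) : ∑ k, f k = f i + f (i + 1) + f (i + 2) := by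
  rw [Fin.sum_univ_three]
  fin_cases i
  · rfl
  · change f 0 + f 1 + f 2 = f 1 + f 2 + f 0; ring
  · change f 0 + f 1 + f 2 = f 2 + f 0 + f 1; ring

/-- Because the decision points avoid `0` and `1`, the server never chooses a node that holds less
than a fixed share of the jobs. -/
theorem exists_share_lower_bound (hd : ∀ i, d i ∈ Set.Ioo (0 : ℝ) 1) :
    ∃ γ > 0, ∀ y i j, Allowed d y i j → γ * ∑ k, toReal y k ≤ toReal y j := by
  obtain ⟨γ, hγ, h⟩ : ∃ γ > 0, ∀ i, γ ≤ d i ∧ γ ≤ 1 - d i := by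
    have h1 : ∀ i, ∀ᶠ γ in 𝓝[>] (0 : ℝ), γ ≤ d i ∧ γ ≤ 1 - d i := fun i => by
      filter_upwards [Ioo_mem_nhdsGT (hd i).1, Ioo_mem_nhdsGT (sub_pos.2 (hd i).2)] with x h1 h2
      exact ⟨h1.2.le, h2.2.le⟩
    obtain ⟨γ, h, hγ⟩ := ((eventually_all.2 h1).and self_mem_nhdsWithin).exists
    exact ⟨γ, hγ, h⟩
  refine ⟨γ, hγ, ?_⟩
  rintro y i j ⟨h0, hy, hj⟩
  have hs := sum_toReal_pos hy
  have hi : toReal y i = 0 := by simp [toReal, h0]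
  have hsum := sum_cyclic (toReal y) i
  rw [hi, zero_add] at hsum
  rcases hj with ⟨rfl, hj⟩ | ⟨rfl, hj⟩
  · rw [proj, div_le_iff₀ hs] at hj
    nlinarith [(h i).2]
  · rw [proj, le_div_iff₀ hs] at hj
    nlinarith [(h i).1]

/-- Emptying queue `j` takes time `y j / (μ_j - λ_j)`, during which work arrives at rate `∑ ρ_i` and
is removed at rate `1`. -/
theorem work_target (hload : ∀ i, r.rho i < 1) (j : Fin 3) (y : Fin 3 → ℝ) :
    work r (target r j y) = work r y + y j * ((∑ i, r.rho i - 1) / (r.mu j - r.lam j)) := by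
  have h1 : ((r.mu j : ℝ) - r.lam j) ≠ 0 := by linarith [Rates.lam_lt_mu hload j]
  have h2 := (r.mu_pos' j).ne'
  have n1 : j + 1 ≠ j := by clear * -; revert j; decide
  have n2 : j + 2 ≠ j := by clear * -; revert j; decide
  unfold work
  rw [sum_cyclic _ j, sum_cyclic (fun i => y i / r.mu i) j, sum_cyclic r.rho j]
  simp only [target, n1, n2, if_true, if_false, Rates.rho]
  have h3 := (r.mu_pos' (j + 1)).ne'
  have h4 := (r.mu_pos' (j + 2)).ne'
  field_simp
  ring

theorem exists_le_work (r : Rates) :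
    ∃ C > 0, ∀ y : Fin 3 → ℝ, (∀ i, 0 ≤ y i) → ∑ i, y i ≤ C * work r y ∧
      work r y ≤ C * ∑ i, y i := by
  refine ⟨∑ i, ((r.mu i : ℝ) + 1 / r.mu i), ?_, fun y hy => ⟨?_, ?_⟩⟩
  · exact Finset.sum_pos (fun i _ => by have := r.mu_pos' i; positivity) ⟨0, Finset.mem_univ _⟩
  · rw [work, Finset.mul_sum]
    refine Finset.sum_le_sum fun i _ => ?_
    have h := r.mu_pos' i
    have h1 : (r.mu i : ℝ) ≤ ∑ i, ((r.mu i : ℝ) + 1 / r.mu i) := by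
      refine le_trans ?_ (Finset.single_le_sum (f := fun i => (r.mu i : ℝ) + 1 / r.mu i)
        (fun j _ => by have := r.mu_pos' j; positivity) (Finset.mem_univ i))
      have : (0 : ℝ) < 1 / r.mu i := by positivity
      linarith
    calc y i = r.mu i * (y i / r.mu i) := by field_simp
      _ ≤ _ := by have := hy i; gcongr
  · rw [work, Finset.mul_sum]
    refine Finset.sum_le_sum fun i _ => ?_
    have h := r.mu_pos' i
    have h1 : 1 / (r.mu i : ℝ) ≤ ∑ i, ((r.mu i : ℝ) + 1 / r.mu i) := by
      refine le_trans ?_ (Finset.single_le_sum (f := fun i => (r.mu i : ℝ) + 1 / r.mu i)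
        (fun j _ => by have := r.mu_pos' j; positivity) (Finset.mem_univ i))
      linarith
    calc y i / r.mu i = 1 / r.mu i * y i := by field_simp
      _ ≤ _ := by have := hy i; gcongr

/-- Switching to an allowed node increases the target workload by a factor. -/
theorem exists_work_growth (hload : ∀ i, r.rho i < 1) (htr : 1 < ∑ i, r.rho i)
    (hd : ∀ i, d i ∈ Set.Ioo (0 : ℝ) 1) :
    ∃ g > 0, ∀ y i j, Allowed d y i j →
      (1 + g) * work r (toReal y) ≤ work r (target r j (toReal y)) := by
  obtain ⟨γ, hγ, hγ'⟩ := exists_share_lower_bound hd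
  obtain ⟨C, hC, hC'⟩ := exists_le_work r
  obtain ⟨q, hq, hq'⟩ : ∃ q > 0, ∀ j, q ≤ (∑ i, r.rho i - 1) / (r.mu j - r.lam j) := by
    have h1 : ∀ j, ∀ᶠ q in 𝓝[>] (0 : ℝ), q ≤ (∑ i, r.rho i - 1) / (r.mu j - r.lam j) := fun j => by
      filter_upwards [Ioo_mem_nhdsGT (div_pos (sub_pos.2 htr)
        (sub_pos.2 (Rates.lam_lt_mu hload j)))] with x h1
      exact h1.2.le
    obtain ⟨γ, h, hγ⟩ := ((eventually_all.2 h1).and self_mem_nhdsWithin).exists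
    exact ⟨γ, hγ, h⟩
  refine ⟨γ / C * q, by positivity, fun y i j h => ?_⟩
  rw [work_target hload]
  have h1 := hγ' y i j h
  have h2 := (hC' _ (toReal_nonneg y)).2
  have h3 : γ / C * work r (toReal y) ≤ toReal y j := by
    refine le_trans ?_ h1
    calc γ / C * work r (toReal y) ≤ γ / C * (C * ∑ k, toReal y k) := by gcongr
      _ = _ := by field_simp
  have h4 : γ / C * work r (toReal y) * q ≤
      toReal y j * ((∑ i, r.rho i - 1) / (r.mu j - r.lam j)) :=
    mul_le_mul h3 (hq' j) hq.le (toReal_nonneg y j)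
  linarith

/-- All queues that are not empty at the target are comparable with the target workload. -/
theorem exists_target_lower_bound (hload : ∀ i, r.rho i < 1) (htr : 1 < ∑ i, r.rho i)
    (hd : ∀ i, d i ∈ Set.Ioo (0 : ℝ) 1) :
    ∃ δ > 0, ∀ y i j, Allowed d y i j → ∀ k, k ≠ j →
      δ * work r (target r j (toReal y)) ≤ target r j (toReal y) k := by
  obtain ⟨γ, hγ, hγ'⟩ := exists_share_lower_bound hd
  obtain ⟨C, hC, hC'⟩ := exists_le_work r
  obtain ⟨q, hq, hq'⟩ : ∃ q > 0, ∀ j k, q ≤ (r.lam k : ℝ) / (r.mu j - r.lam j) := by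
    have h1 : ∀ j k, ∀ᶠ q in 𝓝[>] (0 : ℝ), q ≤ (r.lam k : ℝ) / (r.mu j - r.lam j) := fun j k => by
      filter_upwards [Ioo_mem_nhdsGT (div_pos (r.lam_pos' k)
        (sub_pos.2 (Rates.lam_lt_mu hload j)))] with x h1
      exact h1.2.le
    obtain ⟨γ, h, hγ⟩ :=
      ((eventually_all.2 fun j => eventually_all.2 (h1 j)).and self_mem_nhdsWithin).exists
    exact ⟨γ, hγ, h⟩
  obtain ⟨p, hp, hp'⟩ : ∃ p > 0, ∀ j, (∑ i, r.rho i - 1) / (r.mu j - r.lam j) ≤ p := by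
    have h0 : ∀ j, 0 < (∑ i, r.rho i - 1) / (r.mu j - r.lam j : ℝ) := fun j =>
      div_pos (sub_pos.2 htr) (sub_pos.2 (Rates.lam_lt_mu hload j))
    exact ⟨∑ j, (∑ i, r.rho i - 1) / (r.mu j - r.lam j : ℝ), Finset.sum_pos (fun j _ => h0 j)
      ⟨0, Finset.mem_univ _⟩, fun j => Finset.single_le_sum
      (f := fun j => (∑ i, r.rho i - 1) / (r.mu j - r.lam j : ℝ)) (fun j _ => (h0 j).le)
      (Finset.mem_univ j)⟩
  -- The arrivals at `k` during the service period alone amount to at least `q * γ` times the number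
  -- of jobs, while the target workload is at most `C + p` times that number.
  refine ⟨q * γ / (C + p), by positivity, fun y i j h k hk => ?_⟩
  have h1 := hγ' y i j h
  have h2 := (hC' _ (toReal_nonneg y)).2
  have hj0 := toReal_nonneg y j
  have hk0 := toReal_nonneg y k
  have hjs : toReal y j ≤ ∑ k, toReal y k :=
    Finset.single_le_sum (fun i _ => toReal_nonneg y i) (Finset.mem_univ j)
  have h3 : work r (target r j (toReal y)) ≤ (C + p) * ∑ k, toReal y k := by
    rw [work_target hload, add_mul]
    refine add_le_add h2 ?_
    rw [mul_comm p]
    exact mul_le_mul hjs (hp' j) (div_pos (sub_pos.2 htr)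
      (sub_pos.2 (Rates.lam_lt_mu hload j))).le (hj0.trans hjs)
  have h4 : target r j (toReal y) k =
      toReal y k + r.lam k / (r.mu j - r.lam j) * toReal y j := by simp [target, hk]
  calc q * γ / (C + p) * work r (target r j (toReal y))
      ≤ q * γ / (C + p) * ((C + p) * ∑ k, toReal y k) := by gcongr
    _ = q * (γ * ∑ k, toReal y k) := by field_simp
    _ ≤ r.lam k / (r.mu j - r.lam j) * toReal y j := by
        refine mul_le_mul (hq' j k) h1 (by have := hj0.trans hjs; positivity) ?_
        exact (div_pos (r.lam_pos' k) (sub_pos.2 (Rates.lam_lt_mu hload j))).le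
    _ ≤ _ := by rw [h4]; linarith

theorem target_work_pos (hload : ∀ i, r.rho i < 1) (htr : 1 < ∑ i, r.rho i)
    (j : Fin 3) {y : Fin 3 → ℕ} (hy : y ≠ 0) : 0 < work r (toReal y) ∧
      work r (toReal y) ≤ work r (target r j (toReal y)) := by
  constructor
  · obtain ⟨i, hi⟩ := Function.ne_iff.1 hy
    refine Finset.sum_pos' (fun i _ => div_nonneg (toReal_nonneg y i) (r.mu_pos' i).le)
      ⟨i, Finset.mem_univ _, div_pos (Nat.cast_pos.2 (Nat.pos_of_ne_zero hi)) (r.mu_pos' i)⟩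
  · rw [work_target hload]
    have := mul_nonneg (toReal_nonneg y j) (div_pos (sub_pos.2 htr)
      (sub_pos.2 (Rates.lam_lt_mu hload j))).le
    linarith

/-- Deviations of size `w ^ (3 / 4)` are negligible with respect to `w`. -/
theorem exists_abs_le_of_sum_sq_le {η : ℝ} (hη : 0 < η) :
    ∃ w₀ > 0, ∀ w, w₀ ≤ w → ∀ y : Fin 3 → ℝ, ∑ i, y i ^ 2 ≤ w * √w → ∀ i, |y i| ≤ η * w := by
  refine ⟨(1 / η ^ 2) ^ 2, by positivity, fun w hw y hy i => ?_⟩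
  have hw0 : 0 < w := lt_of_lt_of_le (by positivity) hw
  have h1 : 1 / η ^ 2 ≤ √w := Real.le_sqrt_of_sq_le hw
  have h2 : 1 ≤ η ^ 2 * √w := by
    rw [div_le_iff₀ (by positivity)] at h1; linarith
  have h3 : y i ^ 2 ≤ (η * w) ^ 2 := by
    have h4 : y i ^ 2 ≤ ∑ i, y i ^ 2 :=
      Finset.single_le_sum (f := fun i => y i ^ 2) (fun i _ => sq_nonneg _) (Finset.mem_univ i)
    have h5 : √w * √w = w := Real.mul_self_sqrt hw0.le
    have h6 : w * √w * 1 ≤ w * √w * (η ^ 2 * √w) := by gcongr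
    have h7 : w * √w * (η ^ 2 * √w) = (η * w) ^ 2 := by
      calc w * √w * (η ^ 2 * √w) = w * η ^ 2 * (√w * √w) := by ring
        _ = _ := by rw [h5]; ring
    linarith
  exact abs_le_of_sq_le_sq h3 (by positivity)

/-- For large workloads the admitted deviation costs only a small fraction of the workload, so half
of the growth rate `g` survives. -/
theorem exists_work_growth_of_close (hload : ∀ i, r.rho i < 1) (htr : 1 < ∑ i, r.rho i)
    (hd : ∀ i, d i ∈ Set.Ioo (0 : ℝ) 1) :
    ∃ κ > 1, ∃ w₀ > 0, ∀ c : Fin 3 → ℝ, w₀ ≤ work r c → ∀ y : Fin 3 → ℕ,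
      ∑ i, (toReal y i - c i) ^ 2 ≤ work r c * √(work r c) → ∀ i j, Allowed d y i j →
      κ * work r c ≤ work r (target r j (toReal y)) := by
  obtain ⟨g, hg, hg'⟩ := exists_work_growth hload htr hd
  set M := ∑ i, 1 / (r.mu i : ℝ) with hM
  have hM0 : 0 < M := Finset.sum_pos (fun i _ => by have := r.mu_pos' i; positivity)
    ⟨0, Finset.mem_univ _⟩
  obtain ⟨w₀, hw₀, h⟩ := exists_abs_le_of_sum_sq_le (η := g / (2 * (1 + g) * M)) (by positivity)
  refine ⟨1 + g / 2, by linarith, w₀, hw₀, fun c hc y hy i j hA => ?_⟩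
  have h1 := h _ hc (fun i => toReal y i - c i) hy
  have h2 : work r c - g / (2 * (1 + g)) * work r c ≤ work r (toReal y) := by
    have h3 : work r c - work r (toReal y) ≤ ∑ i, g / (2 * (1 + g) * M) * work r c * (1 / r.mu i) := by
      unfold work
      rw [← Finset.sum_sub_distrib]
      refine Finset.sum_le_sum fun i _ => ?_
      rw [← sub_div, div_eq_mul_one_div]
      have := r.mu_pos' i
      gcongr
      have := (abs_le.1 (h1 i)).1
      unfold work at this
      linarith
    rw [← Finset.mul_sum, ← hM] at h3
    have h4 : g / (2 * (1 + g) * M) * work r c * M = g / (2 * (1 + g)) * work r c := by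
      field_simp
    linarith
  refine le_trans ?_ (hg' y i j hA)
  calc (1 + g / 2) * work r c = (1 + g) * (work r c - g / (2 * (1 + g)) * work r c) := by
        field_simp; ring
    _ ≤ _ := by gcongr

/-! ### One step of the chain -/

theorem lintegral_kernel_serve (S : ServiceLaws r) (tie : TieRule) {s : State} (hs : s.1 s.2 ≠ 0)
    (f : State → ℝ≥0∞) :
    ∫⁻ s', f s' ∂kernel S d tie s =
      ∫⁻ a, f (s.1 - Pi.single s.2 1 + a, s.2) ∂arrivals S s.2 := by
  change ∫⁻ s', f s' ∂transition S d tie s = _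
  rw [transition, if_pos hs, lintegral_map (measurable_of_countable _) (measurable_of_countable _)]

/-- Since `Allowed` has weak inequalities, this bound treats all tie rules at once. -/
theorem lintegral_kernel_switch_le (S : ServiceLaws r) (tie : TieRule) {s : State}
    (hs : s.1 s.2 = 0) (hs' : s.1 ≠ 0) {f : State → ℝ≥0∞} {b : ℝ≥0∞}
    (hf : ∀ j, Allowed d s.1 s.2 j → f (s.1, j) ≤ b) :
    ∫⁻ s', f s' ∂kernel S d tie s ≤ b := by
  change ∫⁻ s', f s' ∂transition S d tie s ≤ b
  rw [transition, if_neg (not_not.2 hs), if_pos hs', lintegral_add_measure, lintegral_smul_measure,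
    lintegral_smul_measure, lintegral_dirac, lintegral_dirac, smul_eq_mul, smul_eq_mul]
  rcases lt_trichotomy (proj (toReal s.1) (s.2 + 2)) (d s.2) with h | h | h
  · have hp : probNext d tie s.1 s.2 = 1 := by rw [probNext, if_pos h]
    simpa [hp] using hf _ ⟨hs, hs', Or.inl ⟨rfl, h.le⟩⟩
  · have h1 := hf _ ⟨hs, hs', Or.inl ⟨rfl, h.le⟩⟩
    have h2 := hf _ ⟨hs, hs', Or.inr ⟨rfl, h.ge⟩⟩
    set p := probNext d tie s.1 s.2
    calc _ ≤ ENNReal.ofReal p * b + ENNReal.ofReal (1 - p) * b := by gcongr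
      _ = b := by
        rw [← add_mul, ← ENNReal.ofReal_add p.2.1 (sub_nonneg.2 p.2.2)]
        simp
  · have hp : probNext d tie s.1 s.2 = 0 := by rw [probNext, if_neg h.not_gt, if_pos h]
    simpa [hp] using hf _ ⟨hs, hs', Or.inr ⟨rfl, h.le⟩⟩

/-! ### Following the fluid model -/

/-- The server has emptied its queue in the state `s`, but the outcome is not close to the
fluid target of the service period that started after the state `L`. -/
def Bad (r : Rates) (d : Fin 3 → ℝ) (L s : State) : Prop :=
  s.1 = 0 ∨ ¬ Allowed d L.1 L.2 s.2 ∨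
    work r (target r s.2 (toReal L.1)) * √(work r (target r s.2 (toReal L.1))) <
      ∑ i, (toReal s.1 i - target r s.2 (toReal L.1) i) ^ 2

open scoped Classical in
/-- The update of the last epoch at which a queue was emptied; `none` records that at one of these
epochs the state was not close to its fluid target. -/
noncomputable def updateLast (r : Rates) (d : Fin 3 → ℝ) (m : Option State) (s : State) :
    Option State :=
  m.bind fun L => if s.1 s.2 ≠ 0 then some L else if Bad r d L s then none else some s

open scoped Classical in
/-- An upper bound for the probability of ever leaving the fluid trajectory. -/
noncomputable def lyapunov (S : ServiceLaws r) (d : Fin 3 → ℝ) (A : ℝ) (L s : State) : ℝ :=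
  if Allowed d L.1 L.2 s.2 then
    -- The first summand is Markov's bound for a failure in the current service period; the second
    -- bounds the sum over all later periods.
    min 1 (potential S s.2 (target r s.2 (toReal L.1)) s.1 /
      (work r (target r s.2 (toReal L.1)) * √(work r (target r s.2 (toReal L.1)))) +
      A / √(work r (target r s.2 (toReal L.1))))
  else 1

/-- A failure that has already occurred is recorded by `none` and has value `1`. -/
noncomputable def lyapunovValue (S : ServiceLaws r) (d : Fin 3 → ℝ) (A : ℝ) (m : Option State)
    (s : State) : ℝ≥0∞ :=
  m.elim 1 fun L => ENNReal.ofReal (lyapunov S d A L s)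

theorem lyapunov_le_one (S : ServiceLaws r) (A : ℝ) (L s : State) : lyapunov S d A L s ≤ 1 := by
  unfold lyapunov
  split_ifs
  · exact min_le_left _ _
  · exact le_rfl

theorem lyapunovValue_le_one (S : ServiceLaws r) (A : ℝ) (m : Option State) (s : State) :
    lyapunovValue S d A m s ≤ 1 := by
  cases m with
  | none => exact le_rfl
  | some L => exact ENNReal.ofReal_le_one.2 (lyapunov_le_one S A L s)

theorem target_eq_self {j : Fin 3} {x : Fin 3 → ℕ} (hx : x j = 0) :
    target r j (toReal x) = toReal x := by
  ext i
  unfold target toReal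
  by_cases h : i = j
  · simp [h, hx]
  · simp [h, hx]

theorem potential_of_empty (S : ServiceLaws r) {j : Fin 3} {x : Fin 3 → ℕ} (hx : x j = 0)
    (c : Fin 3 → ℝ) : potential S j c x = ∑ i, (toReal x i - c i) ^ 2 := by
  rw [potential, target_eq_self hx, hx]
  simp

theorem potential_start (S : ServiceLaws r) (j : Fin 3) (x : Fin 3 → ℕ) :
    potential S j (target r j (toReal x)) x = compensator S j * toReal x j := by
  simp [potential, toReal]

/-- This shows that the empty state is not close to a large target. -/
theorem exists_work_sq_le (r : Rates) :
    ∃ C > 0, ∀ c : Fin 3 → ℝ, work r c ^ 2 ≤ C * ∑ i, c i ^ 2 := by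
  refine ⟨∑ i, (1 / (r.mu i : ℝ)) ^ 2, Finset.sum_pos (fun i _ => by
    have := r.mu_pos' i; positivity) ⟨0, Finset.mem_univ _⟩, fun c => ?_⟩
  have := Finset.sum_mul_sq_le_sq_mul_sq Finset.univ (fun i => 1 / (r.mu i : ℝ)) c
  refine le_of_eq_of_le ?_ this
  unfold work
  congr 1
  exact Finset.sum_congr rfl fun i _ => by ring

/-- A start value of the Lyapunov function. -/
theorem exists_lyapunov_start_le (hload : ∀ i, r.rho i < 1) (htr : 1 < ∑ i, r.rho i)
    (S : ServiceLaws r) :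
    ∃ C ≥ 0, ∀ A ≥ 0, ∀ y i j, Allowed d y i j →
      lyapunov S d A (y, i) (y, j) ≤ (C + A) / √(work r (target r j (toReal y))) := by
  have hB := compensator_nonneg hload S
  refine ⟨∑ j, compensator S j * r.mu j, Finset.sum_nonneg fun j _ =>
    mul_nonneg (hB j) (r.mu_pos' j).le, fun A hA y i j h => ?_⟩
  obtain ⟨hw, hw'⟩ := target_work_pos hload htr j h.2.1
  set w := work r (target r j (toReal y)) with hwdef
  have hw0 : 0 < w := hw.trans_le hw'
  have hsq : 0 < √w := Real.sqrt_pos.2 hw0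
  rw [lyapunov, if_pos h]
  refine (min_le_right _ _).trans ?_
  simp only
  rw [← hwdef, potential_start, add_div]
  refine add_le_add ?_ le_rfl
  rw [div_le_div_iff₀ (by positivity) hsq]
  have h1 : toReal y j ≤ r.mu j * w := by
    have h2 : toReal y j / r.mu j ≤ work r (toReal y) :=
      Finset.single_le_sum (f := fun i => toReal y i / r.mu i)
        (fun i _ => div_nonneg (toReal_nonneg y i) (r.mu_pos' i).le) (Finset.mem_univ j)
    rw [div_le_iff₀ (r.mu_pos' j)] at h2
    nlinarith [r.mu_pos' j]
  have h3 : compensator S j * r.mu j ≤ ∑ j, compensator S j * r.mu j :=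
    Finset.single_le_sum (f := fun j => compensator S j * r.mu j)
      (fun j _ => mul_nonneg (hB j) (r.mu_pos' j).le) (Finset.mem_univ j)
  calc compensator S j * toReal y j * √w ≤ compensator S j * (r.mu j * w) * √w := by
        have := hB j; gcongr
    _ = compensator S j * r.mu j * (w * √w) := by ring
    _ ≤ _ := by gcongr

/-- The Lyapunov function is superharmonic. -/
theorem exists_lyapunov_superharmonic (hload : ∀ i, r.rho i < 1) (htr : 1 < ∑ i, r.rho i)
    (hd : ∀ i, d i ∈ Set.Ioo (0 : ℝ) 1) (S : ServiceLaws r) :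
    ∃ A ≥ 0, ∀ (tie : TieRule) (m : Option State) (s : State),
      ∫⁻ s', lyapunovValue S d A (updateLast r d m s) s' ∂kernel S d tie s ≤
        lyapunovValue S d A m s := by
  obtain ⟨C, hC, hstart⟩ := exists_lyapunov_start_le (d := d) hload htr S
  obtain ⟨κ, hκ, w₀, hw₀, hgrow⟩ := exists_work_growth_of_close hload htr hd
  obtain ⟨M, hM, hM'⟩ := exists_work_sq_le r
  have hκ' : 1 < √κ := Real.lt_sqrt_of_sq_lt (by linarith)
  have hpos : 0 ≤ C / (√κ - 1) := div_nonneg hC (by linarith)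
  -- The bound by `M` excludes that the system empties near its target, the bound by `√w₀` makes the
  -- growth estimate applicable, and the last one gives `C + A ≤ √κ * A`, so that growth at a switch
  -- pays for the new service period.
  refine ⟨max (max M √w₀) (C / (√κ - 1)), le_max_of_le_right hpos, fun tie m s => ?_⟩
  set A := max (max M √w₀) (C / (√κ - 1)) with hA
  have hAM : M ≤ A := (le_max_left _ _).trans (le_max_left _ _)
  have hAw : √w₀ ≤ A := (le_max_right _ _).trans (le_max_left _ _)
  have hAC : C + A ≤ √κ * A := by
    have h1 : C / (√κ - 1) ≤ A := le_max_right _ _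
    rw [div_le_iff₀ (by linarith)] at h1
    linarith
  have hA0 : 0 ≤ A := hpos.trans (le_max_right _ _)
  have hone : ∀ m, ∫⁻ s', lyapunovValue S d A m s' ∂kernel S d tie s ≤ 1 := fun m => by
    refine (lintegral_mono fun s' => lyapunovValue_le_one S A m s').trans ?_
    simp
  cases m with
  | none => exact hone _
  | some L =>
    by_cases hall : Allowed d L.1 L.2 s.2
    swap
    · have : lyapunovValue S d A (some L) s = 1 := by
        simp [lyapunovValue, lyapunov, hall]
      rw [this]
      exact hone _
    have hval : lyapunovValue S d A (some L) s = ENNReal.ofReal (min 1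
        (potential S s.2 (target r s.2 (toReal L.1)) s.1 /
        (work r (target r s.2 (toReal L.1)) * √(work r (target r s.2 (toReal L.1)))) +
        A / √(work r (target r s.2 (toReal L.1))))) := by
      simp only [lyapunovValue, Option.elim_some, lyapunov, if_pos hall]
    obtain ⟨hw, hw'⟩ := target_work_pos hload htr s.2 hall.2.1
    set c := target r s.2 (toReal L.1) with hc
    set w := work r c with hwdef
    have hw0 : 0 < w := hw.trans_le hw'
    have hsq : 0 < √w := Real.sqrt_pos.2 hw0
    have hden : 0 < w * √w := mul_pos hw0 hsq
    have hpotnn : 0 ≤ potential S s.2 c s.1 / (w * √w) :=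
      div_nonneg (potential_nonneg hload S _ _ _) hden.le
    rw [hval]
    by_cases hserve : s.1 s.2 ≠ 0
    · have hu : updateLast r d (some L) s = some L := by
        rw [updateLast, Option.bind_some, if_pos hserve]
      rw [ENNReal.ofReal_min, ENNReal.ofReal_one]
      refine le_min (hone _) ?_
      rw [hu, lintegral_kernel_serve S tie hserve]
      obtain ⟨h1, h2⟩ := integral_potential_serve hload S hserve c
      have h3 : Integrable (fun a => potential S s.2 c (s.1 - Pi.single s.2 1 + a) / (w * √w) +
          A / √w) (arrivals S s.2) := (h1.div_const _).add (integrable_const _)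
      have h4 : ∫ a, (potential S s.2 c (s.1 - Pi.single s.2 1 + a) / (w * √w) + A / √w)
          ∂arrivals S s.2 = potential S s.2 c s.1 / (w * √w) + A / √w := by
        rw [integral_add (h1.div_const _) (integrable_const _), integral_div, h2]
        simp
      rw [← h4, ofReal_integral_eq_lintegral_ofReal h3 (Eventually.of_forall fun a =>
        add_nonneg (div_nonneg (potential_nonneg hload S _ _ _) hden.le)
          (div_nonneg hA0 hsq.le))]
      refine lintegral_mono fun a => ENNReal.ofReal_le_ofReal ?_
      simp only [lyapunov, if_pos hall]
      exact min_le_right _ _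
    · rw [not_not] at hserve
      rw [potential_of_empty S hserve] at hpotnn ⊢
      by_cases hbig : 1 ≤ (∑ i, (toReal s.1 i - c i) ^ 2) / (w * √w) + A / √w
      · rw [min_eq_left hbig, ENNReal.ofReal_one]
        exact hone _
      rw [not_le] at hbig
      rw [min_eq_right hbig.le]
      -- A value below `1` forces a large workload and a small deviation, which rules out every way
      -- of being bad.
      have hAw1 : A < √w := by
        have : A / √w < 1 := by linarith
        rwa [div_lt_one hsq] at this
      have hclose : ∑ i, (toReal s.1 i - c i) ^ 2 ≤ w * √w := by
        have h1 : (∑ i, (toReal s.1 i - c i) ^ 2) / (w * √w) < 1 := by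
          have : 0 ≤ A / √w := div_nonneg hA0 hsq.le
          linarith
        rw [div_lt_one hden] at h1
        exact h1.le
      have hs0 : s.1 ≠ 0 := by
        intro h0
        have h1 : ∑ i, c i ^ 2 ≤ w * √w := by simpa [h0, toReal] using hclose
        have h2 := hM' c
        rw [← hwdef] at h2
        have h3 : √w * √w = w := Real.mul_self_sqrt hw0.le
        have h4 : (∑ i, (toReal s.1 i - c i) ^ 2) / (w * √w) = (∑ i, c i ^ 2) / (w * √w) := by
          simp [h0, toReal]
        have h5 : 1 ≤ M * (∑ i, c i ^ 2) / w ^ 2 := by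
          rw [le_div_iff₀ (by positivity)]; linarith
        have h6 : M * ∑ i, c i ^ 2 ≤ M * (w * √w) := by gcongr
        have h7 : w ^ 2 = w * √w * √w := by rw [mul_assoc, h3, sq]
        have h8 : w * √w * √w ≤ w * √w * M := by linarith
        have h9 := le_of_mul_le_mul_left h8 hden
        linarith
      have hbad : ¬ Bad r d L s := by
        rintro (h | h | h)
        · exact hs0 h
        · exact h hall
        · exact absurd h (not_lt.2 hclose)
      have hu : updateLast r d (some L) s = some s := by
        rw [updateLast, Option.bind_some, if_neg (not_not.2 hserve), if_neg hbad]
      rw [hu]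
      refine lintegral_kernel_switch_le S tie hserve hs0 fun j hj => ?_
      refine ENNReal.ofReal_le_ofReal ?_
      refine (hstart A hA0 s.1 s.2 j hj).trans ?_
      have hw₀w : w₀ ≤ w := by
        have := hAw.trans hAw1.le
        exact (Real.sqrt_le_sqrt_iff hw0.le).1 this
      have h1 := hgrow c hw₀w s.1 hclose s.2 j hj
      have h2 : √κ * √w ≤ √(work r (target r j (toReal s.1))) := by
        rw [← Real.sqrt_mul (by linarith)]
        exact Real.sqrt_le_sqrt h1
      refine le_trans ?_ (le_add_of_nonneg_left hpotnn)
      rw [div_le_div_iff₀ (by nlinarith) hsq]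
      calc (C + A) * √w ≤ √κ * A * √w := by gcongr
        _ = A * (√κ * √w) := by ring
        _ ≤ _ := by gcongr

/-! ### The Markov property -/

/-- A functional of a path depends only on the coordinates up to `n`. -/
def DependsUpTo {α : Type*} (n : ℕ) (G : (ℕ → State) → α) : Prop :=
  ∀ ω ω' : ℕ → State, (∀ i ≤ n, ω i = ω' i) → G ω = G ω'

/-- The integrand may remember the whole past, as needed for `lastStop`. Histories up to `n` form a
countable space, so no measurability of `F` is assumed; `ext` fills the later coordinates
arbitrarily. -/
theorem lintegral_chainLaw_succ (S : ServiceLaws r) (tie : TieRule) (s₀ : State) (n : ℕ)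
    {F : (ℕ → State) → State → ℝ≥0∞} (hF : DependsUpTo n F) :
    ∫⁻ ω, F ω (ω (n + 1)) ∂chainLaw S d tie s₀ =
      ∫⁻ ω, ∫⁻ s', F ω s' ∂kernel S d tie (ω n) ∂chainLaw S d tie s₀ := by
  let ext : (Π _ : Finset.Iic n, State) → ℕ → State := fun h i =>
    if hi : i ∈ Finset.Iic n then h ⟨i, hi⟩ else s₀
  have hext : ∀ ω, F (ext (Preorder.frestrictLe n ω)) = F ω := fun ω => hF _ _ fun i hi => by
    simp only [ext, Finset.mem_Iic, hi, dite_true]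
    rfl
  have key := Kernel.map_frestrictLe_trajMeasure_compProd_eq_map_trajMeasure
    (X := fun _ => State) (μ₀ := Measure.dirac s₀) (κ := historyKernel S d tie) (a := n)
  have hm : Measurable fun p : (Π _ : Finset.Iic n, State) × State => F (ext p.1) p.2 :=
    measurable_of_countable _
  have e1 : ∫⁻ ω, F ω (ω (n + 1)) ∂chainLaw S d tie s₀ =
      ∫⁻ p, F (ext p.1) p.2 ∂((chainLaw S d tie s₀).map
        fun ω => (Preorder.frestrictLe n ω, ω (n + 1))) := by
    rw [lintegral_map hm (by fun_prop)]
    simp only [hext]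
  rw [e1]
  unfold chainLaw
  rw [← key, Measure.lintegral_compProd hm, lintegral_map (measurable_of_countable _)
    (by fun_prop)]
  refine lintegral_congr fun ω => ?_
  rw [historyKernel, Kernel.comap_apply]
  simp only [hext]
  rfl

theorem chainLaw_zero (S : ServiceLaws r) (tie : TieRule) (s₀ : State) :
    chainLaw S d tie s₀ {ω | ω 0 = s₀} = 1 := by
  have h : (chainLaw S d tie s₀).map (Preorder.frestrictLe 0) =
      (Measure.dirac s₀).map (MeasurableEquiv.piUnique
        (fun _ : Finset.Iic 0 => State)).symm := by
    unfold chainLaw Kernel.trajMeasure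
    rw [Measure.map_comp _ _ (by fun_prop), Kernel.traj_map_frestrictLe, Kernel.partialTraj_self,
      Measure.id_comp]
  have h2 : chainLaw S d tie s₀ {ω | ω 0 = s₀} = (chainLaw S d tie s₀).map
      (Preorder.frestrictLe 0) {x | x ⟨0, Finset.mem_Iic.2 le_rfl⟩ = s₀} := by
    rw [Measure.map_apply (by fun_prop) MeasurableSet.of_discrete]
    rfl
  rw [h2, h]
  refine (Measure.map_apply (MeasurableEquiv.measurable _) MeasurableSet.of_discrete).trans ?_
  refine (Measure.dirac_apply' _ MeasurableSet.of_discrete).trans ?_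
  exact Set.indicator_of_mem (by rfl) _

theorem measurableSet_of_dependsUpTo {n : ℕ} {B : (ℕ → State) → Prop} (hB : DependsUpTo n B) :
    MeasurableSet {ω | B ω} := by
  let ext : (Π _ : Finset.Iic n, State) → ℕ → State := fun h i =>
    if hi : i ∈ Finset.Iic n then h ⟨i, hi⟩ else (0, 0)
  have : {ω | B ω} = Preorder.frestrictLe n ⁻¹' {h | B (ext h)} := by
    ext ω
    simp only [Set.mem_ofPred_eq, Set.mem_preimage]
    rw [hB ω (ext (Preorder.frestrictLe n ω)) fun i hi => by
      simp only [ext, Finset.mem_Iic, hi, dite_true]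
      rfl]
  rw [this]
  exact (by fun_prop : Measurable (Preorder.frestrictLe (π := fun _ : ℕ => State) n))
    MeasurableSet.of_discrete

theorem measurable_of_dependsUpTo {n : ℕ} {F : (ℕ → State) → ℝ≥0∞} (hF : DependsUpTo n F) :
    Measurable F := by
  intro B hB
  exact measurableSet_of_dependsUpTo (n := n) (B := fun ω => F ω ∈ B) fun ω ω' h => by
    simp only [hF ω ω' h]

theorem measurableSet_eval_eq (n : ℕ) (s : State) : MeasurableSet {ω : ℕ → State | ω n = s} :=
  measurableSet_of_dependsUpTo (n := n) fun ω ω' h => by simp only [h n le_rfl]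

/-! ### Reachability -/

theorem chainLaw_succ_ne_zero (S : ServiceLaws r) (tie : TieRule) (s₀ : State) {n : ℕ}
    {s s' : State} (h : chainLaw S d tie s₀ {ω | ω n = s} ≠ 0) (hs : kernel S d tie s {s'} ≠ 0) :
    chainLaw S d tie s₀ {ω | ω (n + 1) = s'} ≠ 0 := by
  classical
  have h1 := lintegral_chainLaw_succ (d := d) S tie s₀ n
    (F := fun ω x => if ω n = s then ({s'} : Set State).indicator 1 x else 0)
    (fun ω ω' hω => by simp only [hω n le_rfl])
  have hmeas := measurableSet_eval_eq
  have h2 : ∫⁻ ω, ∫⁻ x, (if ω n = s then ({s'} : Set State).indicator 1 x else 0)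
      ∂kernel S d tie (ω n) ∂chainLaw S d tie s₀ =
      kernel S d tie s {s'} * chainLaw S d tie s₀ {ω | ω n = s} := by
    rw [← lintegral_indicator_const (hmeas n s)]
    refine lintegral_congr fun ω => ?_
    by_cases hω : ω n = s
    · simp [Set.indicator, hω, ← lintegral_indicator_one (MeasurableSet.singleton s')]
    · simp [hω]
  intro h0
  rw [h2] at h1
  have h3 : ∫⁻ ω, (if ω n = s then ({s'} : Set State).indicator 1 (ω (n + 1)) else 0)
      ∂chainLaw S d tie s₀ ≤ chainLaw S d tie s₀ {ω | ω (n + 1) = s'} := by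
    rw [← lintegral_indicator_one (hmeas (n + 1) s')]
    refine lintegral_mono fun ω => ?_
    by_cases h4 : ω n = s <;> by_cases h5 : ω (n + 1) = s' <;> simp [h4, h5, Set.indicator]
  rw [h1, h0, nonpos_iff_eq_zero, mul_eq_zero] at h3
  exact h3.elim hs h

/-- The state `s'` can be reached from `s`. -/
def Reach (S : ServiceLaws r) (d : Fin 3 → ℝ) (tie : TieRule) : State → State → Prop :=
  Relation.ReflTransGen fun s s' => kernel S d tie s {s'} ≠ 0

theorem Reach.exists_chainLaw_ne_zero {S : ServiceLaws r} {tie : TieRule} {s₀ s : State}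
    (h : Reach S d tie s₀ s) : ∃ n, chainLaw S d tie s₀ {ω | ω n = s} ≠ 0 := by
  induction h with
  | refl => exact ⟨0, by rw [chainLaw_zero]; exact one_ne_zero⟩
  | tail _ h ih =>
    obtain ⟨n, hn⟩ := ih
    exact ⟨n + 1, chainLaw_succ_ne_zero S tie s₀ hn h⟩

theorem kernel_serve_ne_zero (S : ServiceLaws r) (tie : TieRule) {s : State} (hs : s.1 s.2 ≠ 0)
    (a : Fin 3 → ℕ) : kernel S d tie s {(s.1 - Pi.single s.2 1 + a, s.2)} ≠ 0 := by
  change transition S d tie s _ ≠ 0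
  rw [transition, if_pos hs, Measure.map_apply (measurable_of_countable _)
    (MeasurableSet.singleton _)]
  intro h
  refine arrivals_singleton_ne_zero S s.2 a (measure_mono_null ?_ h)
  rintro _ rfl
  rfl

/-- The chosen node holds a positive share of the jobs, so a switch is followed by an actual
service. -/
theorem exists_kernel_switch_ne_zero (hd : ∀ i, d i ∈ Set.Ioo (0 : ℝ) 1) (S : ServiceLaws r)
    (tie : TieRule) {s : State} (hs : s.1 s.2 = 0) (hs' : s.1 ≠ 0) :
    ∃ j, s.1 j ≠ 0 ∧ kernel S d tie s {(s.1, j)} ≠ 0 := by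
  obtain ⟨γ, hγ, hγ'⟩ := exists_share_lower_bound hd
  by_contra! hcon
  have h := lintegral_kernel_switch_le (d := d) S tie hs hs'
    (f := fun s' => if s'.1 s'.2 ≠ 0 ∧ s'.1 = s.1 then 0 else 1) (b := 0)
  have h1 : ∫⁻ s', (if s'.1 s'.2 ≠ 0 ∧ s'.1 = s.1 then (0 : ℝ≥0∞) else 1) ∂kernel S d tie s ≤ 0 := by
    refine h fun j hj => ?_
    have h2 := hγ' _ _ _ hj
    have h3 : 0 < toReal s.1 j := lt_of_lt_of_le (mul_pos hγ (sum_toReal_pos hs')) h2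
    have h4 : s.1 j ≠ 0 := fun h0 => by simp [toReal, h0] at h3
    simp [h4]
  rw [nonpos_iff_eq_zero, lintegral_eq_zero_iff (measurable_of_countable _)] at h1
  have h5 : ∀ᵐ s' ∂kernel S d tie s, s'.1 s'.2 ≠ 0 ∧ s'.1 = s.1 := by
    filter_upwards [h1] with s' hs
    by_contra hn
    simp [hn] at hs
  have h6 : ∀ᵐ s' ∂kernel S d tie s, ∀ j, s.1 j ≠ 0 → s' ≠ (s.1, j) := by
    rw [ae_all_iff]
    intro j
    by_cases hj : s.1 j = 0
    · simp [hj]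
    · have := hcon j hj
      filter_upwards [compl_mem_ae_iff.2 this] with s' hs' _
      exact hs'
  have h7 : ∀ᵐ s' ∂kernel S d tie s, False := by
    filter_upwards [h5, h6] with s' a b
    refine b s'.2 ?_ (Prod.ext a.2 rfl)
    rw [← a.2]; exact a.1
  rw [ae_iff] at h7
  simp at h7

/-- Services without any arrival have positive probability and each removes one job. A switch
removes none, so the induction step combines it with the service after it. -/
theorem exists_reach_empty (hd : ∀ i, d i ∈ Set.Ioo (0 : ℝ) 1) (S : ServiceLaws r)
    (tie : TieRule) (s : State) : ∃ j, Reach S d tie s (0, j) := by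
  induction h : ∑ i, s.1 i using Nat.strong_induction_on generalizing s with
  | _ n ih =>
    have serve : ∀ s : State, ∑ i, s.1 i = n → s.1 s.2 ≠ 0 → ∃ j, Reach S d tie s (0, j) := by
      intro s h hs
      have h1 := kernel_serve_ne_zero (d := d) S tie hs 0
      rw [add_zero] at h1
      have h2 : ∑ i, (s.1 - Pi.single s.2 1 : Fin 3 → ℕ) i < n := by
        rw [← h]
        refine Finset.sum_lt_sum (fun i _ => Nat.sub_le _ _) ⟨s.2, Finset.mem_univ _, ?_⟩
        simp only [Pi.sub_apply, Pi.single_eq_same]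
        omega
      obtain ⟨j, hj⟩ := ih _ h2 (s.1 - Pi.single s.2 1, s.2) rfl
      exact ⟨j, Relation.ReflTransGen.head h1 hj⟩
    by_cases hs : s.1 s.2 = 0
    · by_cases hs' : s.1 = 0
      · exact ⟨s.2, by rw [← hs']; exact Relation.ReflTransGen.refl⟩
      · obtain ⟨j, hj, hk⟩ := exists_kernel_switch_ne_zero hd S tie hs hs'
        obtain ⟨k, hk'⟩ := serve (s.1, j) h hj
        exact ⟨k, Relation.ReflTransGen.head hk hk'⟩
    · exact serve s h hs

theorem kernel_empty_ne_zero (S : ServiceLaws r) (tie : TieRule) (j i : Fin 3) :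
    kernel S d tie (0, j) {(Pi.single i 1, i)} ≠ 0 := by
  change transition S d tie _ _ ≠ 0
  rw [transition]
  simp only [Pi.zero_apply, ne_eq, not_true_eq_false, if_false]
  rw [Measure.coe_finsetSum, Finset.sum_apply]
  intro h
  rw [Finset.sum_eq_zero_iff] at h
  have h1 := h i (Finset.mem_univ i)
  rw [Measure.smul_apply, smul_eq_mul, mul_eq_zero] at h1
  rcases h1 with h1 | h1
  · rw [ENNReal.div_eq_zero_iff] at h1
    rcases h1 with h1 | h1
    · exact (r.lam_pos i).ne' (by exact_mod_cast h1)
    · simp at h1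
  · simp at h1

/-- Every state at which a queue has just been emptied can be reached. -/
theorem exists_chainLaw_ne_zero (hd : ∀ i, d i ∈ Set.Ioo (0 : ℝ) 1) (S : ServiceLaws r)
    (tie : TieRule) (s₀ : State) (s : State) :
    ∃ n, chainLaw S d tie s₀ {ω | ω n = s} ≠ 0 := by
  -- From the empty system, one arrival at `s.2` followed by a service during which exactly `s.1`
  -- arrives leads to `s`.
  obtain ⟨j, hj⟩ := exists_reach_empty hd S tie s₀
  refine Reach.exists_chainLaw_ne_zero (Relation.ReflTransGen.tail (Relation.ReflTransGen.tail hj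
    (kernel_empty_ne_zero S tie j s.2)) ?_)
  have := kernel_serve_ne_zero (d := d) S tie (s := (Pi.single s.2 1, s.2)) (by simp) s.1
  simpa using this

/-! ### Busy periods are finite -/

/-- Foster's argument: `V` drops by exactly `1` in mean at each service. The event `E` that the
queue at the server never empties after time `t` therefore satisfies `k * P E ≤ V s` for all `k`,
which forces `P E = 0`. -/
theorem ae_exists_isEmpty (hload : ∀ i, r.rho i < 1) (S : ServiceLaws r) (tie : TieRule)
    (s₀ : State) :
    ∀ᵐ ω ∂chainLaw S d tie s₀, ∀ t, ∃ t', t ≤ t' ∧ (ω t').1 (ω t').2 = 0 := by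
  classical
  set P := chainLaw S d tie s₀ with hP
  let V : State → ℝ≥0∞ := fun s => ENNReal.ofReal ((s.1 s.2 : ℝ) / (1 - r.rho s.2))
  have hV : ∀ s : State, s.1 s.2 ≠ 0 → ∫⁻ s', V s' ∂kernel S d tie s + 1 = V s := by
    intro s hs
    have h0 : 0 < 1 - r.rho s.2 := by linarith [hload s.2]
    obtain ⟨h1, h2⟩ := integral_queue_serve S hs
    rw [lintegral_kernel_serve S tie hs]
    change ∫⁻ a, ENNReal.ofReal ((((s.1 - Pi.single s.2 1 + a : Fin 3 → ℕ) s.2 : ℕ) : ℝ) /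
      (1 - r.rho s.2)) ∂arrivals S s.2 + 1 = ENNReal.ofReal _
    rw [← ofReal_integral_eq_lintegral_ofReal (h1.div_const _)
      (Eventually.of_forall fun a => by positivity), integral_div, h2, ← ENNReal.ofReal_one,
      ← ENNReal.ofReal_add ?_ zero_le_one]
    · congr 1
      field_simp
      ring
    · rw [← h2]
      exact div_nonneg (integral_nonneg fun a => Nat.cast_nonneg _) h0.le
  have key : ∀ (t : ℕ) (s : State),
      P {ω | ω t = s ∧ ∀ i, (ω (t + i)).1 (ω (t + i)).2 ≠ 0} = 0 := by
    intro t s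
    let N : ℕ → (ℕ → State) → Prop := fun k ω =>
      ω t = s ∧ ∀ i < k, (ω (t + i)).1 (ω (t + i)).2 ≠ 0
    let Ψ : ℕ → ℝ≥0∞ := fun k => ∫⁻ ω, (if N k ω then V (ω (t + k)) else 0) ∂P
    set E := {ω : ℕ → State | ω t = s ∧ ∀ i, (ω (t + i)).1 (ω (t + i)).2 ≠ 0} with hE
    have hstep : ∀ k, Ψ (k + 1) + P E ≤ Ψ k := by
      intro k
      have hN : DependsUpTo (t + k) (N (k + 1)) := by
        intro ω ω' h
        simp only [N, eq_iff_iff]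
        rw [h t (by omega)]
        refine and_congr Iff.rfl (forall₂_congr fun i hi => ?_)
        rw [h (t + i) (by omega)]
      have h1 := lintegral_chainLaw_succ (d := d) S tie s₀ (t + k)
        (F := fun ω x => if N (k + 1) ω then V x else 0)
        (fun ω ω' h => by simp only [hN ω ω' h])
      have h2 : P E ≤ ∫⁻ ω, (if N (k + 1) ω then 1 else 0) ∂P := by
        have h3 : MeasurableSet {ω | N (k + 1) ω} := measurableSet_of_dependsUpTo hN
        have h4 : ∫⁻ ω, (if N (k + 1) ω then (1 : ℝ≥0∞) else 0) ∂P = P {ω | N (k + 1) ω} := by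
          rw [← lintegral_indicator_one h3]
          refine lintegral_congr fun ω => ?_
          by_cases h : N (k + 1) ω <;> simp [Set.indicator, h]
        rw [h4]
        exact measure_mono fun ω hω => ⟨hω.1, fun i _ => hω.2 i⟩
      have h5 : Ψ (k + 1) = ∫⁻ ω, ∫⁻ x, (if N (k + 1) ω then V x else 0)
          ∂kernel S d tie (ω (t + k)) ∂P := h1
      rw [h5]
      have hm : Measurable fun ω : ℕ → State => if N (k + 1) ω then (1 : ℝ≥0∞) else 0 :=
        measurable_of_dependsUpTo (n := t + k) fun ω ω' h => by simp only [hN ω ω' h]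
      refine (add_le_add le_rfl h2).trans ?_
      rw [← lintegral_add_right _ hm]
      refine lintegral_mono fun ω => ?_
      by_cases h6 : N (k + 1) ω
      · have h7 : N k ω := ⟨h6.1, fun i hi => h6.2 i (by omega)⟩
        simp only [h6, h7, if_true]
        exact (hV _ (h6.2 k (by omega))).le
      · simp [h6]
    have hsum : ∀ k : ℕ, Ψ k + k * P E ≤ Ψ 0 := by
      intro k
      induction k with
      | zero => simp
      | succ k ih =>
        calc Ψ (k + 1) + (k + 1 : ℕ) * P E = (Ψ (k + 1) + P E) + k * P E := by push_cast; ring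
          _ ≤ Ψ k + k * P E := by gcongr; exact hstep k
          _ ≤ _ := ih
    have hΨ0 : Ψ 0 ≤ V s := by
      calc Ψ 0 ≤ ∫⁻ _, V s ∂P := by
            refine lintegral_mono fun ω => ?_
            by_cases h : N 0 ω
            · simp only [h, if_true, add_zero, h.1, le_refl]
            · simp [h]
        _ = V s := by simp [hP]
    by_contra hne
    have hbound : ∀ k : ℕ, (k : ℝ≥0∞) * P E ≤ V s := fun k =>
      le_add_self.trans ((hsum k).trans hΨ0)
    have hVfin : V s ≠ ∞ := ENNReal.ofReal_ne_top
    obtain ⟨k, hk⟩ := ENNReal.exists_nat_mul_gt hne hVfin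
    exact absurd (hbound k) (not_le.2 hk)
  rw [ae_all_iff]
  intro t
  have h1 : ∀ s : State, ∀ᵐ ω ∂P, ¬ (ω t = s ∧ ∀ i, (ω (t + i)).1 (ω (t + i)).2 ≠ 0) := fun s => by
    rw [ae_iff]
    simpa using key t s
  filter_upwards [ae_all_iff.2 h1] with ω hω
  have h2 := hω (ω t)
  simp only [true_and, not_forall, not_not] at h2
  obtain ⟨i, hi⟩ := h2
  exact ⟨t + i, by omega, hi⟩

/-! ### Following the fluid model forever -/

/-- The last epoch at which a queue was emptied, starting with the epoch `t₀`. -/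
noncomputable def lastStop (r : Rates) (d : Fin 3 → ℝ) (t₀ : ℕ) (ω : ℕ → State) : ℕ → Option State
  | 0 => some (ω t₀)
  -- Index `k` stands for time `t₀ + k`: the value at `k` has seen the path up to and including that
  -- time.
  | k + 1 => updateLast r d (lastStop r d t₀ ω k) (ω (t₀ + 1 + k))

theorem dependsUpTo_lastStop (t₀ k : ℕ) :
    DependsUpTo (t₀ + k) fun ω => lastStop r d t₀ ω k := by
  induction k with
  | zero => intro ω ω' h; simp only [lastStop, h t₀ (by omega)]
  | succ k ih =>
    intro ω ω' h
    simp only [lastStop]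
    have := ih ω ω' fun i hi => h i (by omega)
    simp only at this
    rw [this, h (t₀ + 1 + k) (by omega)]

/-- With positive probability the chain follows its fluid model forever. -/
theorem exists_follow (hload : ∀ i, r.rho i < 1) (htr : 1 < ∑ i, r.rho i)
    (hd : ∀ i, d i ∈ Set.Ioo (0 : ℝ) 1) (S : ServiceLaws r) :
    ∃ w₁ : ℝ, ∀ (tie : TieRule) (s₀ s : State), s.1 s.2 = 0 → s.1 ≠ 0 →
      w₁ ≤ work r (toReal s.1) → ∃ t₀, 0 < chainLaw S d tie s₀ {ω | ω t₀ = s ∧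
        (∀ k, lastStop r d t₀ ω k ≠ none) ∧ ∀ t, ∃ t', t ≤ t' ∧ (ω t').1 (ω t').2 = 0} := by
  classical
  obtain ⟨A, hA, hsup⟩ := exists_lyapunov_superharmonic hload htr hd S
  obtain ⟨C, hC, hstart⟩ := exists_lyapunov_start_le (d := d) hload htr S
  -- From this workload on, the Lyapunov function starts at or below `1 / 2`.
  refine ⟨(2 * (C + A)) ^ 2, fun tie s₀ s hs hs' hw => ?_⟩
  obtain ⟨t₀, ht₀⟩ := exists_chainLaw_ne_zero hd S tie s₀ s
  refine ⟨t₀, ?_⟩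
  set P := chainLaw S d tie s₀ with hP
  -- The record is taken just before its update by the present state, hence the shift of time by
  -- one.
  let Φ : ℕ → ℝ≥0∞ := fun k => ∫⁻ ω, (if ω t₀ = s then
    lyapunovValue S d A (lastStop r d t₀ ω k) (ω (t₀ + k + 1)) else 0) ∂P
  have hmeas := measurableSet_eval_eq t₀ s
  have hstep : ∀ k, Φ (k + 1) ≤ Φ k := by
    intro k
    have h1 := lintegral_chainLaw_succ (d := d) S tie s₀ (t₀ + (k + 1))
      (F := fun ω x => if ω t₀ = s then lyapunovValue S d A (lastStop r d t₀ ω (k + 1)) x else 0)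
      (fun ω ω' h => by
        have := dependsUpTo_lastStop (r := r) (d := d) t₀ (k + 1) ω ω' h
        simp only at this
        simp only [this, h t₀ (by omega)])
    refine (le_of_eq h1).trans (lintegral_mono fun ω => ?_)
    by_cases h2 : ω t₀ = s
    · simp only [h2, if_true]
      have := hsup tie (lastStop r d t₀ ω k) (ω (t₀ + k + 1))
      have e : lastStop r d t₀ ω (k + 1) =
          updateLast r d (lastStop r d t₀ ω k) (ω (t₀ + k + 1)) := by
        rw [lastStop, add_right_comm]
      rw [e]
      exact this
    · simp [h2]
  have hΦ : ∀ k, Φ k ≤ Φ 0 := fun k => by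
    induction k with
    | zero => exact le_rfl
    | succ k ih => exact (hstep k).trans ih
  have hΦ0 : Φ 0 ≤ ENNReal.ofReal (1 / 2) * P {ω | ω t₀ = s} := by
    have h1 := lintegral_chainLaw_succ (d := d) S tie s₀ t₀
      (F := fun ω x => if ω t₀ = s then lyapunovValue S d A (some (ω t₀)) x else 0)
      (fun ω ω' h => by simp only [h t₀ le_rfl])
    refine (le_of_eq h1).trans ?_
    rw [← lintegral_indicator_const hmeas]
    refine lintegral_mono fun ω => ?_
    by_cases h2 : ω t₀ = s
    · simp only [h2, if_true, Set.indicator, Set.mem_ofPred_eq]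
      refine lintegral_kernel_switch_le S tie hs hs' fun j hj => ENNReal.ofReal_le_ofReal ?_
      refine (hstart A hA s.1 s.2 j hj).trans ?_
      obtain ⟨hw0, hw'⟩ := target_work_pos hload htr j hs'
      rw [div_le_div_iff₀ (Real.sqrt_pos.2 (hw0.trans_le hw')) two_pos]
      have := Real.le_sqrt_of_sq_le (hw.trans hw')
      linarith
    · simp [h2]
  -- After a failure the integrand equals `1`, so the supermartingale bounds the failure probability
  -- uniformly in `k`.
  have hdead : ∀ k, P {ω | ω t₀ = s ∧ lastStop r d t₀ ω k = none} ≤ Φ 0 := by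
    intro k
    refine le_trans ?_ (hΦ k)
    have hm : MeasurableSet {ω | ω t₀ = s ∧ lastStop r d t₀ ω k = none} :=
      measurableSet_of_dependsUpTo (n := t₀ + k) fun ω ω' h => by
        have := dependsUpTo_lastStop (r := r) (d := d) t₀ k ω ω' h
        simp only at this
        rw [this, h t₀ (by omega)]
    rw [← lintegral_indicator_one hm]
    refine lintegral_mono fun ω => ?_
    by_cases h : ω t₀ = s ∧ lastStop r d t₀ ω k = none
    · simp [Set.indicator, h, lyapunovValue]
    · have : ω ∉ {ω | ω t₀ = s ∧ lastStop r d t₀ ω k = none} := h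
      rw [Set.indicator_of_notMem this]
      exact zero_le
  have hdead' : P (⋃ k, {ω | ω t₀ = s ∧ lastStop r d t₀ ω k = none}) ≤ Φ 0 := by
    have hmono : Monotone fun k => {ω | ω t₀ = s ∧ lastStop r d t₀ ω k = none} := by
      refine monotone_nat_of_le_succ fun k ω hω => ⟨hω.1, ?_⟩
      rw [lastStop, hω.2, updateLast, Option.bind_none]
    rw [hmono.measure_iUnion]
    exact iSup_le hdead
  have hpos : 0 < P {ω | ω t₀ = s} := pos_iff_ne_zero.2 ht₀
  have hlt : Φ 0 < P {ω | ω t₀ = s} := by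
    refine hΦ0.trans_lt ?_
    calc ENNReal.ofReal (1 / 2) * P {ω | ω t₀ = s} < 1 * P {ω | ω t₀ = s} := by
          refine ENNReal.mul_lt_mul_left hpos.ne' (measure_ne_top _ _) ?_
          rw [← ENNReal.ofReal_one, ENNReal.ofReal_lt_ofReal_iff one_pos]
          norm_num
      _ = _ := one_mul _
  by_contra hcon
  rw [not_lt, nonpos_iff_eq_zero] at hcon
  have hempty := ae_exists_isEmpty (d := d) hload S tie s₀
  have hsub : P {ω | ω t₀ = s} ≤ P (⋃ k, {ω | ω t₀ = s ∧ lastStop r d t₀ ω k = none}) := by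
    refine measure_mono_ae ?_
    have h0 : ∀ᵐ ω ∂P, ¬ (ω t₀ = s ∧ (∀ k, lastStop r d t₀ ω k ≠ none) ∧
        ∀ t, ∃ t', t ≤ t' ∧ (ω t').1 (ω t').2 = 0) := by
      rw [ae_iff]; simpa using hcon
    filter_upwards [h0, hempty] with ω h1 h2 h3
    have h3' : ω t₀ = s := h3
    by_contra h4
    refine h1 ⟨h3', fun k hk => h4 ?_, h2⟩
    exact Set.mem_iUnion.2 ⟨k, h3', hk⟩
  exact absurd (hsub.trans hdead') (not_le.2 hlt)

/-! ### Ratio coordinates -/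

/-- The normalized ratio of the two queues that are not empty on side `i`. -/
noncomputable def ratio (r : Rates) (i : Fin 3) (y : Fin 3 → ℝ) : ℝ :=
  (y (i + 2) / r.lam (i + 2)) / (y (i + 1) / r.lam (i + 1))

/-- The contraction coefficient of the service at node `j` in ratio coordinates. -/
noncomputable def Rates.beta (r : Rates) (j : Fin 3) : ℝ := (r.mu j - r.lam j) / r.lam j

/-- The point on side `i` with normalized ratio `R`. -/
noncomputable def sidePoint (r : Rates) (i : Fin 3) (R : ℝ) : Fin 3 → ℝ := fun k =>
  if k = i then 0
  else if k = i + 1 then r.lam (i + 1) / (r.lam (i + 1) + r.lam (i + 2) * R)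
  else r.lam (i + 2) * R / (r.lam (i + 1) + r.lam (i + 2) * R)

/-- Decision points with prescribed normalized ratios. -/
noncomputable def decisionPoints (r : Rates) (T : Fin 3 → ℝ) : Fin 3 → ℝ := fun i =>
  r.lam (i + 2) * T i / (r.lam (i + 1) + r.lam (i + 2) * T i)

theorem Rates.beta_pos (hload : ∀ i, r.rho i < 1) (j : Fin 3) : 0 < r.beta j :=
  div_pos (sub_pos.2 (Rates.lam_lt_mu hload j)) (r.lam_pos' j)

theorem fin_add_one_ne (i : Fin 3) : i + 1 ≠ i := by revert i; decide

theorem fin_add_two_ne (i : Fin 3) : i + 2 ≠ i := by revert i; decide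

theorem fin_add_two_ne_add_one (i : Fin 3) : i + 2 ≠ i + 1 := by revert i; decide

theorem fin_one_two (i : Fin 3) : i + 1 + 2 = i := by revert i; decide

theorem fin_one_one (i : Fin 3) : i + 1 + 1 = i + 2 := by revert i; decide

theorem fin_two_two (i : Fin 3) : i + 2 + 2 = i + 1 := by revert i; decide

theorem fin_two_one (i : Fin 3) : i + 2 + 1 = i := by revert i; decide

theorem fin_cases_cyclic (i k : Fin 3) : k = i ∨ k = i + 1 ∨ k = i + 2 := by
  revert i k; decide

theorem sidePoint_self (r : Rates) (i : Fin 3) (R : ℝ) : sidePoint r i R i = 0 := by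
  simp [sidePoint]

theorem sidePoint_one (r : Rates) (i : Fin 3) (R : ℝ) :
    sidePoint r i R (i + 1) = r.lam (i + 1) / (r.lam (i + 1) + r.lam (i + 2) * R) := by
  simp [sidePoint]

theorem sidePoint_two (r : Rates) (i : Fin 3) (R : ℝ) :
    sidePoint r i R (i + 2) = r.lam (i + 2) * R / (r.lam (i + 1) + r.lam (i + 2) * R) := by
  simp [sidePoint]

theorem ratio_pos {i : Fin 3} {y : Fin 3 → ℝ} (h1 : 0 < y (i + 1)) (h2 : 0 < y (i + 2)) :
    0 < ratio r i y :=
  div_pos (div_pos h2 (r.lam_pos' _)) (div_pos h1 (r.lam_pos' _))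

theorem proj_eq_sidePoint {i : Fin 3} {y : Fin 3 → ℝ} (h0 : y i = 0) (h1 : 0 < y (i + 1))
    (h2 : 0 < y (i + 2)) : proj y = sidePoint r i (ratio r i y) := by
  have l1 := r.lam_pos' (i + 1)
  have l2 := r.lam_pos' (i + 2)
  have hs : ∑ k, y k = y (i + 1) + y (i + 2) := by rw [sum_cyclic y i, h0]; ring
  ext k
  rcases fin_cases_cyclic i k with rfl | rfl | rfl
  · rw [sidePoint_self, proj, h0, zero_div]
  · rw [sidePoint_one, proj, hs, ratio]
    field_simp
  · rw [sidePoint_two, proj, hs, ratio]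
    field_simp

theorem sidePoint_two_strictMono (r : Rates) (i : Fin 3) {R R' : ℝ} (hR : 0 < R) (hR' : 0 < R') :
    sidePoint r i R (i + 2) ≤ sidePoint r i R' (i + 2) ↔ R ≤ R' := by
  have l1 := r.lam_pos' (i + 1)
  have l2 := r.lam_pos' (i + 2)
  rw [sidePoint_two, sidePoint_two, div_le_div_iff₀ (by positivity) (by positivity)]
  constructor
  · intro h
    have h1 : (r.lam (i + 1) * r.lam (i + 2) : ℝ) * R ≤ r.lam (i + 1) * r.lam (i + 2) * R' := by
      linarith
    exact le_of_mul_le_mul_left h1 (by positivity)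
  · intro h
    have h1 : (r.lam (i + 1) * r.lam (i + 2) : ℝ) * R ≤ r.lam (i + 1) * r.lam (i + 2) * R' := by
      gcongr
    linarith

theorem decisionPoints_eq (r : Rates) (T : Fin 3 → ℝ) (i : Fin 3) :
    decisionPoints r T i = sidePoint r i (T i) (i + 2) := by
  rw [sidePoint_two, decisionPoints]

theorem decisionPoints_mem (r : Rates) {T : Fin 3 → ℝ} (hT : ∀ i, 0 < T i) (i : Fin 3) :
    decisionPoints r T i ∈ Set.Ioo (0 : ℝ) 1 := by
  have l1 := r.lam_pos' (i + 1)
  have l2 := r.lam_pos' (i + 2)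
  have := hT i
  unfold decisionPoints
  constructor
  · positivity
  · rw [div_lt_one (by positivity)]
    linarith

/-- If the service period lasts `t`, the normalized queues at `i` and `i + 2` become `t` and `y (i +
2) / λ + t`, and `t` is the normalized queue `i + 1` divided by `beta (i + 1)`. -/
theorem ratio_target_up (hload : ∀ i, r.rho i < 1) {i : Fin 3} {y : Fin 3 → ℝ} (h0 : y i = 0)
    (h1 : 0 < y (i + 1)) (h2 : 0 < y (i + 2)) :
    ratio r (i + 1) (target r (i + 1) y) = ratioUp (r.beta (i + 1)) (ratio r i y) := by
  have l0 := r.lam_pos' i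
  have l1 := r.lam_pos' (i + 1)
  have l2 := r.lam_pos' (i + 2)
  have hm := sub_pos.2 (Rates.lam_lt_mu hload (i + 1))
  unfold ratio ratioUp target Rates.beta
  simp only [fin_one_two, fin_one_one, (fin_add_one_ne i).symm, fin_add_two_ne_add_one, if_false, h0]
  set m : ℝ := r.mu (i + 1) - r.lam (i + 1)
  field_simp
  ring

theorem ratio_target_down (hload : ∀ i, r.rho i < 1) {i : Fin 3} {y : Fin 3 → ℝ} (h0 : y i = 0)
    (h2 : 0 < y (i + 2)) :
    ratio r (i + 2) (target r (i + 2) y) = ratioDown (r.beta (i + 2)) (ratio r i y) := by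
  have l0 := r.lam_pos' i
  have l1 := r.lam_pos' (i + 1)
  have l2 := r.lam_pos' (i + 2)
  have hm := sub_pos.2 (Rates.lam_lt_mu hload (i + 2))
  unfold ratio ratioDown target Rates.beta
  simp only [fin_two_two, fin_two_one, (fin_add_two_ne i).symm, (fin_add_two_ne_add_one i).symm,
    if_false, h0]
  set m : ℝ := r.mu (i + 2) - r.lam (i + 2)
  field_simp
  ring

/-- Relative perturbation of the ratio. -/
theorem abs_ratio_sub_one_le {a b x y η : ℝ} (ha : 0 < a) (hb : 0 < b) (hη : η ≤ 1 / 2)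
    (hx : |x - a| ≤ η * a) (hy : |y - b| ≤ η * b) :
    0 < x ∧ 0 < y ∧ |(x / y) / (a / b) - 1| ≤ 4 * η := by
  obtain ⟨x1, x2⟩ := abs_le.1 hx
  obtain ⟨y1, y2⟩ := abs_le.1 hy
  have hx0 : 0 < x := by nlinarith
  have hyb : b / 2 ≤ y := by nlinarith
  have hy0 : 0 < y := by linarith
  refine ⟨hx0, hy0, ?_⟩
  have e : (x / y) / (a / b) - 1 = ((x - a) * b - a * (y - b)) / (a * y) := by
    field_simp; ring
  rw [e, abs_div, abs_of_pos (mul_pos ha hy0), div_le_iff₀ (mul_pos ha hy0)]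
  have h1 : |(x - a) * b - a * (y - b)| ≤ η * a * b + a * (η * b) := by
    refine (abs_sub _ _).trans ?_
    rw [abs_mul, abs_mul, abs_of_pos ha, abs_of_pos hb]
    gcongr
  have hη0 : 0 ≤ η := by
    have := (abs_nonneg _).trans hx
    by_contra hh
    nlinarith
  nlinarith [mul_nonneg hη0 ha.le, mul_le_mul_of_nonneg_left hyb (mul_nonneg hη0 ha.le)]

/-! ### From paths of the chain to noisy orbits -/

theorem lastStop_eq_of_forall_ne {t₀ u : ℕ} {ω : ℕ → State}
    (hu : lastStop r d t₀ ω u = some (ω (t₀ + u))) (j : ℕ)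
    (hj : ∀ v, u < v → v ≤ u + j → (ω (t₀ + v)).1 (ω (t₀ + v)).2 ≠ 0) :
    lastStop r d t₀ ω (u + j) = some (ω (t₀ + u)) := by
  induction j with
  | zero => exact hu
  | succ j ih =>
    rw [← add_assoc, lastStop, ih fun v h1 h2 => hj v h1 (by omega), updateLast, Option.bind_some,
      if_pos]
    have := hj (u + j + 1) (by omega) (by omega)
    rwa [show t₀ + 1 + (u + j) = t₀ + (u + j + 1) by omega]

theorem lastStop_of_isEmpty {t₀ : ℕ} {ω : ℕ → State} (hal : ∀ k, lastStop r d t₀ ω k ≠ none) {k : ℕ}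
    (hk : (ω (t₀ + 1 + k)).1 (ω (t₀ + 1 + k)).2 = 0) :
    lastStop r d t₀ ω (k + 1) = some (ω (t₀ + 1 + k)) ∧
      ∀ L, lastStop r d t₀ ω k = some L → ¬ Bad r d L (ω (t₀ + 1 + k)) := by
  have h1 := hal (k + 1)
  obtain ⟨L, hL⟩ := Option.ne_none_iff_exists'.1 (hal k)
  rw [lastStop, hL, updateLast, Option.bind_some, if_neg (not_not.2 hk)] at h1 ⊢
  by_cases hb : Bad r d L (ω (t₀ + 1 + k))
  · rw [if_pos hb] at h1
    exact absurd rfl h1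
  · rw [if_neg hb]
    refine ⟨rfl, fun L' hL' => ?_⟩
    rw [← Option.some.inj hL']
    exact hb

/-- Consecutive switching epochs of a path that follows the fluid model. -/
theorem follow_consecutive {t₀ : ℕ} {ω : ℕ → State} (hal : ∀ k, lastStop r d t₀ ω k ≠ none)
    {u t : ℕ} (hu : t₀ ≤ u) (hus : (ω u).1 (ω u).2 = 0) (hut : u < t)
    (ht : (ω t).1 (ω t).2 = 0) (hno : ∀ v, u < v → v < t → (ω v).1 (ω v).2 ≠ 0) :
    ¬ Bad r d (ω u) (ω t) := by
  obtain ⟨a, rfl⟩ := Nat.exists_eq_add_of_le hu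
  obtain ⟨b, rfl⟩ := Nat.exists_eq_add_of_le hut
  have h1 : lastStop r d t₀ ω a = some (ω (t₀ + a)) := by
    cases a with
    | zero => rfl
    | succ a =>
      have e : t₀ + (a + 1) = t₀ + 1 + a := by omega
      rw [e] at hus ⊢
      exact (lastStop_of_isEmpty hal hus).1
  have h2 := lastStop_eq_of_forall_ne h1 b fun v h3 h4 => hno _ (by omega) (by omega)
  have e : t₀ + a + 1 + b = t₀ + 1 + (a + b) := by omega
  rw [show (t₀ + a).succ + b = t₀ + 1 + (a + b) by omega] at ht ⊢
  exact (lastStop_of_isEmpty hal ht).2 _ h2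

theorem follow_mem_switchTimes {t₀ : ℕ} {ω : ℕ → State} (hal : ∀ k, lastStop r d t₀ ω k ≠ none)
    {t : ℕ} (ht₀ : t₀ < t) (ht : (ω t).1 (ω t).2 = 0) : t ∈ switchTimes ω := by
  obtain ⟨b, rfl⟩ := Nat.exists_eq_add_of_le ht₀
  refine ⟨ht, fun h0 => ?_⟩
  obtain ⟨L, hL⟩ := Option.ne_none_iff_exists'.1 (hal b)
  exact (lastStop_of_isEmpty hal ht).2 L hL (Or.inl h0)

/-- A path that follows the fluid model from a large state, in terms of its switching epochs. -/
theorem follow_tau {t₀ : ℕ} {ω : ℕ → State} (hal : ∀ k, lastStop r d t₀ ω k ≠ none)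
    (hinf : ∀ t, ∃ t', t ≤ t' ∧ (ω t').1 (ω t').2 = 0) (h0 : t₀ ∈ switchTimes ω) :
    (switchTimes ω).Infinite ∧ ∃ n₀, tau ω n₀ = t₀ ∧ ∀ k,
      ¬ Bad r d (ω (tau ω (n₀ + k))) (ω (tau ω (n₀ + k + 1))) := by
  classical
  have hi : (switchTimes ω).Infinite := by
    rw [Set.infinite_iff_exists_gt]
    intro a
    obtain ⟨t', h1, h2⟩ := hinf (max a t₀ + 1)
    exact ⟨t', follow_mem_switchTimes hal (by omega) h2, by omega⟩
  have hi' : {n | n ∈ switchTimes ω}.Infinite := hi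
  have hmem : ∀ n, tau ω n ∈ switchTimes ω := fun n => Nat.nth_mem_of_infinite hi' n
  have hmono : StrictMono (tau ω) := Nat.nth_strictMono hi'
  -- The epoch `t₀` is itself a switching epoch; its index is the number of earlier ones.
  refine ⟨hi, Nat.count (· ∈ switchTimes ω) t₀, Nat.nth_count h0, fun k => ?_⟩
  set n₀ := Nat.count (· ∈ switchTimes ω) t₀
  have ht₀ : tau ω n₀ = t₀ := Nat.nth_count h0
  have hle : t₀ ≤ tau ω (n₀ + k) := by
    rw [← ht₀]; exact hmono.monotone (by omega)
  refine follow_consecutive hal hle (hmem _).1 (hmono (by omega)) (hmem _).1 fun v h1 h2 h3 => ?_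
  have h4 := follow_mem_switchTimes hal (lt_of_le_of_lt hle h1) h3
  have h5 : v ≤ tau ω (n₀ + k) := Nat.le_nth_of_lt_nth_succ h2 h4
  omega

/-- Paths that follow the fluid model from a large state are noisy orbits in ratio coordinates. -/
theorem exists_noisyOrbit (hload : ∀ i, r.rho i < 1) (htr : 1 < ∑ i, r.rho i) {T : Fin 3 → ℝ}
    (hT : ∀ i, 0 < T i) {ε : ℝ} (hε : 0 < ε) :
    ∃ w₂ : ℝ, ∀ (y : ℕ → Fin 3 → ℕ) (i : ℕ → Fin 3),
      (∀ k, ¬ Bad r (decisionPoints r T) (y k, i k) (y (k + 1), i (k + 1))) →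
      (y 0 (i 0) = 0 ∧ 0 < y 0 (i 0 + 1) ∧ 0 < y 0 (i 0 + 2)) → w₂ ≤ work r (toReal (y 0)) →
      (∀ k, y k (i k) = 0 ∧ 0 < y k (i k + 1) ∧ 0 < y k (i k + 2)) ∧
      ∃ e, NoisyOrbit r.beta T i (fun k => ratio r (i k) (toReal (y k))) e ∧ ∀ n, |e n| ≤ ε := by
  have hd := decisionPoints_mem r hT
  set d := decisionPoints r T with hdd
  obtain ⟨κ, hκ, w₀, hw₀, hgrow⟩ := exists_work_growth_of_close hload htr hd
  obtain ⟨δ, hδ, hlow⟩ := exists_target_lower_bound hload htr hd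
  -- the required precision holds for large workloads
  have prec : ∀ ε' > 0, ∃ w' > 0, ∀ (x x' : Fin 3 → ℕ) (a b : Fin 3), ¬ Bad r d (x, a) (x', b) →
      w' ≤ work r (target r b (toReal x)) →
      (0 < x' (b + 1) ∧ 0 < x' (b + 2)) ∧
      |ratio r b (toReal x') / ratio r b (target r b (toReal x)) - 1| ≤ ε' := by
    intro ε' hε'
    set η := min (1 / 2) (ε' / 4) with hη
    have hη0 : 0 < η := lt_min (by norm_num) (by positivity)
    -- Nonempty target queues are at least `δ` times the workload, so a deviation of `η * δ` times
    -- the workload has relative size at most `η`. The ratio then errs by at most `4 * η ≤ ε'`.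
    obtain ⟨w', hw', h⟩ := exists_abs_le_of_sum_sq_le (η := η * δ) (by positivity)
    refine ⟨w', hw', fun x x' a b hbad hw => ?_⟩
    unfold Bad at hbad
    push Not at hbad
    obtain ⟨-, hall, hcl⟩ := hbad
    simp only at hall hcl hw
    set c := target r b (toReal x) with hc
    have hwpos : 0 < work r c := hw'.trans_le hw
    have h1 := h _ hw (fun i => toReal x' i - c i) hcl
    have h2 : ∀ k, k ≠ b → 0 < c k ∧ |toReal x' k - c k| ≤ η * c k := fun k hk => by
      have h3 := hlow x a b hall k hk
      refine ⟨lt_of_lt_of_le (mul_pos hδ hwpos) h3, (h1 k).trans ?_⟩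
      rw [mul_assoc]
      gcongr
    obtain ⟨p1, q1⟩ := h2 _ (fin_add_one_ne b)
    obtain ⟨p2, q2⟩ := h2 _ (fin_add_two_ne b)
    obtain ⟨x1, x2, x3⟩ := abs_ratio_sub_one_le p2 p1 (min_le_left _ _) q2 q1
    refine ⟨⟨Nat.cast_pos.1 x2, Nat.cast_pos.1 x1⟩, ?_⟩
    have l1 := r.lam_pos' (b + 1)
    have l2 := r.lam_pos' (b + 2)
    have e1 : ratio r b (toReal x') / ratio r b c =
        (toReal x' (b + 2) / toReal x' (b + 1)) / (c (b + 2) / c (b + 1)) := by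
      unfold ratio
      field_simp
    rw [e1]
    refine x3.trans ?_
    have := min_le_right (1 / 2) (ε' / 4)
    linarith
  obtain ⟨w', hw', hprec⟩ := prec ε hε
  refine ⟨max w₀ w', fun y i hbad hy0 hw => ?_⟩
  set W : ℕ → ℝ := fun k => work r (target r (i (k + 1)) (toReal (y k))) with hW
  have hbad' : ∀ k, y (k + 1) ≠ 0 ∧ Allowed d (y k) (i k) (i (k + 1)) ∧
      ∑ m, (toReal (y (k + 1)) m - target r (i (k + 1)) (toReal (y k)) m) ^ 2 ≤
        W k * √(W k) := fun k => by
    have := hbad k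
    unfold Bad at this
    push Not at this
    exact this
  have hWk : ∀ k, max w₀ w' ≤ W k ∧ κ ^ k * max w₀ w' ≤ W k := by
    have hm : 0 < max w₀ w' := lt_max_of_lt_left hw₀
    have hpow : ∀ k, κ ^ k * max w₀ w' ≤ W k := by
      intro k
      induction k with
      | zero =>
        rw [pow_zero, one_mul]
        exact hw.trans (target_work_pos hload htr _ (hbad' 0).2.1.2.1).2
      | succ k ih =>
        have hk : w₀ ≤ W k := by
          refine (le_max_left w₀ w').trans (le_trans ?_ ih)
          exact le_mul_of_one_le_left hm.le (one_le_pow₀ hκ.le)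
        have := hgrow _ hk _ (hbad' k).2.2 _ _ (hbad' (k + 1)).2.1
        calc κ ^ (k + 1) * max w₀ w' = κ * (κ ^ k * max w₀ w') := by ring
          _ ≤ κ * W k := by gcongr
          _ ≤ _ := this
    intro k
    refine ⟨le_trans ?_ (hpow k), hpow k⟩
    exact le_mul_of_one_le_left hm.le (one_le_pow₀ hκ.le)
  -- Geometric growth of the workload makes the noise vanish.
  have hWlim : Tendsto W atTop atTop := by
    refine tendsto_atTop_mono (fun k => (hWk k).2) ?_
    exact (tendsto_pow_atTop_atTop_of_one_lt hκ).atTop_mul_const (lt_max_of_lt_left hw₀)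
  have hpos : ∀ k, y k (i k) = 0 ∧ 0 < y k (i k + 1) ∧ 0 < y k (i k + 2) := by
    intro k
    cases k with
    | zero => exact hy0
    | succ k =>
      exact ⟨(hbad' (k + 1)).2.1.1,
        (hprec _ _ _ _ (hbad k) ((le_max_right _ _).trans (hWk k).1)).1⟩
  -- The noise is by definition the relative error of the ratio with respect to its exact fluid
  -- image.
  refine ⟨hpos, fun k => ratio r (i (k + 1)) (toReal (y (k + 1))) /
    ratio r (i (k + 1)) (target r (i (k + 1)) (toReal (y k))) - 1, ⟨?_, ?_, ?_⟩, ?_⟩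
  · intro k
    exact ratio_pos (Nat.cast_pos.2 (hpos k).2.1) (Nat.cast_pos.2 (hpos k).2.2)
  · rw [Metric.tendsto_atTop]
    intro ε' hε'
    obtain ⟨w'', -, h⟩ := prec (ε' / 2) (by positivity)
    obtain ⟨N, hN⟩ := eventually_atTop.1 (hWlim.eventually_ge_atTop w'')
    refine ⟨N, fun n hn => ?_⟩
    rw [Real.dist_eq, sub_zero]
    exact lt_of_le_of_lt (h _ _ _ _ (hbad n) (hN n hn)).2 (by linarith)
  · intro k
    have z0 : toReal (y k) (i k) = 0 := by simp [toReal, (hpos k).1]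
    have z1 : 0 < toReal (y k) (i k + 1) := Nat.cast_pos.2 (hpos k).2.1
    have z2 : 0 < toReal (y k) (i k + 2) := Nat.cast_pos.2 (hpos k).2.2
    have hR := ratio_pos (r := r) z1 z2
    have hpr := proj_eq_sidePoint (r := r) z0 z1 z2
    rcases (hbad' k).2.1.2.2 with ⟨h1, h2⟩ | ⟨h1, h2⟩
    · left
      rw [hdd, decisionPoints_eq, hpr, sidePoint_two_strictMono r _ hR (hT _)] at h2
      refine ⟨h2, h1, ?_⟩
      have h3 := ratio_target_up hload z0 z1 z2
      have h4 : 0 < ratioUp (r.beta (i k + 1)) (ratio r (i k) (toReal (y k))) :=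
        ratioUp_pos (Rates.beta_pos hload _) hR
      simp only [h1]
      rw [h3]
      field_simp
      ring
    · right
      rw [hdd, decisionPoints_eq, hpr, sidePoint_two_strictMono r _ (hT _) hR] at h2
      refine ⟨h2, h1, ?_⟩
      have h3 := ratio_target_down hload z0 z2
      have h4 : 0 < ratioDown (r.beta (i k + 2)) (ratio r (i k) (toReal (y k))) :=
        zero_lt_one.trans (one_lt_ratioDown (Rates.beta_pos hload _) hR)
      simp only [h1]
      rw [h3]
      field_simp
      ring
  · intro n
    exact (hprec _ _ _ _ (hbad n) ((le_max_right _ _).trans (hWk n).1)).2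

/-! ### Initial states, the periodic orbit, and the conclusion -/

/-- Queue length vectors with large workload and prescribed approximate ratio on side `0`. -/
theorem exists_state_ratio_near (r : Rates) {v ε : ℝ} (hv : 0 < v) (hε : 0 < ε) (w : ℝ) :
    ∃ y : Fin 3 → ℕ, y 0 = 0 ∧ 0 < y 1 ∧ 0 < y 2 ∧ |ratio r 0 (toReal y) - v| < ε ∧
      w ≤ work r (toReal y) := by
  have l1 := r.lam_pos' 1
  have l2 := r.lam_pos' 2
  have m1 := r.mu_pos' 1
  have m2 := r.mu_pos' 2
  -- The queues are `λ₁ N` and `λ₂ v N` rounded up, with `N` large.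
  have t1 := tendsto_nat_ceil_mul_div_atTop (R := ℝ) l1.le
  have t2 := tendsto_nat_ceil_mul_div_atTop (R := ℝ) (mul_pos l2 hv).le
  have t3 := (t2.div_const (r.lam 2 : ℝ)).div (t1.div_const (r.lam 1 : ℝ)) (by positivity)
  have e : (r.lam 2 * v / r.lam 2 : ℝ) / (r.lam 1 / r.lam 1) = v := by field_simp
  rw [e] at t3
  have ev1 := (Metric.tendsto_nhds.1 t3) ε hε
  obtain ⟨N, h1, h2, h3⟩ := (ev1.and ((eventually_gt_atTop 0).and
    (eventually_ge_atTop (w * r.mu 1 / r.lam 1)))).exists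
  have c1 := Nat.le_ceil (r.lam 1 * N : ℝ)
  refine ⟨![0, ⌈(r.lam 1 * N : ℝ)⌉₊, ⌈(r.lam 2 * v * N : ℝ)⌉₊], rfl, ?_, ?_, ?_, ?_⟩
  · exact Nat.ceil_pos.2 (by positivity)
  · exact Nat.ceil_pos.2 (by positivity)
  · rw [Real.dist_eq] at h1
    convert h1 using 3
    have hp : (0 : ℝ) < ⌈(r.lam 1 * N : ℝ)⌉₊ := Nat.cast_pos.2 (Nat.ceil_pos.2 (by positivity))
    simp only [ratio, toReal, zero_add, Pi.div_apply, Matrix.cons_val]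
    field_simp
  · simp only [work, toReal, Fin.sum_univ_three, Matrix.cons_val, Nat.cast_zero, zero_div, zero_add]
    have h4 : w ≤ ⌈(r.lam 1 * N : ℝ)⌉₊ / (r.mu 1 : ℝ) := by
      rw [le_div_iff₀ m1]
      rw [div_le_iff₀ l1] at h3
      linarith
    have : (0 : ℝ) ≤ ⌈(r.lam 2 * v * N : ℝ)⌉₊ / (r.mu 2 : ℝ) := by positivity
    linarith

/-- This links the maps of the triangle process to the ratio dynamics; the cycle needs it for down
steps only. -/
theorem serve_sidePoint (hload : ∀ i, r.rho i < 1) (i : Fin 3) {R : ℝ} (hR : 0 < R) :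
    serve r (i + 2) (sidePoint r i R) =
      sidePoint r (i + 2) (ratioDown (r.beta (i + 2)) R) := by
  have l0 := r.lam_pos' i
  have l1 := r.lam_pos' (i + 1)
  have l2 := r.lam_pos' (i + 2)
  have hmu := r.mu_pos' (i + 2)
  have hlt := Rates.lam_lt_mu hload (i + 2)
  have hb := Rates.beta_pos hload (i + 2)
  have hden : (r.mu (i + 2) - r.lam (i + 2) : ℝ) +
      r.mu (i + 2) * r.theta (i + 2) * sidePoint r i R (i + 2) =
      ((r.mu (i + 2) - r.lam (i + 2)) * (r.lam (i + 1)) +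
        (r.lam i + r.lam (i + 1)) * (r.lam (i + 2) * R)) /
        (r.lam (i + 1) + r.lam (i + 2) * R) := by
    rw [sidePoint_two, Rates.theta, sum_cyclic (fun k => (r.lam k : ℝ)) i]
    field_simp
    ring
  have hsub : (0 : ℝ) < r.mu (i + 2) - r.lam (i + 2) := sub_pos.2 hlt
  ext k
  rcases fin_cases_cyclic (i + 2) k with rfl | rfl | rfl
  · rw [sidePoint_self, serve, if_pos rfl]
  · rw [sidePoint_one, serve, if_neg (fin_add_one_ne _), hden]
    simp only [fin_two_one, fin_two_two, sidePoint_self, sidePoint_two, ratioDown, Rates.beta]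
    set m : ℝ := r.mu (i + 2) - r.lam (i + 2)
    field_simp
    ring
  · rw [sidePoint_two, serve, if_neg (fin_add_two_ne _), hden]
    simp only [fin_two_one, fin_two_two, sidePoint_one, sidePoint_two, ratioDown, Rates.beta]
    set m : ℝ := r.mu (i + 2) - r.lam (i + 2)
    field_simp
    ring

theorem sidePoint_mem_triangle (r : Rates) (i : Fin 3) {R : ℝ} (hR : 0 < R) :
    sidePoint r i R ∈ Triangle := by
  have l1 := r.lam_pos' (i + 1)
  have l2 := r.lam_pos' (i + 2)
  refine ⟨fun k => ?_, ?_, i, sidePoint_self r i R⟩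
  · rcases fin_cases_cyclic i k with rfl | rfl | rfl
    · rw [sidePoint_self]
    · rw [sidePoint_one]; positivity
    · rw [sidePoint_two]; positivity
  · rw [sum_cyclic _ i, sidePoint_self, sidePoint_one, sidePoint_two]
    field_simp
    ring

/-- The periodic orbit of period three that visits the sides in decreasing order. -/
theorem isPeriodicOrbit_sidePoint (hload : ∀ i, r.rho i < 1) {T v : Fin 3 → ℝ}
    (hT : ∀ i, 0 < T i) (hTv : ∀ i, T i < v i)
    (hv : ∀ i, v (i + 2) = ratioDown (r.beta (i + 2)) (v i)) :
    IsPeriodicOrbit r (decisionPoints r T) 3 fun n => sidePoint r (2 * n) (v (2 * n)) := by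
  have hv0 : ∀ i, 0 < v i := fun i => (hT i).trans (hTv i)
  refine ⟨fun n => sidePoint_mem_triangle r _ (hv0 _), fun n => ?_⟩
  -- In `Fin 3` the index `2 * n` runs through `0, 2, 1`, and raising `n` by one is a down step,
  -- also at the closing of the cycle.
  refine ⟨2 * n, sidePoint_self _ _ _, Or.inr ⟨?_, ?_⟩⟩
  · rw [decisionPoints_eq, sidePoint_two_strictMono r _ (hT _) (hv0 _)]
    exact (hTv _).le
  · simp only [serve_sidePoint hload _ (hv0 _), ← hv, mul_add, mul_one]

theorem tendsto_dist₁_sidePoint (r : Rates) (i : Fin 3) {R : ℕ → ℝ} {v : ℝ} (hv : 0 < v)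
    (hR : Tendsto R atTop (𝓝 v)) :
    Tendsto (fun t => dist₁ (sidePoint r i (R t)) (sidePoint r i v)) atTop (𝓝 0) := by
  have l1 := r.lam_pos' (i + 1)
  have l2 := r.lam_pos' (i + 2)
  have hne : (r.lam (i + 1) + r.lam (i + 2) * v : ℝ) ≠ 0 := by positivity
  have hden := (hR.const_mul (r.lam (i + 2) : ℝ)).const_add (r.lam (i + 1) : ℝ)
  have hc : ∀ k, Tendsto (fun t => sidePoint r i (R t) k) atTop (𝓝 (sidePoint r i v k)) := by
    intro k
    rcases fin_cases_cyclic i k with rfl | rfl | rfl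
    · simp only [sidePoint_self]
      exact tendsto_const_nhds
    · simp only [sidePoint_one]
      exact tendsto_const_nhds.div hden hne
    · simp only [sidePoint_two]
      exact (hR.const_mul _).div hden hne
  have h1 : Tendsto (fun t => ∑ k, (sidePoint r i (R t) k - sidePoint r i v k) ^ 2) atTop
      (𝓝 (∑ k, (sidePoint r i v k - sidePoint r i v k) ^ 2)) :=
    tendsto_finsetSum _ fun k _ => ((hc k).sub_const _).pow 2
  have h2 := ((Real.continuous_sqrt.tendsto _).comp h1).div_const (√2)
  simpa [dist₁] using h2

/-- With positive probability the path is a noisy orbit with any prescribed approximate initial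
ratio and any prescribed precision. -/
theorem chainLaw_noisyOrbit_pos (hload : ∀ i, r.rho i < 1) (htr : 1 < ∑ i, r.rho i)
    {T : Fin 3 → ℝ} (hT : ∀ i, 0 < T i) {R₀ ε δ : ℝ} (hR₀ : 0 < R₀) (hε : 0 < ε) (hδ : 0 < δ)
    (S : ServiceLaws r) (tie : TieRule) (s₀ : State) :
    0 < chainLaw S (decisionPoints r T) tie s₀ {ω | (switchTimes ω).Infinite ∧
      ∃ (n₀ : ℕ) (R e : ℕ → ℝ), NoisyOrbit r.beta T (fun k => zetaSide ω (n₀ + k)) R e ∧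
        (∀ n, |e n| ≤ ε) ∧ zetaSide ω n₀ = 0 ∧ |R 0 - R₀| < δ ∧
        ∀ k, zeta ω (n₀ + k) = sidePoint r (zetaSide ω (n₀ + k)) (R k)} := by
  obtain ⟨w₁, hfollow⟩ := exists_follow hload htr (decisionPoints_mem r hT) S
  obtain ⟨w₂, hnoisy⟩ := exists_noisyOrbit hload htr hT hε
  obtain ⟨y, y0, y1, y2, hRy, hw⟩ := exists_state_ratio_near r hR₀ hδ (max w₁ w₂)
  have hy : y ≠ 0 := fun h => by simp [h] at y1
  obtain ⟨t₀, ht₀⟩ := hfollow tie s₀ (y, 0) y0 hy ((le_max_left _ _).trans hw)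
  -- Monotonicity of the measure holds for arbitrary sets, so the larger event need not be
  -- measurable.
  refine ht₀.trans_le (measure_mono ?_)
  rintro ω ⟨h0, hal, hinf⟩
  obtain ⟨hi, n₀, hn₀, hbad⟩ := follow_tau hal hinf (by
    change (ω t₀).1 (ω t₀).2 = 0 ∧ (ω t₀).1 ≠ 0
    rw [h0]
    exact ⟨y0, hy⟩)
  have hst : ω (tau ω n₀) = (y, 0) := by rw [hn₀, h0]
  obtain ⟨hpos, e, hno, he⟩ := hnoisy (fun k => (ω (tau ω (n₀ + k))).1)
    (fun k => (ω (tau ω (n₀ + k))).2) hbad (by simpa [hst] using ⟨y0, y1, y2⟩)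
    (by simpa [hst] using (le_max_right w₁ w₂).trans hw)
  refine ⟨hi, n₀, _, e, hno, he, ?_, ?_, fun k => ?_⟩
  · rw [zetaSide, hst]
  · simpa [hst] using hRy
  · obtain ⟨p0, p1, p2⟩ := hpos k
    exact proj_eq_sidePoint (Nat.cast_eq_zero.2 p0) (Nat.cast_pos.2 p1) (Nat.cast_pos.2 p2)

end Polling

theorem theorem3p5 (r : Polling.Rates) (hload : ∀ i, r.rho i < 1)
    (htransient : 1 < ∑ i, r.rho i) :
    ∃ d : Fin 3 → ℝ, (∀ i, d i ∈ Set.Ioo (0 : ℝ) 1) ∧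
      ∀ (S : Polling.ServiceLaws r) (tie : Polling.TieRule) (s₀ : Polling.State),
        0 < Polling.chainLaw S d tie s₀ Polling.zetaNonperiodic ∧
        ∃ (m : ℕ) (_ : NeZero m) (u : Fin m → Fin 3 → ℝ),
          Polling.IsPeriodicOrbit r d m u ∧
          0 < Polling.chainLaw S d tie s₀ (Polling.zetaConvergesOnto m u) := by
  open Polling in
  have hβ := Rates.beta_pos hload
  obtain ⟨T, v, hT, hTv, hv, ε, hε, hnon⟩ := exists_thresholds hβ
  have hv0 : ∀ i, 0 < v i := fun i => (hT i).trans (hTv i)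
  obtain ⟨ε', hε', hcyc⟩ := noisyOrbit_tendsto_cycle hβ hv0 hTv hv
  refine ⟨decisionPoints r T, decisionPoints_mem r hT, fun S tie s₀ => ⟨?_, 3, inferInstance,
    fun n => sidePoint r (2 * n) (v (2 * n)), isPeriodicOrbit_sidePoint hload hT hTv hv, ?_⟩⟩
  -- Starting near ratio `1` on side `0` leads into the contracted rotation; starting near `v 0`
  -- leads to the cycle.
  · refine (chainLaw_noisyOrbit_pos hload htransient hT one_pos hε hε S tie s₀).trans_le
      (measure_mono ?_)
    rintro ω ⟨hi, n₀, R, e, hno, he, hs, hR, -⟩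
    refine ⟨hi, fun m hm ⟨N, hN⟩ => hnon _ R e hno he hs hR m hm ⟨N, fun n hn => ?_⟩⟩
    simpa only [add_assoc] using hN (n₀ + n) (by omega)
  · refine (chainLaw_noisyOrbit_pos hload htransient hT (hv0 0) hε' (mul_pos hε' (hv0 0)) S tie
      s₀).trans_le (measure_mono ?_)
    rintro ω ⟨hi, n₀, R, e, hno, he, hs, hR, hz⟩
    obtain ⟨hstep, hlim⟩ := hcyc _ R e hno he (by simpa [hs] using hR)
    have hzero : ∀ t, zetaSide ω (n₀ + 3 * t) = 0 := by
      intro t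
      induction t with
      | zero => exact hs
      | succ t ih =>
        rw [mul_add, hstep (3 * t + 2), hstep (3 * t + 1), hstep (3 * t), ih]
        rfl
    have hside : ∀ (t : ℕ) (n : Fin 3), zetaSide ω (n₀ + (3 * t + n)) = 2 * n := by
      intro t n
      fin_cases n
      · exact hzero t
      · exact (hstep _).trans (by rw [hzero]; rfl)
      · exact (hstep _).trans (by rw [hstep, hzero]; rfl)
    refine ⟨hi, n₀, fun n => ?_⟩
    have htop : Tendsto (fun t : ℕ => 3 * t + (n : ℕ)) atTop atTop :=
      tendsto_atTop_mono (fun t => show t ≤ 3 * t + n by omega) tendsto_id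
    have hsub : Tendsto (fun t : ℕ => R (3 * t + n)) atTop (𝓝 (v (2 * n))) := by
      have h1 := (hlim.comp htop).add_const (v (2 * n))
      simpa only [Function.comp_def, hside, sub_add_cancel, zero_add] using h1
    refine (tendsto_dist₁_sidePoint r (2 * n) (hv0 _) hsub).congr fun t => ?_
    rw [add_comm _ n₀, hz, hside]
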